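/- Let $X=L^1(\mathbb R)\cap L^2(\mathbb R)$ with norm $\|f\|_X=\|f\|_{L^1}+\|f\|_{L^2}$, and let $\widehat X$ be the space of the Fourier transforms $\widehat f(\xi)=\int_{\mathbb R}e^{2i\xi x}f(x)\,dx$, $f\in X$, with $\|\widehat f\|_{\widehat X}=\|f\|_X$. Let $\mathcal R_{>0}$ be the set of all $r\in\widehat X$ such that $r(-k)=\overline{r(k)}$ for all $k\in\mathbb R$, $|r(k)|<1$ for $k\neq0$, $r(0)=-1$, and $\widetilde r(k):=(1-|r(k)|^2)/k^2$ (extended by its limit to $k=0$) belongs to $\widehat X$ and satisfies $\widetilde r(0)>0$. Equip $\mathcal R_{>0}$ with the metric $d(r_1,r_2)=\|r_1-r_2\|_{\widehat X}+\|\widetilde r_1-\widetilde r_2\|_{\widehat X}$. Let $(\mathcal Cf)(z)=\frac1{2\pi i}\int_{\mathbb R}\frac{f(s)}{s-z}\,ds$ for $z\in\mathbb C\setminus\mathbb R$, and let $\mathcal C_+f=\lim_{\varepsilon\downarrow0}(\mathcal Cf)(\cdot+i\varepsilon)$, the limit being taken in $L^2(\mathbb R)$ and identified with its continuous representative. A generic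 Miura potential is a real distribution $q\in H^{-1}(\mathbb R)$ such that $q=u_+'+u_+^2=u_-'+u_-^2$ for real functions $u_+\in L^2(\mathbb R)\cap L^1(0,\infty)$ and $u_-\in L^2(\mathbb R)\cap L^1(-\infty,0)$ that are not equal almost everywhere. For such $q$ and real $k\ne0$, let $f_\pm(\cdot,k)\in H^1_{\rm loc}(\mathbb R)$ be the Jost solutions, i.e. the weak solutions of $-y''+qy=k^2y$ with $f_\pm(x,k)-e^{\pm ikx}\to0$ as $x\to\pm\infty$. Define $a(k)$, $b(k)$ by $f_+(x,k)=a(k)f_-(x,-k)+b(k)f_-(x,k)$ for all $x\in\mathbb R$. The right and left reflection coefficients of $q$ are $r_+(k)=-b(-k)/a(k)$ and $r_-(k)=b(k)/a(k)$. **Proposition.** For every $r\in\mathcal R_{>0}$ the function $\log\bigl[(1-|r(k)|^2)\frac{k^2+1}{k^2}\bigr]$ belongs to $\widehat X$ and $\mathcal C_+$ is defined on it. Let $$\widetilde t=\exp\Bigl\{\mathcal C_+\log\Bigl[(1-|r(k)|^2)\frac{k^2+1}{k^2}\Bigr]\Bigr\},\qquad t(k)=\frac{k\,\widetilde t(k)}{k+i}.$$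 Then the nonlinear map $$\mathcal I:\ r\mapsto r^\#,\qquad r^\#(k)=-\frac{t(k)}{t(-k)}\,r(-k)\quad(k\ne0),\qquad r^\#(0)=-1,$$ is a continuous involution of $\mathcal R_{>0}$. It maps each reflection coefficient to the other one: for every generic Miura potential $q$, the Jost solutions and the coefficients $a(k)\neq0$, $b(k)$ exist for real $k\ne0$, the functions $r_\pm$, extended to $k=0$ by the value $-1$, belong to $\mathcal R_{>0}$, and $\mathcal I r_+=r_-$, $\mathcal I r_-=r_+$. -/

import Mathlib

open Filter Topology MeasureTheory Set
open scoped ENNReal Distributions ComplexConjugate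

noncomputable section

namespace MiuraScattering

/-! ### The Banach algebra of Fourier transforms of functions in `L¹ ∩ L²` -/

/-- The space `X = L¹(ℝ) ∩ L²(ℝ)`. -/
def MemX (f : ℝ → ℂ) : Prop := MemLp f 1 volume ∧ MemLp f 2 volume

/-- The norm `‖f‖_X = ‖f‖_{L¹} + ‖f‖_{L²}`. -/
def normX (f : ℝ → ℂ) : ℝ≥0∞ := eLpNorm f 1 volume + eLpNorm f 2 volume

/-- The Fourier transform, normalized as `ξ ↦ ∫ exp (2 i ξ x) f x dx`. -/
def fourierX (f : ℝ → ℂ) (ξ : ℝ) : ℂ :=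
  ∫ x : ℝ, Complex.exp (2 * Complex.I * (ξ : ℂ) * (x : ℂ)) * f x

/-- The space `X̂` of Fourier transforms of functions in `X` (as functions on `ℝ`). -/
def MemXhat (g : ℝ → ℂ) : Prop := ∃ f : ℝ → ℂ, MemX f ∧ fourierX f = g

/-- The norm of `X̂`: `‖f̂‖_X̂ = ‖f‖_X`. As `f` is determined by `f̂` up to a null set, the infimum is
over equal numbers; outside `X̂` the value is `∞`. -/
def normXhat (g : ℝ → ℂ) : ℝ≥0∞ :=
  ⨅ (f : ℝ → ℂ) (_ : MemX f ∧ fourierX f = g), normX f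

/-! ### The class of reflection coefficients -/

/-- The function `r̃(k) = (1 - |r(k)|²) / k²`, with the limit of the quotient as its value at
`k = 0`. (If there is no limit, then the function is not continuous, hence not in `X̂`,
whatever the value at `0`.) -/
def rTilde (r : ℝ → ℂ) : ℝ → ℝ :=
  Function.update (fun k => (1 - ‖r k‖ ^ 2) / k ^ 2) 0
    (limUnder (𝓝[≠] (0 : ℝ)) fun k => (1 - ‖r k‖ ^ 2) / k ^ 2)

/-- Membership in `𝓡`: `r ∈ X̂`, `r(-k)` is the conjugate of `r(k)`, and `|r(k)| < 1` for
`k ≠ 0`. -/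
structure MemR (r : ℝ → ℂ) : Prop where
  memXhat : MemXhat r
  conj_symm : ∀ k, r (-k) = conj (r k)
  norm_lt_one : ∀ k, k ≠ 0 → ‖r k‖ < 1

/-- The set `𝓡_{>0}`, as a type. -/
@[ext] structure RPos where
  /-- the function `k ↦ r(k)` -/
  toFun : ℝ → ℂ
  memR : MemR toFun
  apply_zero : toFun 0 = -1
  tilde_memXhat : MemXhat fun k => (rTilde toFun k : ℂ)
  tilde_zero_pos : 0 < rTilde toFun 0

instance : CoeFun RPos fun _ => ℝ → ℂ := ⟨RPos.toFun⟩

/-! ### Facts needed for the metric of `𝓡_{>0}` -/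

lemma normXhat_zero : normXhat (fun _ => 0) = 0 := by
  refine le_antisymm ?_ bot_le
  have h : fourierX (fun _ => 0) = fun _ => 0 := by
    funext ξ
    simp [fourierX]
  refine (iInf₂_le (fun _ => (0 : ℂ)) ⟨⟨MemLp.zero, MemLp.zero⟩, h⟩).trans ?_
  simp [normX]

lemma normXhat_neg_le (g : ℝ → ℂ) : normXhat (fun k => -g k) ≤ normXhat g := by
  refine le_iInf₂ fun f hf => ?_
  have h : fourierX (-f) = fun k => -g k := by
    funext ξ
    rw [← hf.2]
    simp [fourierX, integral_neg]
  refine (iInf₂_le (-f) ⟨⟨hf.1.1.neg, hf.1.2.neg⟩, h⟩).trans ?_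
  simp [normX, eLpNorm_neg]

lemma integrable_fourierX {f : ℝ → ℂ} (hf : MemX f) (ξ : ℝ) :
    Integrable fun x : ℝ => Complex.exp (2 * Complex.I * (ξ : ℂ) * (x : ℂ)) * f x := by
  refine (memLp_one_iff_integrable.1 hf.1).bdd_mul (c := 1) ?_ ?_
  · exact Continuous.aestronglyMeasurable (by fun_prop)
  · refine Eventually.of_forall fun x => ?_
    rw [Complex.norm_exp]
    simp

lemma normXhat_add_le (g h : ℝ → ℂ) :
    normXhat (fun k => g k + h k) ≤ normXhat g + normXhat h := by
  have key : ∀ f e : ℝ → ℂ, MemX f ∧ fourierX f = g → MemX e ∧ fourierX e = h →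
      normXhat (fun k => g k + h k) ≤ normX f + normX e := by
    intro f e hf he
    have hfe : fourierX (f + e) = fun k => g k + h k := by
      funext ξ
      rw [← hf.2, ← he.2]
      simp only [fourierX, Pi.add_apply, mul_add]
      exact integral_add (integrable_fourierX hf.1 ξ) (integrable_fourierX he.1 ξ)
    refine (iInf₂_le (f + e) ⟨⟨hf.1.1.add he.1.1, hf.1.2.add he.1.2⟩, hfe⟩).trans ?_
    simp only [normX]
    calc eLpNorm (f + e) 1 volume + eLpNorm (f + e) 2 volume
        ≤ (eLpNorm f 1 volume + eLpNorm e 1 volume)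
          + (eLpNorm f 2 volume + eLpNorm e 2 volume) :=
          add_le_add (eLpNorm_add_le hf.1.1.1 he.1.1.1 le_rfl)
            (eLpNorm_add_le hf.1.2.1 he.1.2.1 one_le_two)
      _ = _ := by ring
  rw [normXhat.eq_def g, normXhat.eq_def h]
  simp only [ENNReal.iInf_add, ENNReal.add_iInf]
  exact le_iInf₂ fun f hf => le_iInf₂ fun e he => key _ _ (by assumption) (by assumption)

lemma normXhat_sub_comm (g h : ℝ → ℂ) :
    normXhat (fun k => g k - h k) = normXhat (fun k => h k - g k) := by
  refine le_antisymm ?_ ?_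
  · simpa using normXhat_neg_le fun k => h k - g k
  · simpa using normXhat_neg_le fun k => g k - h k

lemma normXhat_sub_triangle (f g h : ℝ → ℂ) :
    normXhat (fun k => f k - h k)
      ≤ normXhat (fun k => f k - g k) + normXhat (fun k => g k - h k) := by
  simpa using normXhat_add_le (fun k => f k - g k) fun k => g k - h k

/-- The metric `d(r₁, r₂) = ‖r₁ - r₂‖_X̂ + ‖r̃₁ - r̃₂‖_X̂` of `𝓡_{>0}` and its topology. -/
instance : PseudoEMetricSpace RPos where
  edist r₁ r₂ := normXhat (fun k => r₁ k - r₂ k)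
    + normXhat (fun k => (rTilde r₁ k : ℂ) - (rTilde r₂ k : ℂ))
  edist_self r := by simp [normXhat_zero]
  edist_comm r₁ r₂ := by
    rw [normXhat_sub_comm r₁ r₂,
      normXhat_sub_comm (fun k => (rTilde r₁ k : ℂ)) fun k => (rTilde r₂ k : ℂ)]
  edist_triangle r₁ r₂ r₃ := by
    refine (add_le_add (normXhat_sub_triangle r₁ r₂ r₃)
      (normXhat_sub_triangle (fun k => (rTilde r₁ k : ℂ)) (fun k => (rTilde r₂ k : ℂ))
        fun k => (rTilde r₃ k : ℂ))).trans_eq ?_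
    ring

/-! ### The Riesz projector and the transmission coefficient -/

/-- The Cauchy integral `(𝒞 f)(z) = (2πi)⁻¹ ∫ f(s) / (s - z) ds`. -/
def cauchyIntegral (f : ℝ → ℂ) (z : ℂ) : ℂ :=
  (2 * (Real.pi : ℂ) * Complex.I)⁻¹ * ∫ s : ℝ, f s / ((s : ℂ) - z)

/-- `g` is the continuous representative of the limit in `L²(ℝ)` of `(𝒞 f)(· + iε)` as `ε ↓ 0`. -/
def IsCauchyPlus (f g : ℝ → ℂ) : Prop :=
  Continuous g ∧
    Tendsto (fun ε : ℝ =>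
      eLpNorm (fun s : ℝ => cauchyIntegral f ((s : ℂ) + (ε : ℂ) * Complex.I) - g s) 2 volume)
      (𝓝[>] 0) (𝓝 0)

/-- The Riesz projector `𝒞₊ f`, as a continuous function. -/
def cauchyPlus (f : ℝ → ℂ) : ℝ → ℂ := Classical.epsilon (IsCauchyPlus f)

/-- The function `log [(1 - |r(k)|²) (k² + 1) / k²] = log [(k² + 1) r̃(k)]`. -/
def logSymbol (r : ℝ → ℂ) (k : ℝ) : ℂ := (Real.log ((k ^ 2 + 1) * rTilde r k) : ℝ)

/-- `t̃ = exp (𝒞₊ log [(1 - |r(k)|²) (k² + 1) / k²])`. -/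
def tTilde (r : ℝ → ℂ) (k : ℝ) : ℂ := Complex.exp (cauchyPlus (logSymbol r) k)

/-- `t(k) = k t̃(k) / (k + i)`. -/
def transmission (r : ℝ → ℂ) (k : ℝ) : ℂ := (k : ℂ) * tTilde r k / ((k : ℂ) + Complex.I)

/-! ### Generic Miura potentials and their reflection coefficients -/

/-- `q` belongs to `H⁻¹(ℝ)`: it is bounded with respect to the norm of `H¹(ℝ)`. -/
def MemHMinusOne (q : 𝓓'((⊤ : TopologicalSpace.Opens ℝ), ℝ)) : Prop :=
  ∃ C : ℝ, ∀ φ : 𝓓((⊤ : TopologicalSpace.Opens ℝ), ℝ),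
    |q φ| ≤ C * √((∫ x, φ x ^ 2) + ∫ x, deriv φ x ^ 2)

/-- `q = u' + u²` in the sense of distributions. -/
def IsRiccatiRep (q : 𝓓'((⊤ : TopologicalSpace.Opens ℝ), ℝ)) (u : ℝ → ℝ) : Prop :=
  ∀ φ : 𝓓((⊤ : TopologicalSpace.Opens ℝ), ℝ),
    q φ = ∫ x, (-(u x) * deriv φ x + u x ^ 2 * φ x)

/-- `q` is a generic Miura potential, `q ∈ 𝓠_{>0}`: a real distribution in `H⁻¹(ℝ)` with Riccati
representatives `u₊ ∈ L²(ℝ) ∩ L¹(0, ∞)` and `u₋ ∈ L²(ℝ) ∩ L¹(-∞, 0)` that are distinct. (They are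
the extremal ones, and `q` determines them up to null sets.) -/
def IsGenericMiura (q : 𝓓'((⊤ : TopologicalSpace.Opens ℝ), ℝ)) : Prop :=
  MemHMinusOne q ∧ ∃ uPlus uMinus : ℝ → ℝ,
    MemLp uPlus 2 volume ∧ IntegrableOn uPlus (Ioi 0) ∧ IsRiccatiRep q uPlus ∧
    MemLp uMinus 2 volume ∧ IntegrableOn uMinus (Iio 0) ∧ IsRiccatiRep q uMinus ∧
    ¬ uPlus =ᵐ[volume] uMinus

/-- The space `L²_loc(ℝ)`. -/
def MemL2loc {F : Type*} [NormedAddCommGroup F] (f : ℝ → F) : Prop :=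
  ∀ R : ℝ, MemLp f 2 (volume.restrict (Icc (-R) R))

/-- `y` is an `H¹_loc(ℝ)` solution of `-y'' + q y = k² y` for a distribution `q` with a Riccati
representative in `L²_loc(ℝ)`: `y` has a derivative `y' ∈ L²_loc(ℝ)`, and for all test functions `φ`
`∫ y' (φ̄)' + ⟨q, y φ̄⟩ = k² ∫ y φ̄`, where `⟨q, g⟩ = ∫ (-u g' + u² g)` for compactly supported `g` in
`H¹(ℝ)`. The pairing does not depend on the Riccati representative `u`, so that it is the same to
ask this for one `u` or for all. -/
def IsSchrodingerSolution (q : 𝓓'((⊤ : TopologicalSpace.Opens ℝ), ℝ)) (k : ℝ) (y : ℝ → ℂ) :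
    Prop :=
  ∃ y' : ℝ → ℂ, MemL2loc y' ∧ (∀ x, y x = y 0 + ∫ s in (0 : ℝ)..x, y' s) ∧
    ∀ u : ℝ → ℝ, MemL2loc u → IsRiccatiRep q u →
      ∀ φ : 𝓓((⊤ : TopologicalSpace.Opens ℝ), ℂ),
        (∫ x, y' x * conj (deriv φ x))
          + ∫ x, (-(u x : ℂ) * (y' x * conj (φ x) + y x * conj (deriv φ x))
              + (u x : ℂ) ^ 2 * (y x * conj (φ x)))
          = (k : ℂ) ^ 2 * ∫ x, y x * conj (φ x)

/-- For real `k ≠ 0`, the functions `f₊(·, k)`, `f₋(·, k)` are the Jost solutions of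
`-y'' + q y = k² y`, that is `f₊(x, k) - exp (ikx) → 0` as `x → ∞` and `f₋(x, k) - exp (-ikx) → 0`
as `x → -∞`, and `a(k)`, `b(k)` are the coefficients in
`f₊(x, k) = a(k) f₋(x, -k) + b(k) f₋(x, k)`. (The values at `k = 0` play no role.) -/
structure IsScatteringData (q : 𝓓'((⊤ : TopologicalSpace.Opens ℝ), ℝ))
    (fPlus fMinus : ℝ → ℝ → ℂ) (a b : ℝ → ℂ) : Prop where
  plus_solution : ∀ k, k ≠ 0 → IsSchrodingerSolution q k fun x => fPlus x k
  plus_asymp : ∀ k : ℝ, k ≠ 0 →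
    Tendsto (fun x : ℝ => fPlus x k - Complex.exp (Complex.I * (k : ℂ) * (x : ℂ))) atTop (𝓝 0)
  minus_solution : ∀ k, k ≠ 0 → IsSchrodingerSolution q k fun x => fMinus x k
  minus_asymp : ∀ k : ℝ, k ≠ 0 →
    Tendsto (fun x : ℝ => fMinus x k - Complex.exp (-(Complex.I * (k : ℂ) * (x : ℂ)))) atBot (𝓝 0)
  relation : ∀ k, k ≠ 0 → ∀ x, fPlus x k = a k * fMinus x (-k) + b k * fMinus x k

end MiuraScattering

end

open MiuraScattering

/-! With convolution as product, `X` is a Banach algebra, and `X.hat` turns it into pointwise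
multiplication. In its unitization `A`, the functions with a limit at infinity and the rest in X̂,
the characters are the evaluations at real points and at infinity. This is Wiener's lemma
(`A.isUnit_of_ev_ne_zero`). Hence positive elements with value 1 at infinity have logarithms in `X`
that depend continuously on them (`A.IsPos.exists_isLog`, `A.continuousOn_log`). The identity (k² +
1) r̃ = 1 - |r|² + r̃ puts the symbol among these elements. By Parseval, 𝒞₊ is the restriction of
the inverse transform to (0, ∞) (`X.isCauchyPlus_hat`), a bounded operator on `X`. So log t̃ lies in
X̂ and depends continuously on r. The factors k in t(k) / t(-k) cancel and leave (k - i) / (k + i)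
times t̃(k) / t̃(-k). This is an element of `A` of modulus one on the line. Therefore r^# lies in X̂
and |r^#| = |r|, so r̃ and t are unchanged. Continuity and the involution property follow. For the
scattering part, a Jost solution is written as exp(izx)(p + m), with quasi-derivative y' - uy = iz
exp(izx)(p - m). Then p' = um and m' = -2izm + up. The corresponding Volterra equations are solved
for `X`-valued kernels (`exists_kernel`), so p(0) - 1 and m(0) are half-line transforms of elements
of `X`, for all Im z ≥ 0 at once. The left solution is obtained by the reflection x ↦ -x. The two
sides use different Riccati representatives; their difference v is absolutely continuous, and
genericity forces v(0) < 0 (`neg_of_riccati_difference`). Matching data at 0 gives k a(k) and k b(k)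
as explicit expressions `scatA` and `scatB` in the amplitudes and v(0). The conservation law |p|² -
|m|² ≥ 1 and the sign of v(0) give |z| ≤ |`scatA` z| in the closed upper half-plane
(`IsAmplitude.norm_le_scatA`). At z = 0 the term with v(0) survives. Thus k a(k) / (k + i) is a unit
of `A`, and the quotients defining r₊ and r₋ belong to the class (`exists_rPos`). Its product with
t̃ extends holomorphically to the upper half-plane, is bounded above and below, has modulus one on
the line and tends to 1. So the product is 1 and t = 1/a (`IsAmplitude.tTilde_mul`). The exchange of
r₊ and r₋ is then a cancellation. -/

noncomputable section

namespace MiuraScattering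

/-! ### Calculus of primitives of locally integrable functions -/

section Primitives

variable {E : Type*} [NormedAddCommGroup E] [NormedSpace ℝ E]

/-- `F` is a primitive of the locally integrable function `f`. -/
structure IsPrim (F f : ℝ → E) : Prop where
  locInt : LocallyIntegrable f volume
  eq_add : ∀ x, F x = F 0 + ∫ s in (0 : ℝ)..x, f s

lemma LocallyIntegrable.intervalIntegrable' {E : Type*} [NormedAddCommGroup E] {f : ℝ → E} (hf : LocallyIntegrable f volume)
    (a b : ℝ) : IntervalIntegrable f volume a b :=
  (hf.integrableOn_isCompact isCompact_uIcc).intervalIntegrable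

lemma locallyIntegrable_of_intervalIntegrable {E : Type*} [NormedAddCommGroup E] {f : ℝ → E}
    (h : ∀ a b : ℝ, IntervalIntegrable f volume a b) : LocallyIntegrable f volume := by
  intro x
  refine ⟨Ioc (x - 1) (x + 1), Ioc_mem_nhds (by linarith) (by linarith), ?_⟩
  exact (intervalIntegrable_iff_integrableOn_Ioc_of_le (by linarith)).1 (h _ _)

lemma IsPrim.intervalIntegrable {F f : ℝ → E} (h : IsPrim F f) (a b : ℝ) :
    IntervalIntegrable f volume a b := LocallyIntegrable.intervalIntegrable' h.locInt a b

lemma IsPrim.sub_eq {F f : ℝ → E} (h : IsPrim F f) (a b : ℝ) :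
    F b - F a = ∫ s in a..b, f s := by
  rw [h.eq_add b, h.eq_add a, add_sub_add_left_eq_sub,
    intervalIntegral.integral_interval_sub_left (h.intervalIntegrable _ _)
      (h.intervalIntegrable _ _)]

lemma isPrim_of_sub_eq {F f : ℝ → E} (hf : LocallyIntegrable f volume)
    (h : ∀ a b, a ≤ b → F b - F a = ∫ s in a..b, f s) : IsPrim F f := by
  refine ⟨hf, fun x => ?_⟩
  rcases le_total 0 x with hx | hx
  · rw [← h 0 x hx]; abel
  · rw [intervalIntegral.integral_symm, ← h x 0 hx]; abel

lemma IsPrim.continuous {F f : ℝ → E} (h : IsPrim F f) : Continuous F := by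
  have : F = fun x => F 0 + ∫ s in (0 : ℝ)..x, f s := funext h.eq_add
  rw [this]
  exact continuous_const.add
    (intervalIntegral.continuous_primitive (fun a b => h.intervalIntegrable a b) 0)

lemma isPrim_const (c : E) : IsPrim (fun _ => c) (fun _ => 0) :=
  ⟨(integrable_zero ℝ E volume).locallyIntegrable, fun x => by simp⟩

lemma IsPrim.add {F f G g : ℝ → E} (hF : IsPrim F f) (hG : IsPrim G g) :
    IsPrim (fun x => F x + G x) (fun x => f x + g x) := by
  refine ⟨hF.locInt.add hG.locInt, fun x => ?_⟩
  rw [intervalIntegral.integral_add (hF.intervalIntegrable _ _) (hG.intervalIntegrable _ _),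
    hF.eq_add x, hG.eq_add x]
  abel

lemma IsPrim.neg {F f : ℝ → E} (hF : IsPrim F f) :
    IsPrim (fun x => -F x) (fun x => -f x) := by
  refine ⟨hF.locInt.neg, fun x => ?_⟩
  rw [intervalIntegral.integral_neg, hF.eq_add x]
  abel

lemma IsPrim.sub {F f G g : ℝ → E} (hF : IsPrim F f) (hG : IsPrim G g) :
    IsPrim (fun x => F x - G x) (fun x => f x - g x) := by
  simpa [sub_eq_add_neg] using hF.add hG.neg

lemma IsPrim.congr_ae {F f g : ℝ → E} (hF : IsPrim F f) (h : f =ᵐ[volume] g) :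
    IsPrim F g := by
  refine ⟨hF.locInt.congr h, fun x => ?_⟩
  rw [hF.eq_add x]
  congr 1
  exact intervalIntegral.integral_congr_ae (h.mono fun _ hx _ => hx)

lemma IsPrim.clm_comp {G : Type*} [NormedAddCommGroup G] [NormedSpace ℝ G]
    [CompleteSpace E] [CompleteSpace G]
    {F f : ℝ → E} (hF : IsPrim F f) (L : E →L[ℝ] G) :
    IsPrim (fun x => L (F x)) (fun x => L (f x)) := by
  refine ⟨?_, fun x => ?_⟩
  · intro x
    obtain ⟨s, hs, h⟩ := hF.locInt x
    exact ⟨s, hs, L.integrable_comp h⟩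
  · rw [L.intervalIntegral_comp_comm (hF.intervalIntegrable _ _), ← map_add, ← hF.eq_add]

lemma IsPrim.ofReal {F f : ℝ → ℝ} (hF : IsPrim F f) :
    IsPrim (fun x => (F x : ℂ)) (fun x => (f x : ℂ)) := hF.clm_comp Complex.ofRealCLM

lemma IsPrim.conj {F f : ℝ → ℂ} (hF : IsPrim F f) :
    IsPrim (fun x => conj (F x)) (fun x => conj (f x)) :=
  hF.clm_comp (Complex.conjCLE : ℂ →L[ℝ] ℂ)

lemma IsPrim.re {F f : ℝ → ℂ} (hF : IsPrim F f) :
    IsPrim (fun x => (F x).re) (fun x => (f x).re) := hF.clm_comp Complex.reCLM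

lemma IsPrim.const_mul {F f : ℝ → ℂ} (hF : IsPrim F f) (c : ℂ) :
    IsPrim (fun x => c * F x) (fun x => c * f x) :=
  hF.clm_comp (ContinuousLinearMap.restrictScalars ℝ (ContinuousLinearMap.mul ℂ ℂ c))

lemma isPrim_of_hasDerivAt [CompleteSpace E] {F f : ℝ → E} (h : ∀ x, HasDerivAt F (f x) x)
    (hf : Continuous f) : IsPrim F f := by
  refine ⟨hf.locallyIntegrable, fun x => ?_⟩
  rw [intervalIntegral.integral_eq_sub_of_hasDerivAt (fun y _ => h y)
    (hf.intervalIntegrable _ _)]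
  abel

lemma IsPrim.ae_hasDerivAt [CompleteSpace E] {F f : ℝ → E} (h : IsPrim F f) :
    ∀ᵐ x, HasDerivAt F (f x) x := by
  filter_upwards [LocallyIntegrable.ae_hasDerivAt_integral h.locInt] with x hx
  have : F = fun x => F 0 + ∫ s in (0 : ℝ)..x, f s := funext h.eq_add
  rw [this]
  exact (hx 0).const_add _

lemma IsPrim.ae_eq [CompleteSpace E] {F f g : ℝ → E} (hf : IsPrim F f) (hg : IsPrim F g) :
    f =ᵐ[volume] g := by
  filter_upwards [hf.ae_hasDerivAt, hg.ae_hasDerivAt] with x h1 h2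
  exact h1.unique h2

/-- The increments of `F` are dominated by those of the scalar primitive of `‖f‖`. -/
lemma IsPrim.absolutelyContinuous {F f : ℝ → E} (h : IsPrim F f) (a b : ℝ) :
    AbsolutelyContinuousOnInterval F a b := by
  have hV := (h.intervalIntegrable a b).norm.absolutelyContinuousOnInterval_intervalIntegral
    (left_mem_uIcc)
  rw [absolutelyContinuousOnInterval_iff] at hV ⊢
  intro ε hε
  obtain ⟨δ, hδ, H⟩ := hV ε hε
  refine ⟨δ, hδ, fun I h1 h2 => lt_of_le_of_lt (Finset.sum_le_sum fun i _ => ?_) (H I h1 h2)⟩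
  rw [dist_comm, dist_eq_norm, h.sub_eq, dist_comm, Real.dist_eq,
    intervalIntegral.integral_interval_sub_left]
  · exact intervalIntegral.norm_integral_le_abs_integral_norm
  · exact (h.intervalIntegrable _ _).norm
  · exact (h.intervalIntegrable _ _).norm

/-- `F` minus the integral of `f` is absolutely continuous with derivative zero a.e., hence
constant. The product and exponential rules are deduced from this. -/
lemma isPrim_of_absolutelyContinuous [CompleteSpace E] {F f : ℝ → E}
    (hF : ∀ a b, AbsolutelyContinuousOnInterval F a b)
    (hf : LocallyIntegrable f volume) (hd : ∀ᵐ x, HasDerivAt F (f x) x) : IsPrim F f := by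
  have hG : IsPrim (fun x => ∫ s in (0 : ℝ)..x, f s) f := ⟨hf, fun x => by simp⟩
  refine ⟨hf, fun x => ?_⟩
  obtain ⟨C, hC⟩ := ((hF 0 x).sub (hG.absolutelyContinuous 0 x)).const_of_ae_hasDerivAt_zero (by
    filter_upwards [hd, hG.ae_hasDerivAt] with y h1 h2 _
    simpa using h1.sub h2)
  have h0 := hC 0 left_mem_uIcc
  have hx := hC x right_mem_uIcc
  simp only [Pi.sub_apply, intervalIntegral.integral_same, sub_zero] at h0 hx
  rw [h0, ← hx]; abel

lemma LocallyIntegrable.mul_continuous {𝕜 : Type*} [RCLike 𝕜] {f g : ℝ → 𝕜}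
    (hf : LocallyIntegrable f volume) (hg : Continuous g) :
    LocallyIntegrable (fun x => f x * g x) volume :=
  locallyIntegrable_of_intervalIntegrable fun a b =>
    (LocallyIntegrable.intervalIntegrable' hf a b).mul_continuousOn hg.continuousOn

lemma LocallyIntegrable.continuous_mul {𝕜 : Type*} [RCLike 𝕜] {f g : ℝ → 𝕜}
    (hf : LocallyIntegrable f volume) (hg : Continuous g) :
    LocallyIntegrable (fun x => g x * f x) volume :=
  locallyIntegrable_of_intervalIntegrable fun a b =>
    (LocallyIntegrable.intervalIntegrable' hf a b).continuousOn_mul hg.continuousOn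

lemma IsPrim.mul {𝕜 : Type*} [RCLike 𝕜] {F f G g : ℝ → 𝕜} (hF : IsPrim F f) (hG : IsPrim G g) :
    IsPrim (fun x => F x * G x) (fun x => f x * G x + F x * g x) := by
  refine isPrim_of_absolutelyContinuous
    (fun a b => (hF.absolutelyContinuous a b).smul (hG.absolutelyContinuous a b))
    ((LocallyIntegrable.mul_continuous hF.locInt hG.continuous).add
      (LocallyIntegrable.continuous_mul hG.locInt hF.continuous)) ?_
  filter_upwards [hF.ae_hasDerivAt, hG.ae_hasDerivAt] with x h1 h2
  exact h1.mul h2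

lemma IsPrim.rexp {F f : ℝ → ℝ} (hF : IsPrim F f) :
    IsPrim (fun x => Real.exp (F x)) (fun x => Real.exp (F x) * f x) := by
  refine isPrim_of_absolutelyContinuous (fun a b => ?_)
    (LocallyIntegrable.continuous_mul hF.locInt (Real.continuous_exp.comp hF.continuous)) ?_
  · obtain ⟨C, hC⟩ := (isCompact_uIcc (a := a) (b := b)).exists_bound_of_continuousOn
      hF.continuous.continuousOn
    have hA := hF.absolutelyContinuous a b
    obtain ⟨K, hK⟩ := (Real.contDiff_exp (n := 1)).contDiffOn.exists_lipschitzOnWith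
      (s := Icc (-C) C) (by decide) (convex_Icc _ _) isCompact_Icc
    rw [absolutelyContinuousOnInterval_iff] at hA ⊢
    intro ε hε
    -- `K` is a Lipschitz constant of exp on the bounded range of `F`. Since `K` may vanish, the
    -- division is by `K + 1`.
    obtain ⟨δ, hδ, H⟩ := hA (ε / (K + 1)) (by positivity)
    refine ⟨δ, hδ, fun I h1 h2 => ?_⟩
    have hb : ∀ x ∈ uIcc a b, F x ∈ Icc (-C) C := fun x hx => abs_le.1 (hC x hx)
    calc _ ≤ ∑ i ∈ Finset.range I.1, K * dist (F (I.2 i).1) (F (I.2 i).2) := by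
          refine Finset.sum_le_sum fun i hi => ?_
          exact hK.dist_le_mul _ (hb _ (h1.1 i hi).1) _ (hb _ (h1.1 i hi).2)
      _ = K * ∑ i ∈ Finset.range I.1, dist (F (I.2 i).1) (F (I.2 i).2) := by
          rw [Finset.mul_sum]
      _ ≤ K * (ε / (K + 1)) := by
          gcongr
          exact (H I h1 h2).le
      _ < (K + 1) * (ε / (K + 1)) := by gcongr; linarith
      _ = ε := by field
  · filter_upwards [hF.ae_hasDerivAt] with x h1
    exact h1.exp

/-- Turns Volterra equations with integrals up to infinity into differential equations. -/
lemma isPrim_sub_setIntegral_Ioi {g : ℝ → E} (c : E) (hg : ∀ x, IntegrableOn g (Ioi x)) :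
    IsPrim (fun x => c - ∫ s in Ioi x, g s) g := by
  refine isPrim_of_sub_eq (locallyIntegrable_of_intervalIntegrable fun a b => ?_) fun a b hab => ?_
  · rw [intervalIntegrable_iff]
    exact (hg (min a b)).mono_set fun x hx => hx.1
  · rw [intervalIntegral.integral_of_le hab, sub_sub_sub_cancel_left, sub_eq_iff_eq_add,
      ← setIntegral_union (Ioc_disjoint_Ioi le_rfl) measurableSet_Ioi
        ((hg a).mono_set fun x hx => hx.1) (hg b), Ioc_union_Ioi_eq_Ioi hab]

lemma tendsto_setIntegral_Ioi_atTop {g : ℝ → E} {a : ℝ} (hg : IntegrableOn g (Ioi a)) :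
    Tendsto (fun x => ∫ s in Ioi x, g s) atTop (𝓝 0) := by
  have h := tendsto_setIntegral_of_antitone (μ := volume) (f := g) (s := fun x : ℝ => Ioi x)
    (fun _ => measurableSet_Ioi) (fun x y hxy => Ioi_subset_Ioi hxy) ⟨a, hg⟩
  have he : ⋂ x : ℝ, Ioi x = (∅ : Set ℝ) := by
    ext y
    simp only [mem_iInter, mem_Ioi, mem_empty_iff_false, iff_false, not_forall, not_lt]
    exact ⟨y, le_rfl⟩
  simpa [he] using h

lemma IsPrim.comp_neg {F f : ℝ → E} (h : IsPrim F f) :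
    IsPrim (fun x => F (-x)) (fun x => -f (-x)) := by
  refine ⟨?_, fun x => ?_⟩
  · refine (locallyIntegrable_of_intervalIntegrable fun a b => ?_)
    have := (IntervalIntegrable.iff_comp_neg (by simp)).1 (h.intervalIntegrable (-a) (-b))
    simpa [Pi.neg_def] using this.neg
  · rw [intervalIntegral.integral_neg, intervalIntegral.integral_comp_neg, neg_zero,
      ← intervalIntegral.integral_symm, ← h.eq_add]

/-- The source of the conservation laws for Wronskians and amplitudes. -/
lemma IsPrim.eq_of_deriv_zero {F : ℝ → E} {f : ℝ → E} (h : IsPrim F f) (hf : f =ᵐ[volume] 0)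
    (x : ℝ) : F x = F 0 := by
  rw [(h.congr_ae hf).eq_add x]
  simp

end Primitives

/-! ### The lemma of du Bois-Reymond -/

lemma IsPrim.integral_eq_zero {E : Type*} [NormedAddCommGroup E] [NormedSpace ℝ E]
    {H h : ℝ → E} (hH : IsPrim H h) {R : ℝ} (hR : 0 ≤ R) (hs : ∀ x, R ≤ |x| → h x = 0)
    (hb : ∀ x, R ≤ |x| → H x = 0) : ∫ x, h x = 0 := by
  have h1 : ∫ x in Ioc (-R) R, h x = ∫ x, h x :=
    setIntegral_eq_integral_of_forall_compl_eq_zero fun x hx => hs x (by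
      by_contra hlt
      rw [not_le, abs_lt] at hlt
      exact hx ⟨hlt.1, hlt.2.le⟩)
  rw [← h1, ← intervalIntegral.integral_of_le (by linarith), ← hH.sub_eq,
    hb R (le_abs_self R), hb (-R) (by rw [abs_neg]; exact le_abs_self R), sub_zero]

lemma exists_radius {E : Type*} [NormedAddCommGroup E] [NormedSpace ℝ E] {φ : ℝ → E}
    (hφ : HasCompactSupport φ) :
    ∃ R : ℝ, 0 ≤ R ∧ ∀ x, R ≤ |x| → φ x = 0 ∧ deriv φ x = 0 := by
  obtain ⟨R, hR⟩ := hφ.isCompact.isBounded.subset_closedBall (0 : ℝ)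
  have h : ∀ x, |R| + 1 ≤ |x| → x ∉ tsupport φ := fun x hx hx' => by
    have := hR hx'
    rw [mem_closedBall_zero_iff, Real.norm_eq_abs] at this
    linarith [le_abs_self R]
  refine ⟨|R| + 1, by positivity, fun x hx => ⟨image_eq_zero_of_notMem_tsupport (h x hx), ?_⟩⟩
  by_contra hne
  exact h x hx (support_deriv_subset hne)

lemma IsPrim.integral_by_parts {F f φ : ℝ → ℂ} (hF : IsPrim F f) (hφ : ContDiff ℝ (⊤ : ℕ∞) φ)
    (hc : HasCompactSupport φ) : ∫ x, F x * deriv φ x = -∫ x, f x * φ x := by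
  have hp : IsPrim φ (deriv φ) := isPrim_of_hasDerivAt
    (fun x => (hφ.differentiable (by simp)).differentiableAt.hasDerivAt)
    (hφ.continuous_deriv (by simp))
  obtain ⟨R, hR, h⟩ := exists_radius hc
  have h0 := (hF.mul hp).integral_eq_zero hR (fun x hx => by simp [h x hx])
    fun x hx => by simp [h x hx]
  rw [integral_add] at h0
  · exact eq_neg_of_add_eq_zero_right h0
  · simpa [mul_comm] using
      hF.locInt.integrable_smul_left_of_hasCompactSupport hp.continuous hc
  · exact (hF.continuous.mul (hφ.continuous_deriv (by simp))).integrable_of_hasCompactSupport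
      (hc.deriv.mul_left)

/-- The primitive started to the left of the support vanishes again on the right because the mean of
`h` is zero. -/
lemma exists_primitive_hasCompactSupport {h : ℝ → ℝ} (hh : ContDiff ℝ (⊤ : ℕ∞) h)
    (hc : HasCompactSupport h) (h0 : ∫ x, h x = 0) :
    ∃ χ : ℝ → ℝ, ContDiff ℝ (⊤ : ℕ∞) χ ∧ HasCompactSupport χ ∧ deriv χ = h := by
  obtain ⟨R, hR, hz⟩ := exists_radius hc
  have hd : ∀ x, HasDerivAt (fun x => ∫ s in (-R)..x, h s) (h x) x := fun x =>
    intervalIntegral.integral_hasDerivAt_right (hh.continuous.intervalIntegrable _ _)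
      (hh.continuous.stronglyMeasurableAtFilter _ _) hh.continuous.continuousAt
  have hdf : deriv (fun x => ∫ s in (-R)..x, h s) = h := funext fun x => (hd x).deriv
  refine ⟨_, ?_, ?_, hdf⟩
  · rw [contDiff_infty_iff_deriv, hdf]
    exact ⟨fun x => (hd x).differentiableAt, hh⟩
  · refine HasCompactSupport.intro (isCompact_Icc (a := -R) (b := R)) fun x hx => ?_
    rw [mem_Icc, not_and_or, not_le, not_le] at hx
    rcases hx with hx | hx
    · rw [intervalIntegral.integral_symm, intervalIntegral.integral_of_le hx.le,
        setIntegral_eq_zero_of_forall_eq_zero, neg_zero]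
      intro y hy
      refine (hz y ?_).1
      rw [abs_of_nonpos (by linarith [hy.2])]
      linarith [hy.2]
    · rw [intervalIntegral.integral_of_le (by linarith),
        setIntegral_eq_integral_of_forall_compl_eq_zero, h0]
      intro y hy
      refine (hz y ?_).1
      rw [mem_Ioc, not_and_or, not_lt, not_le] at hy
      rcases hy with hy | hy
      · exact (by linarith : R ≤ -y).trans (neg_le_abs y)
      · exact (by linarith : R ≤ y).trans (le_abs_self y)

/-- Subtracting (∫ φ) ψ from a test function φ, with ψ a bump of integral 1, leaves a function of
mean zero, that is, the derivative of a test function. So `d` acts on φ as the constant ∫ ψ d. -/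
lemma ae_eq_const_of_integral_deriv_smul {d : ℝ → ℂ} (hd : LocallyIntegrable d volume)
    (h : ∀ φ : ℝ → ℝ, ContDiff ℝ (⊤ : ℕ∞) φ → HasCompactSupport φ → ∫ x, deriv φ x • d x = 0) :
    ∃ c : ℂ, d =ᵐ[volume] fun _ => c := by
  let b : ContDiffBump (0 : ℝ) := ⟨1, 2, zero_lt_one, one_lt_two⟩
  let ψ : ℝ → ℝ := b.normed volume
  have hψ : ContDiff ℝ (⊤ : ℕ∞) ψ := b.contDiff_normed
  have hψc : HasCompactSupport ψ := b.hasCompactSupport_normed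
  have hψi : ∫ x, ψ x = 1 := b.integral_normed
  have hint : ∀ φ : ℝ → ℝ, Continuous φ → HasCompactSupport φ →
      Integrable (fun x => φ x • d x) volume := fun φ h1 h2 =>
    hd.integrable_smul_left_of_hasCompactSupport h1 h2
  refine ⟨∫ x, ψ x • d x, ?_⟩
  have := ae_eq_zero_of_integral_contDiff_smul_eq_zero
    (f := fun x => d x - ∫ x, ψ x • d x) (hd.sub (locallyIntegrable_const _)) (by
    intro φ hφ hφc
    have hφi := hφ.continuous.integrable_of_hasCompactSupport (μ := volume) hφc
    obtain ⟨χ, h1, h2, h3⟩ := exists_primitive_hasCompactSupport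
      (h := fun x => φ x - (∫ y, φ y) * ψ x) (hφ.sub (contDiff_const.mul hψ))
      (hφc.sub hψc.mul_left) (by
        rw [integral_sub hφi ((hψ.continuous.integrable_of_hasCompactSupport hψc).const_mul _),
          integral_const_mul, hψi]
        ring)
    have h4 := h χ h1 h2
    rw [h3] at h4
    simp only [sub_smul, mul_smul] at h4
    rw [integral_sub (hint φ hφ.continuous hφc) ((hint ψ hψ.continuous hψc).fun_smul _),
      integral_smul, sub_eq_zero] at h4
    simp only [smul_sub]
    rw [integral_sub (hint φ hφ.continuous hφc) (hφi.smul_const _), integral_smul_const, h4,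
      sub_self])
  filter_upwards [this] with x hx using sub_eq_zero.1 hx

/-- The difference of `f` and a primitive of `g` has weak derivative zero. -/
lemma exists_isPrim_of_weak_deriv {f g : ℝ → ℂ} (hf : LocallyIntegrable f volume)
    (hg : LocallyIntegrable g volume)
    (h : ∀ φ : ℝ → ℝ, ContDiff ℝ (⊤ : ℕ∞) φ → HasCompactSupport φ →
      ∫ x, f x * ((deriv φ x : ℝ) : ℂ) = -∫ x, g x * (φ x : ℂ)) :
    ∃ F, IsPrim F g ∧ f =ᵐ[volume] F := by
  have hG : IsPrim (fun x => ∫ s in (0 : ℝ)..x, g s) g := ⟨hg, fun x => by simp⟩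
  set G : ℝ → ℂ := fun x => ∫ s in (0 : ℝ)..x, g s
  obtain ⟨c, hc⟩ := ae_eq_const_of_integral_deriv_smul (d := fun x => f x - G x)
    (hf.sub hG.continuous.locallyIntegrable) (by
    intro φ hφ hφc
    have hdc := hφ.continuous_deriv (by simp)
    have hφC : ContDiff ℝ (⊤ : ℕ∞) fun x => (φ x : ℂ) := Complex.ofRealCLM.contDiff.comp hφ
    have hφCc : HasCompactSupport fun x => (φ x : ℂ) := hφc.comp_left Complex.ofReal_zero
    have hd : deriv (fun x => (φ x : ℂ)) = fun x => ((deriv φ x : ℝ) : ℂ) := funext fun x =>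
      ((hφ.differentiable (by simp)).differentiableAt.hasDerivAt.ofReal_comp).deriv
    have h1 := h φ hφ hφc
    have h2 := hG.integral_by_parts hφC hφCc
    rw [hd] at h2
    simp only [smul_sub]
    rw [integral_sub (hf.integrable_smul_left_of_hasCompactSupport hdc hφc.deriv)
      (hG.continuous.locallyIntegrable.integrable_smul_left_of_hasCompactSupport hdc hφc.deriv)]
    simp only [Complex.real_smul, mul_comm ((deriv φ _ : ℝ) : ℂ)]
    rw [h1, h2, sub_self])
  refine ⟨fun x => G x + c, ?_, ?_⟩
  · simpa using hG.add (isPrim_const c)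
  · filter_upwards [hc] with x hx
    rw [← hx]; ring

/-! ### Riccati representatives and quasi-derivatives -/

lemma MemL2loc.locallyIntegrable_mul {f g : ℝ → ℂ} (hf : MemL2loc f) (hg : MemL2loc g) :
    LocallyIntegrable (fun x => f x * g x) volume := by
  refine locallyIntegrable_of_intervalIntegrable fun a b => ?_
  have h : IntegrableOn (fun x => f x * g x) (Icc (-(max |a| |b|)) (max |a| |b|)) volume :=
    MemLp.integrable_mul (hf _) (hg _)
  refine (h.mono_set ?_).intervalIntegrable
  intro x hx
  have := abs_le_max_abs_abs hx.1 hx.2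
  rw [mem_Icc, ← abs_le]
  refine this.trans (max_le ?_ ?_)
  · rcases min_choice a b with h | h <;> rw [h] <;> simp
  · rcases max_choice a b with h | h <;> rw [h] <;> simp

lemma MemL2loc.ofReal {u : ℝ → ℝ} (hu : MemL2loc u) : MemL2loc fun x => (u x : ℂ) :=
  fun R => (hu R).ofReal

lemma memL2loc_of_continuous {f : ℝ → ℂ} (hf : Continuous f) : MemL2loc f := fun R =>
  have ⟨C, hC⟩ := (isCompact_Icc (a := -R) (b := R)).exists_bound_of_continuousOn hf.continuousOn
  MemLp.of_bound hf.aestronglyMeasurable C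
    ((ae_restrict_iff' measurableSet_Icc).2 (Eventually.of_forall hC))

lemma MemL2loc.locallyIntegrable {f : ℝ → ℂ} (hf : MemL2loc f) : LocallyIntegrable f volume := by
  simpa using hf.locallyIntegrable_mul (memL2loc_of_continuous (continuous_const (y := (1 : ℂ))))

lemma MemL2loc.mul_continuous {f g : ℝ → ℂ} (hf : MemL2loc f) (hg : Continuous g) :
    MemL2loc fun x => f x * g x := by
  intro R
  obtain ⟨C, hC⟩ := (isCompact_Icc (a := -R) (b := R)).exists_bound_of_continuousOn
    hg.continuousOn
  refine MemLp.of_le_mul (c := C) (hf R) ((hf R).1.mul hg.aestronglyMeasurable) ?_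
  refine (ae_restrict_iff' measurableSet_Icc).2 (Eventually.of_forall fun x hx => ?_)
  rw [norm_mul, mul_comm]
  exact mul_le_mul_of_nonneg_right (hC x hx) (norm_nonneg _)

lemma MemL2loc.add {f g : ℝ → ℂ} (hf : MemL2loc f) (hg : MemL2loc g) :
    MemL2loc fun x => f x + g x := fun R => (hf R).add (hg R)

lemma MemL2loc.of_memLp {u : ℝ → ℝ} (hu : MemLp u 2 volume) : MemL2loc u := fun _ =>
  hu.restrict _

/-- A smooth function with compact support as a test function. -/
def mkTest {F : Type*} [NormedAddCommGroup F] [NormedSpace ℝ F] (φ : ℝ → F)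
    (h1 : ContDiff ℝ (⊤ : ℕ∞) φ) (h2 : HasCompactSupport φ) :
    𝓓((⊤ : TopologicalSpace.Opens ℝ), F) := ⟨φ, h1, h2, by simp⟩

lemma mkTest_coe {F : Type*} [NormedAddCommGroup F] [NormedSpace ℝ F] (φ : ℝ → F)
    (h1 : ContDiff ℝ (⊤ : ℕ∞) φ) (h2 : HasCompactSupport φ) : ⇑(mkTest φ h1 h2) = φ := rfl

/-- Two Riccati representatives differ by an absolutely continuous function. -/
lemma IsRiccatiRep.exists_sub {q : 𝓓'((⊤ : TopologicalSpace.Opens ℝ), ℝ)} {u₁ u₂ : ℝ → ℝ}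
    (h₁ : IsRiccatiRep q u₁) (h₂ : IsRiccatiRep q u₂) (l₁ : MemL2loc u₁) (l₂ : MemL2loc u₂) :
    ∃ v : ℝ → ℝ, IsPrim v (fun x => -(u₁ x + u₂ x) * v x) ∧
      (fun x => u₁ x - u₂ x) =ᵐ[volume] v := by
  have i₁ := l₁.ofReal.locallyIntegrable
  have i₂ := l₂.ofReal.locallyIntegrable
  have q₁ := l₁.ofReal.locallyIntegrable_mul l₁.ofReal
  have q₂ := l₂.ofReal.locallyIntegrable_mul l₂.ofReal
  -- From u₁' + u₁² = u₂' + u₂², the weak derivative of u₁ - u₂ is -(u₁² - u₂²), which is locally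
  -- integrable. The argument runs over ℂ and real parts are taken at the end.
  obtain ⟨V, hV, hae⟩ := exists_isPrim_of_weak_deriv (f := fun x => (u₁ x : ℂ) - u₂ x)
    (g := fun x => -((u₁ x : ℂ) * u₁ x - (u₂ x : ℂ) * u₂ x)) (i₁.sub i₂) (q₁.sub q₂).neg (by
    intro φ hφ hφc
    have e : ∀ {u : ℝ → ℝ}, IsRiccatiRep q u → MemL2loc u →
        (q (mkTest φ hφ hφc) : ℂ) = -(∫ x, (u x : ℂ) * deriv φ x) +
          ∫ x, (u x : ℂ) * u x * φ x := by
      intro u hu lu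
      rw [hu, ← integral_complex_ofReal, ← integral_neg, ← integral_add]
      · refine integral_congr_ae (Eventually.of_forall fun x => ?_)
        simp only [mkTest_coe]
        push_cast
        ring
      · exact (Integrable.neg (by
          simpa [mul_comm] using
            lu.ofReal.locallyIntegrable.integrable_smul_left_of_hasCompactSupport
              (hφ.continuous_deriv (by simp)) hφc.deriv))
      · simpa [mul_comm] using
          (lu.ofReal.locallyIntegrable_mul
            lu.ofReal).integrable_smul_left_of_hasCompactSupport hφ.continuous hφc
    have key := (e h₁ l₁).symm.trans (e h₂ l₂)
    have I1 : ∀ {f : ℝ → ℂ}, LocallyIntegrable f volume →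
        Integrable (fun x => f x * ((deriv φ x : ℝ) : ℂ)) volume := fun hf => by
      simpa [mul_comm] using hf.integrable_smul_left_of_hasCompactSupport
        (hφ.continuous_deriv (by simp)) hφc.deriv
    have I2 : ∀ {f : ℝ → ℂ}, LocallyIntegrable f volume →
        Integrable (fun x => f x * (φ x : ℂ)) volume := fun hf => by
      simpa [mul_comm] using hf.integrable_smul_left_of_hasCompactSupport hφ.continuous hφc
    simp only [sub_mul, neg_mul, integral_neg]
    rw [integral_sub (I1 i₁) (I1 i₂), integral_sub (I2 q₁) (I2 q₂)]
    linear_combination -key)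
  refine ⟨fun x => (V x).re, hV.re.congr_ae ?_, ?_⟩
  · filter_upwards [hae] with x hx
    rw [← hx]
    simp
    ring
  · filter_upwards [hae] with x hx
    rw [← hx]
    simp

/-- `y` with the quasi-derivative `η = y' - u y` solves `-y'' + (u' + u²) y = k² y`. -/
structure IsSystem (u : ℝ → ℝ) (k : ℝ) (y η : ℝ → ℂ) : Prop where
  prim_fst : IsPrim y fun x => u x * y x + η x
  prim_snd : IsPrim η fun x => -(u x * η x) - (k : ℂ) ^ 2 * y x

/-- The quasi-derivative with respect to a second Riccati representative. -/
lemma IsSystem.switch {u₁ u₂ v : ℝ → ℝ} {k : ℝ} {y η : ℝ → ℂ} (h : IsSystem u₁ k y η)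
    (hv : IsPrim v fun x => -(u₁ x + u₂ x) * v x) (hae : (fun x => u₁ x - u₂ x) =ᵐ[volume] v) :
    IsSystem u₂ k y fun x => η x + v x * y x := by
  refine ⟨h.prim_fst.congr_ae ?_, (h.prim_snd.add (hv.ofReal.mul h.prim_fst)).congr_ae ?_⟩
  · filter_upwards [hae] with x hx
    rw [← hx]
    push_cast
    ring
  · filter_upwards [hae] with x hx
    rw [← hx]
    push_cast
    ring

/-- The weak equation says that y' - uy has the locally integrable weak derivative -u(y' - uy) - k²
y, although y'' and q are only distributions. Real test functions suffice, so the conjugation drops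
out. -/
lemma isSystem_of_isSchrodingerSolution {q : 𝓓'((⊤ : TopologicalSpace.Opens ℝ), ℝ)}
    {u : ℝ → ℝ} (hu : IsRiccatiRep q u) (lu : MemL2loc u) {k : ℝ} {y : ℝ → ℂ}
    (h : IsSchrodingerSolution q k y) : ∃ η, IsSystem u k y η := by
  obtain ⟨y', ly', hy, hw⟩ := h
  have hy' : IsPrim y y' := ⟨ly'.locallyIntegrable, hy⟩
  have luy := lu.ofReal.mul_continuous hy'.continuous
  have le : MemL2loc fun x => y' x - u x * y x := fun R => (ly' R).sub (luy R)
  have ie := le.locallyIntegrable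
  have iue := lu.ofReal.locallyIntegrable_mul le
  have iy := (hy'.continuous.const_mul ((k : ℂ) ^ 2)).locallyIntegrable (μ := volume)
  obtain ⟨η, hη, hae⟩ := exists_isPrim_of_weak_deriv (f := fun x => y' x - u x * y x)
    (g := fun x => -(u x * (y' x - u x * y x)) - (k : ℂ) ^ 2 * y x) ie (iue.neg.sub iy) (by
    intro φ hφ hφc
    have hd : deriv (fun x => (φ x : ℂ)) = fun x => ((deriv φ x : ℝ) : ℂ) := funext fun x =>
      ((hφ.differentiable (by simp)).differentiableAt.hasDerivAt.ofReal_comp).deriv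
    have hφC : ContDiff ℝ (⊤ : ℕ∞) fun x => (φ x : ℂ) := Complex.ofRealCLM.contDiff.comp hφ
    have hφCc : HasCompactSupport fun x => (φ x : ℂ) := hφc.comp_left Complex.ofReal_zero
    have key := hw u lu hu (mkTest (fun x => (φ x : ℂ)) hφC hφCc)
    simp only [mkTest_coe, hd, Complex.conj_ofReal] at key
    have I1 : ∀ {f : ℝ → ℂ}, LocallyIntegrable f volume →
        Integrable (fun x => f x * ((deriv φ x : ℝ) : ℂ)) volume := fun hf => by
      simpa [mul_comm] using hf.integrable_smul_left_of_hasCompactSupport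
        (hφ.continuous_deriv (by simp)) hφc.deriv
    have I2 : ∀ {f : ℝ → ℂ}, LocallyIntegrable f volume →
        Integrable (fun x => f x * (φ x : ℂ)) volume := fun hf => by
      simpa [mul_comm] using hf.integrable_smul_left_of_hasCompactSupport hφ.continuous hφc
    have e1 : ∫ x, (-(u x : ℂ) * (y' x * (φ x : ℂ) + y x * ((deriv φ x : ℝ) : ℂ))
        + (u x : ℂ) ^ 2 * (y x * (φ x : ℂ)))
        = -(∫ x, u x * y x * ((deriv φ x : ℝ) : ℂ)) - ∫ x, u x * (y' x - u x * y x) * (φ x : ℂ) := by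
      rw [← integral_neg, ← integral_sub (I1 luy.locallyIntegrable).fun_neg (I2 iue)]
      refine integral_congr_ae (Eventually.of_forall fun x => ?_)
      ring
    rw [e1] at key
    have e2 : ∫ x, (y' x - u x * y x) * ((deriv φ x : ℝ) : ℂ) =
        (∫ x, y' x * ((deriv φ x : ℝ) : ℂ)) - ∫ x, u x * y x * ((deriv φ x : ℝ) : ℂ) := by
      rw [← integral_sub (I1 ly'.locallyIntegrable) (I1 luy.locallyIntegrable)]
      exact integral_congr_ae (Eventually.of_forall fun x => sub_mul _ _ _)
    have e3 : ∫ x, (-(u x * (y' x - u x * y x)) - (k : ℂ) ^ 2 * y x) * (φ x : ℂ) =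
        -(∫ x, u x * (y' x - u x * y x) * (φ x : ℂ)) - (k : ℂ) ^ 2 * ∫ x, y x * (φ x : ℂ) := by
      rw [← integral_neg, ← integral_const_mul, ← integral_sub (I2 iue).fun_neg (by
        simpa only [mul_assoc] using I2 iy)]
      exact integral_congr_ae (Eventually.of_forall fun x => by ring)
    rw [e2, e3]
    linear_combination key)
  refine ⟨η, hy'.congr_ae ?_, hη.congr_ae ?_⟩
  · filter_upwards [hae] with x hx
    rw [← hx]; ring
  · filter_upwards [hae] with x hx
    rw [← hx]

/-- The weak form has to hold for every Riccati representative `w`. `IsSystem.switch` passes to the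
quasi-derivative for `w`, and an integration by parts concludes. -/
lemma IsSystem.isSchrodingerSolution {q : 𝓓'((⊤ : TopologicalSpace.Opens ℝ), ℝ)}
    {u : ℝ → ℝ} (hu : IsRiccatiRep q u) (lu : MemL2loc u) {k : ℝ} {y η : ℝ → ℂ}
    (h : IsSystem u k y η) : IsSchrodingerSolution q k y := by
  refine ⟨fun x => u x * y x + η x, (lu.ofReal.mul_continuous h.prim_fst.continuous).add
    (memL2loc_of_continuous h.prim_snd.continuous), h.prim_fst.eq_add, fun w lw hw φ => ?_⟩
  obtain ⟨v, hv, hae⟩ := hu.exists_sub hw lu lw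
  have hs := h.switch hv hae
  set θ : ℝ → ℂ := fun x => η x + v x * y x with hθ
  have hφ : ContDiff ℝ (⊤ : ℕ∞) φ := φ.contDiff
  have hc : HasCompactSupport φ := φ.hasCompactSupport
  set ψ : ℝ → ℂ := fun x => conj (φ x) with hψ
  have hψd : ContDiff ℝ (⊤ : ℕ∞) ψ := Complex.conjCLE.contDiff.comp hφ
  have hψc : HasCompactSupport ψ := hc.comp_left (map_zero _)
  have hd : deriv ψ = fun x => conj (deriv φ x) := funext fun x =>
    ((hφ.differentiable (by simp)).differentiableAt.hasDerivAt.star).deriv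
  have hdc := hψd.continuous_deriv (by simp)
  have key := hs.prim_snd.integral_by_parts hψd hψc
  have I1 : ∀ {f : ℝ → ℂ}, LocallyIntegrable f volume →
      Integrable (fun x => f x * deriv ψ x) volume := fun hf => by
    simpa [mul_comm] using hf.integrable_smul_left_of_hasCompactSupport hdc hψc.deriv
  have I2 : ∀ {f : ℝ → ℂ}, LocallyIntegrable f volume →
      Integrable (fun x => f x * ψ x) volume := fun hf => by
    simpa [mul_comm] using hf.integrable_smul_left_of_hasCompactSupport hψd.continuous hψc
  have lwy := (lw.ofReal.mul_continuous hs.prim_fst.continuous).locallyIntegrable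
  have lwθ := (lw.ofReal.mul_continuous hs.prim_snd.continuous).locallyIntegrable
  have lθ := hs.prim_snd.continuous.locallyIntegrable (μ := volume)
  have ly := (h.prim_fst.continuous.const_mul ((k : ℂ) ^ 2)).locallyIntegrable (μ := volume)
  -- Both sides are derivatives of `y`, with respect to the two representatives.
  have e0 : (fun x => (u x * y x + η x)) =ᵐ[volume] fun x => w x * y x + θ x :=
    h.prim_fst.ae_eq hs.prim_fst
  have e1 : ∫ x, (u x * y x + η x) * deriv ψ x =
      (∫ x, w x * y x * deriv ψ x) + ∫ x, θ x * deriv ψ x := by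
    rw [← integral_add (I1 lwy) (I1 lθ)]
    refine integral_congr_ae ?_
    filter_upwards [e0] with x hx
    rw [hx]; ring
  have e2 : ∫ x, (-(w x : ℂ) * ((u x * y x + η x) * ψ x + y x * deriv ψ x)
        + (w x : ℂ) ^ 2 * (y x * ψ x)) =
      -(∫ x, w x * y x * deriv ψ x) - ∫ x, w x * θ x * ψ x := by
    rw [← integral_neg, ← integral_sub (I1 lwy).fun_neg (I2 lwθ)]
    refine integral_congr_ae ?_
    filter_upwards [e0] with x hx
    rw [hx]; ring
  have e3 : ∫ x, (-(w x * θ x) - (k : ℂ) ^ 2 * y x) * ψ x =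
      -(∫ x, w x * θ x * ψ x) - (k : ℂ) ^ 2 * ∫ x, y x * ψ x := by
    simp only [sub_mul, neg_mul]
    rw [integral_sub (I2 lwθ).fun_neg (I2 ly), integral_neg]
    simp only [mul_assoc ((k : ℂ) ^ 2), integral_const_mul]
  have hd' : ∀ x, conj (deriv φ x) = deriv ψ x := fun x => by rw [hd]
  simp only [hd']
  change (∫ x, (u x * y x + η x) * deriv ψ x) + ∫ x, (-(w x : ℂ) * ((u x * y x + η x) * ψ x +
    y x * deriv ψ x) + (w x : ℂ) ^ 2 * (y x * ψ x)) = (k : ℂ) ^ 2 * ∫ x, y x * ψ x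
  rw [e1, e2, key, e3]
  ring

/-! ### The Banach space `X = L¹ ∩ L²` -/

/-- The closed subspace of `L¹ × L²` of pairs that agree almost everywhere. -/
def submoduleX : Submodule ℂ (Lp ℂ 1 (volume : Measure ℝ) × Lp ℂ 2 (volume : Measure ℝ)) where
  carrier := {p | p.1 =ᵐ[volume] p.2}
  add_mem' {p q} hp hq := by
    filter_upwards [hp, hq, Lp.coeFn_add p.1 q.1, Lp.coeFn_add p.2 q.2] with x h1 h2 h3 h4
    rw [Prod.fst_add, Prod.snd_add, h3, h4, Pi.add_apply, Pi.add_apply, h1, h2]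
  zero_mem' := by
    filter_upwards [Lp.coeFn_zero ℂ 1 (volume : Measure ℝ),
      Lp.coeFn_zero ℂ 2 (volume : Measure ℝ)] with x h1 h2
    rw [Prod.fst_zero, Prod.snd_zero, h1, h2]
  smul_mem' c p hp := by
    filter_upwards [hp, Lp.coeFn_smul c p.1, Lp.coeFn_smul c p.2] with x h1 h3 h4
    rw [Prod.smul_fst, Prod.smul_snd, h3, h4, Pi.smul_apply, Pi.smul_apply, h1]

lemma mem_submoduleX {p : Lp ℂ 1 (volume : Measure ℝ) × Lp ℂ 2 (volume : Measure ℝ)} :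
    p ∈ submoduleX ↔ p.1 =ᵐ[volume] p.2 := Iff.rfl

/-- Convergence in L¹ and in L² both imply convergence in measure, whose limit is unique a.e. -/
lemma isClosed_submoduleX : IsClosed (submoduleX : Set (Lp ℂ 1 (volume : Measure ℝ) ×
    Lp ℂ 2 (volume : Measure ℝ))) := by
  refine IsSeqClosed.isClosed fun p a hp ha => ?_
  have h1 := tendstoInMeasure_of_tendsto_Lp ((continuous_fst.tendsto a).comp ha)
  have h2 := tendstoInMeasure_of_tendsto_Lp ((continuous_snd.tendsto a).comp ha)
  exact tendstoInMeasure_ae_unique h1 (h2.congr_left fun n => (mem_submoduleX.1 (hp n)).symm)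

/-- The Banach space `X = L¹ ∩ L²`, with the larger of the two norms. -/
def X : Type := submoduleX

instance : NormedAddCommGroup X := inferInstanceAs (NormedAddCommGroup submoduleX)
instance : NormedSpace ℂ X := inferInstanceAs (NormedSpace ℂ submoduleX)
instance : CompleteSpace X := isClosed_submoduleX.completeSpace_coe

namespace X

/-- The first component. -/
def fstCLM : X →L[ℂ] Lp ℂ 1 (volume : Measure ℝ) :=
  (ContinuousLinearMap.fst ℂ _ _).comp submoduleX.subtypeL

/-- The second component. -/
def sndCLM : X →L[ℂ] Lp ℂ 2 (volume : Measure ℝ) :=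
  (ContinuousLinearMap.snd ℂ _ _).comp submoduleX.subtypeL

/-- A representative. -/
def fn (f : X) : ℝ → ℂ := fstCLM f

lemma fn_ae_snd (f : X) : f.fn =ᵐ[volume] sndCLM f := f.2

lemma norm_def (f : X) : ‖f‖ = max ‖fstCLM f‖ ‖sndCLM f‖ := rfl

lemma norm_fst_le (f : X) : ‖fstCLM f‖ ≤ ‖f‖ := le_max_left _ _

lemma norm_snd_le (f : X) : ‖sndCLM f‖ ≤ ‖f‖ := le_max_right _ _

lemma memX (f : X) : MemX f.fn :=
  ⟨Lp.memLp (fstCLM f), (memLp_congr_ae f.fn_ae_snd).2 (Lp.memLp (sndCLM f))⟩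

lemma integrable (f : X) : Integrable f.fn volume := memLp_one_iff_integrable.1 f.memX.1

lemma ext_ae {f g : X} (h : f.fn =ᵐ[volume] g.fn) : f = g := by
  refine Subtype.ext (Prod.ext (Lp.ext h) (Lp.ext ?_))
  exact (f.fn_ae_snd.symm.trans h).trans g.fn_ae_snd

/-- The element of `X` given by a function. -/
def mk (f : ℝ → ℂ) (hf : MemX f) : X :=
  ⟨(hf.1.toLp f, hf.2.toLp f), hf.1.coeFn_toLp.trans hf.2.coeFn_toLp.symm⟩

lemma fn_mk {f : ℝ → ℂ} (hf : MemX f) : (mk f hf).fn =ᵐ[volume] f := hf.1.coeFn_toLp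

lemma fn_add (f g : X) : (f + g).fn =ᵐ[volume] fun x => f.fn x + g.fn x := by
  have := Lp.coeFn_add (fstCLM f) (fstCLM g)
  rw [← map_add] at this
  exact this

lemma fn_smul (c : ℂ) (f : X) : (c • f).fn =ᵐ[volume] fun x => c * f.fn x := by
  have := Lp.coeFn_smul c (fstCLM f)
  rw [← map_smul] at this
  exact this

lemma norm_fst_eq (f : X) : ‖fstCLM f‖ = (eLpNorm f.fn 1 volume).toReal := Lp.norm_def _

lemma norm_snd_eq (f : X) : ‖sndCLM f‖ = (eLpNorm f.fn 2 volume).toReal := by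
  rw [Lp.norm_def, eLpNorm_congr_ae f.fn_ae_snd]

lemma norm_eq (f : X) : ‖f‖ = max (eLpNorm f.fn 1 volume).toReal (eLpNorm f.fn 2 volume).toReal := by
  rw [norm_def, norm_fst_eq, norm_snd_eq]

lemma integral_norm_le (f : X) : ∫ x, ‖f.fn x‖ ≤ ‖f‖ := by
  refine le_trans (le_of_eq ?_) f.norm_fst_le
  rw [norm_fst_eq, eLpNorm_one_eq_lintegral_enorm,
    integral_norm_eq_lintegral_enorm f.memX.1.1]

lemma normX_fn (f : X) : normX f.fn = ENNReal.ofReal (‖fstCLM f‖ + ‖sndCLM f‖) := by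
  rw [norm_fst_eq, norm_snd_eq, ENNReal.ofReal_add ENNReal.toReal_nonneg ENNReal.toReal_nonneg,
    ENNReal.ofReal_toReal f.memX.1.2.ne, ENNReal.ofReal_toReal f.memX.2.2.ne, normX]

lemma norm_le_of_eLpNorm_le {f g : X} (h : ∀ p : ℝ≥0∞, eLpNorm f.fn p volume ≤ eLpNorm g.fn p volume) :
    ‖f‖ ≤ ‖g‖ := by
  rw [norm_eq, norm_eq]
  exact max_le_max (ENNReal.toReal_mono g.memX.1.2.ne (h 1))
    (ENNReal.toReal_mono g.memX.2.2.ne (h 2))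

/-- The operator on `X` given by a linear operator on functions that does not increase norms. -/
def liftCLM (T : (ℝ → ℂ) → (ℝ → ℂ)) (hT : ∀ f, MemX f → MemX (T f))
    (hcongr : ∀ f g : ℝ → ℂ, f =ᵐ[volume] g → T f =ᵐ[volume] T g)
    (hadd : ∀ f g : ℝ → ℂ, T (fun x => f x + g x) = fun x => T f x + T g x)
    (hsmul : ∀ (c : ℂ) (f : ℝ → ℂ), T (fun x => c * f x) = fun x => c * T f x)
    (hle : ∀ f : ℝ → ℂ, AEStronglyMeasurable f volume →
      ∀ p : ℝ≥0∞, eLpNorm (T f) p volume ≤ eLpNorm f p volume) : X →L[ℂ] X :=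
  LinearMap.mkContinuous
    { toFun := fun f => mk (T f.fn) (hT _ f.memX)
      map_add' := fun f g => ext_ae (by
        filter_upwards [fn_mk (hT _ (f + g).memX), fn_mk (hT _ f.memX), fn_mk (hT _ g.memX),
          hcongr _ _ (fn_add f g), fn_add (mk _ (hT _ f.memX)) (mk _ (hT _ g.memX))]
          with x h1 h2 h3 h4 h5
        rw [h1, h4, h5, h2, h3, hadd])
      map_smul' := fun c f => ext_ae (by
        filter_upwards [fn_mk (hT _ (c • f).memX), fn_mk (hT _ f.memX),
          hcongr _ _ (fn_smul c f), fn_smul c (mk _ (hT _ f.memX))]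
          with x h1 h2 h4 h5
        rw [h1, h4, RingHom.id_apply, h5, h2, hsmul]) } 1 fun f => by
      rw [one_mul]
      refine norm_le_of_eLpNorm_le fun p => ?_
      exact (eLpNorm_congr_ae (fn_mk (hT _ f.memX))).trans_le (hle _ f.memX.1.1 p)

/-- Multiplication with the indicator function of a measurable set. -/
def ind (s : Set ℝ) (hs : MeasurableSet s) : X →L[ℂ] X :=
  liftCLM (fun f => s.indicator f) (fun _ hf => ⟨hf.1.indicator hs, hf.2.indicator hs⟩)
    (fun f g h => h.mono fun x hx => by simp only [indicator, hx])
    (fun f g => by funext x; by_cases h : x ∈ s <;> simp [h])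
    (fun c f => by funext x; by_cases h : x ∈ s <;> simp [h])
    (fun f _ _ => eLpNorm_indicator_le f)

lemma fn_ind (s : Set ℝ) (hs : MeasurableSet s) (f : X) :
    (ind s hs f).fn =ᵐ[volume] s.indicator f.fn :=
  fn_mk ⟨f.memX.1.indicator hs, f.memX.2.indicator hs⟩

lemma norm_ind_le (s : Set ℝ) (hs : MeasurableSet s) (f : X) : ‖ind s hs f‖ ≤ ‖f‖ :=
  norm_le_of_eLpNorm_le fun _ =>
    (eLpNorm_congr_ae (fn_ind s hs f)).trans_le (eLpNorm_indicator_le _)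

lemma measurePreserving_sub (h : ℝ) :
    MeasurePreserving (fun x : ℝ => x - h) volume volume := measurePreserving_sub_right volume h

lemma measurePreserving_neg : MeasurePreserving (fun x : ℝ => -x) volume volume :=
  Measure.measurePreserving_neg volume

/-- The operator `f ↦ f ∘ e` for a measure preserving map. -/
def comp (e : ℝ → ℝ) (he : MeasurePreserving e volume volume) : X →L[ℂ] X :=
  liftCLM (fun f => f ∘ e)
    (fun _ hf => ⟨hf.1.comp_measurePreserving he, hf.2.comp_measurePreserving he⟩)
    (fun _ _ h => he.quasiMeasurePreserving.ae_eq_comp h)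
    (fun _ _ => rfl) (fun _ _ => rfl)
    (fun _ hf _ => (eLpNorm_comp_measurePreserving hf he).le)

lemma fn_comp (e : ℝ → ℝ) (he : MeasurePreserving e volume volume) (f : X) :
    (comp e he f).fn =ᵐ[volume] fun x => f.fn (e x) :=
  fn_mk ⟨f.memX.1.comp_measurePreserving he, f.memX.2.comp_measurePreserving he⟩

lemma norm_comp (e : ℝ → ℝ) (he : MeasurePreserving e volume volume) (f : X) :
    ‖comp e he f‖ = ‖f‖ := by
  have h : ∀ p, eLpNorm (comp e he f).fn p volume = eLpNorm f.fn p volume := fun p =>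
    (eLpNorm_congr_ae (fn_comp e he f)).trans (eLpNorm_comp_measurePreserving f.memX.1.1 he)
  rw [norm_eq, norm_eq, h, h]

/-- Translation. -/
def trans (h : ℝ) : X →L[ℂ] X := comp _ (measurePreserving_sub h)

/-- Reflection. -/
def refl : X →L[ℂ] X := comp _ measurePreserving_neg

lemma fn_trans (h : ℝ) (f : X) : (trans h f).fn =ᵐ[volume] fun x => f.fn (x - h) := fn_comp _ _ f

lemma fn_refl (f : X) : (refl f).fn =ᵐ[volume] fun x => f.fn (-x) := fn_comp _ _ f

lemma norm_trans (h : ℝ) (f : X) : ‖trans h f‖ = ‖f‖ := norm_comp _ _ f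

lemma norm_refl (f : X) : ‖refl f‖ = ‖f‖ := norm_comp _ _ f

/-- Translation is jointly continuous on L^p for p < ∞, here in both components. Joint continuity is
needed for the Bochner integrals of translates and for the Volterra equation in `X`. -/
lemma continuous_trans : Continuous fun p : ℝ × X => trans p.1 p.2 := by
  let g : ℝ → C(ℝ, ℝ) := ContinuousMap.curry ⟨fun p : ℝ × ℝ => p.2 - p.1, by fun_prop⟩
  have hg : Continuous g := ContinuousMap.continuous _
  have hgm : ∀ h, MeasurePreserving (g h) volume volume := measurePreserving_sub
  have h1 : Continuous fun p : ℝ × X =>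
      Lp.compMeasurePreserving (g p.1) (hgm p.1) (fstCLM p.2) :=
    Continuous.compMeasurePreservingLp (fstCLM.continuous.comp continuous_snd)
      (hg.comp continuous_fst) _ ENNReal.one_ne_top
  have h2 : Continuous fun p : ℝ × X =>
      Lp.compMeasurePreserving (g p.1) (hgm p.1) (sndCLM p.2) :=
    Continuous.compMeasurePreservingLp (sndCLM.continuous.comp continuous_snd)
      (hg.comp continuous_fst) _ ENNReal.ofNat_ne_top
  refine (Topology.IsInducing.subtypeVal
    (t := {p | p ∈ submoduleX})).continuous_iff.2 ?_
  refine (h1.prodMk h2).congr fun p => Prod.ext (Lp.ext ?_) (Lp.ext ?_)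
  · exact (Lp.coeFn_compMeasurePreserving _ _).trans (fn_trans p.1 p.2).symm
  · refine ((Lp.coeFn_compMeasurePreserving _ _).trans ?_).trans
      ((fn_trans p.1 p.2).symm.trans (fn_ae_snd _))
    exact (hgm p.1).quasiMeasurePreserving.ae_eq_comp (fn_ae_snd p.2).symm

end X

lemma fourierX_congr {f g : ℝ → ℂ} (h : f =ᵐ[volume] g) : fourierX f = fourierX g := by
  funext ξ
  exact integral_congr_ae (h.mono fun x hx => by simp only [hx])

namespace X

/-! ### Functionals and the Fourier transform on `X` -/

lemma integrable_pairing {φ : ℝ → ℂ} (hφ : AEStronglyMeasurable φ volume)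
    (h1 : ∀ x, ‖φ x‖ ≤ 1) (f : X) : Integrable (fun x => φ x * f.fn x) volume :=
  f.integrable.bdd_mul hφ (Eventually.of_forall h1)

/-- The functional `f ↦ ∫ φ f` for a bounded function `φ`. -/
def pairing (φ : ℝ → ℂ) (hφ : AEStronglyMeasurable φ volume) (h1 : ∀ x, ‖φ x‖ ≤ 1) :
    X →L[ℂ] ℂ :=
  LinearMap.mkContinuous
    { toFun := fun f => ∫ x, φ x * f.fn x
      map_add' := fun f g => by
        rw [← integral_add (integrable_pairing hφ h1 f) (integrable_pairing hφ h1 g)]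
        refine integral_congr_ae ((fn_add f g).mono fun x hx => ?_)
        simp only [hx, mul_add]
      map_smul' := fun c f => by
        rw [RingHom.id_apply, smul_eq_mul, ← integral_const_mul]
        refine integral_congr_ae ((fn_smul c f).mono fun x hx => ?_)
        simp only [hx, mul_left_comm] } 1 fun f => by
      rw [one_mul]
      refine (norm_integral_le_integral_norm _).trans (le_trans ?_ f.integral_norm_le)
      refine integral_mono (integrable_pairing hφ h1 f).norm f.integrable.norm fun x => ?_
      simp only [norm_mul]
      exact mul_le_of_le_one_left (norm_nonneg _) (h1 x)

lemma pairing_apply {φ : ℝ → ℂ} (hφ : AEStronglyMeasurable φ volume) (h1 : ∀ x, ‖φ x‖ ≤ 1)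
    (f : X) : pairing φ hφ h1 f = ∫ x, φ x * f.fn x := rfl

lemma norm_pairing_le {φ : ℝ → ℂ} (hφ : AEStronglyMeasurable φ volume) (h1 : ∀ x, ‖φ x‖ ≤ 1)
    (f : X) : ‖pairing φ hφ h1 f‖ ≤ ‖f‖ := by
  have := LinearMap.mkContinuous_norm_le (𝕜 := ℂ) (pairing φ hφ h1 : X →ₗ[ℂ] ℂ) zero_le_one
    fun f => by
      rw [one_mul]
      refine (norm_integral_le_integral_norm _).trans (le_trans ?_ f.integral_norm_le)
      refine integral_mono (integrable_pairing hφ h1 f).norm f.integrable.norm fun x => ?_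
      simp only [norm_mul]
      exact mul_le_of_le_one_left (norm_nonneg _) (h1 x)
  simpa using ContinuousLinearMap.le_of_opNorm_le _ this f

lemma norm_exp_two_I (ξ x : ℝ) :
    ‖Complex.exp (2 * Complex.I * (ξ : ℂ) * (x : ℂ))‖ = 1 := by
  rw [Complex.norm_exp]
  simp

/-- The value of the Fourier transform at `ξ`. -/
def hat (ξ : ℝ) : X →L[ℂ] ℂ :=
  pairing (fun x => Complex.exp (2 * Complex.I * (ξ : ℂ) * (x : ℂ)))
    (Continuous.aestronglyMeasurable (by fun_prop)) fun x => (norm_exp_two_I ξ x).le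

lemma hat_eq (ξ : ℝ) (f : X) : hat ξ f = fourierX f.fn ξ := rfl

lemma norm_hat_le (ξ : ℝ) (f : X) : ‖hat ξ f‖ ≤ ‖f‖ := norm_pairing_le _ _ f

lemma hat_mk {f : ℝ → ℂ} (hf : MemX f) (ξ : ℝ) : hat ξ (mk f hf) = fourierX f ξ := by
  rw [hat_eq, fourierX_congr (fn_mk hf)]

lemma memXhat_iff {g : ℝ → ℂ} : MemXhat g ↔ ∃ f : X, ∀ ξ, hat ξ f = g ξ := by
  constructor
  · rintro ⟨f, hf, rfl⟩
    exact ⟨mk f hf, hat_mk hf⟩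
  · rintro ⟨f, hf⟩
    exact ⟨f.fn, f.memX, funext hf⟩

lemma memXhat_hat (f : X) : MemXhat fun ξ => hat ξ f := memXhat_iff.2 ⟨f, fun _ => rfl⟩

lemma hat_trans (ξ h : ℝ) (f : X) :
    hat ξ (trans h f) = Complex.exp (2 * Complex.I * (ξ : ℂ) * (h : ℂ)) * hat ξ f := by
  rw [hat_eq, fourierX_congr (fn_trans h f), hat_eq, fourierX, fourierX, ← integral_const_mul,
    ← integral_add_right_eq_self _ h]
  refine integral_congr_ae (Eventually.of_forall fun x => ?_)
  simp only [add_sub_cancel_right, ← mul_assoc, ← Complex.exp_add]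
  congr 2
  push_cast
  ring

lemma hat_refl (ξ : ℝ) (f : X) : hat ξ (refl f) = hat (-ξ) f := by
  rw [hat_eq, fourierX_congr (fn_refl f), hat_eq, fourierX, fourierX,
    ← integral_neg_eq_self]
  refine integral_congr_ae (Eventually.of_forall fun x => ?_)
  simp

/-- The involution `f ↦ conj (f (-x))`, which corresponds to the conjugation of the Fourier
transform. -/
def inv (f : X) : X :=
  mk (fun x => conj ((refl f).fn x))
    ⟨(refl f).memX.1.star, (refl f).memX.2.star⟩

lemma fn_inv (f : X) : (inv f).fn =ᵐ[volume] fun x => conj (f.fn (-x)) :=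
  (fn_mk _).trans ((fn_refl f).mono fun x hx => by simp only [hx])

lemma hat_inv (ξ : ℝ) (f : X) : hat ξ (inv f) = conj (hat ξ f) := by
  rw [hat_eq, fourierX_congr (fn_inv f), hat_eq, fourierX, fourierX,
    ← integral_neg_eq_self, ← integral_conj]
  refine integral_congr_ae (Eventually.of_forall fun x => ?_)
  simp [← Complex.exp_conj, Complex.conj_ofNat]

lemma norm_inv (f : X) : ‖inv f‖ = ‖f‖ := by
  rw [← norm_refl f]
  have h : ∀ p, eLpNorm (inv f).fn p volume = eLpNorm (refl f).fn p volume := fun p => by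
    rw [eLpNorm_congr_ae (show (inv f).fn =ᵐ[volume] fun x => conj ((refl f).fn x) from fn_mk _)]
    refine eLpNorm_congr_norm_ae (Eventually.of_forall fun x => ?_)
    simp
  rw [norm_eq, norm_eq, h, h]

lemma inv_sub (f g : X) : inv (f - g) = inv f - inv g := by
  rw [eq_sub_iff_add_eq]
  have h : (f - g) + g = f := sub_add_cancel f g
  refine ext_ae ?_
  have h2 := measurePreserving_neg.quasiMeasurePreserving.ae_eq_comp (fn_add (f - g) g)
  rw [h] at h2
  filter_upwards [fn_add (inv (f - g)) (inv g), fn_inv f, fn_inv g, fn_inv (f - g), h2]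
    with x h3 h4 h5 h6 h7
  simp only [Function.comp] at h7
  rw [h3, h4, h5, h6, h7, map_add]

lemma continuous_inv : Continuous inv := by
  refine Isometry.continuous (Isometry.of_dist_eq fun f g => ?_)
  rw [dist_eq_norm, dist_eq_norm, ← inv_sub, norm_inv]

/-! ### Plancherel's theorem -/

open FourierTransform in
lemma fourierX_eq_fourier (f : ℝ → ℂ) (ξ : ℝ) : fourierX f ξ = 𝓕 f (-Real.pi⁻¹ * ξ) := by
  rw [Real.fourier_eq', fourierX]
  refine integral_congr_ae (Eventually.of_forall fun x => ?_)
  have : (Real.pi : ℂ) ≠ 0 := by exact_mod_cast Real.pi_ne_zero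
  simp only [smul_eq_mul]
  congr 2
  simp
  field_simp

open FourierTransform in
-- The L² transform, defined by extension, is compared with the integral by testing against smooth
-- compactly supported functions and using the multiplication formula ∫ φ̂ f = ∫ φ f̂.
lemma fourier_snd_ae (f : X) :
    ((𝓕 (sndCLM f) : Lp ℂ 2 (volume : Measure ℝ)) : ℝ → ℂ) =ᵐ[volume] 𝓕 f.fn := by
  have hc : Continuous (𝓕 f.fn) :=
    VectorFourier.fourierIntegral_continuous Real.continuous_fourierChar continuous_inner
      f.integrable
  refine ae_eq_of_integral_contDiff_smul_eq ?_ hc.locallyIntegrable fun φ hφ hφc => ?_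
  · exact (Lp.memLp _).locallyIntegrable (by norm_num)
  · have hφC : ContDiff ℝ (⊤ : ℕ∞) fun x => (φ x : ℂ) := Complex.ofRealCLM.contDiff.comp hφ
    have hφCc : HasCompactSupport fun x => (φ x : ℂ) := hφc.comp_left Complex.ofReal_zero
    have h1 := congrArg (fun T => T (hφCc.toSchwartzMap hφC))
      (MeasureTheory.Lp.fourier_toTemperedDistribution_eq (sndCLM f))
    simp only [TemperedDistribution.fourier_apply, Lp.toTemperedDistribution_apply] at h1
    have h2 : ∫ x, (φ x : ℂ) • (𝓕 (sndCLM f) : Lp ℂ 2 (volume : Measure ℝ)) x =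
        ∫ x, (𝓕 (fun x => (φ x : ℂ)) x) • f.fn x := by
      refine Eq.trans h1.symm (integral_congr_ae ?_)
      filter_upwards [f.fn_ae_snd] with x hx
      rw [hx]
      rfl
    have h3 := VectorFourier.integral_fourierIntegral_smul_eq_flip (L := innerₗ ℝ)
      (f := fun x => (φ x : ℂ)) (g := f.fn) (μ := volume) (ν := volume)
      Real.continuous_fourierChar continuous_inner
      (hφC.continuous.integrable_of_hasCompactSupport hφCc) f.integrable
    rw [flip_innerₗ] at h3
    simp only [← Complex.coe_smul]
    exact h2.trans h3

end X
namespace X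

open FourierTransform in
lemma continuous_hat (f : X) : Continuous fun ξ => hat ξ f := by
  have hc : Continuous (𝓕 f.fn) :=
    VectorFourier.fourierIntegral_continuous Real.continuous_fourierChar continuous_inner
      f.integrable
  refine (hc.comp (continuous_const_mul (-Real.pi⁻¹))).congr fun ξ => ?_
  rw [hat_eq, fourierX_eq_fourier]
  rfl

open FourierTransform in
lemma tendsto_hat_cocompact (f : X) : Tendsto (fun ξ => hat ξ f) (cocompact ℝ) (𝓝 0) := by
  have h := Real.zero_at_infty_fourier f.fn
  have h2 : Tendsto (fun ξ : ℝ => -Real.pi⁻¹ * ξ) (cocompact ℝ) (cocompact ℝ) :=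
    (Homeomorph.mulLeft₀ (-Real.pi⁻¹)
      (neg_ne_zero.2 (inv_ne_zero Real.pi_ne_zero))).isClosedEmbedding.tendsto_cocompact
  refine (h.comp h2).congr fun ξ => ?_
  rw [hat_eq, fourierX_eq_fourier]
  rfl

open FourierTransform in
-- Plancherel. The factor √π comes from the dilation ξ ↦ -ξ/π between the two normalizations.
lemma eLpNorm_hat (f : X) : eLpNorm (fun ξ => hat ξ f) 2 volume =
    ENNReal.ofReal Real.pi ^ (1 / 2 : ℝ) * eLpNorm f.fn 2 volume := by
  have hc : Continuous (𝓕 f.fn) :=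
    VectorFourier.fourierIntegral_continuous Real.continuous_fourierChar continuous_inner
      f.integrable
  have h0 : -Real.pi⁻¹ ≠ 0 := neg_ne_zero.2 (inv_ne_zero Real.pi_ne_zero)
  have e : (fun ξ => hat ξ f) = 𝓕 f.fn ∘ (-Real.pi⁻¹ * ·) := funext fun ξ => by
    rw [hat_eq, fourierX_eq_fourier]
    rfl
  rw [e, ← eLpNorm_map_measure hc.aestronglyMeasurable (by fun_prop),
    Real.map_volume_mul_left h0, eLpNorm_smul_measure_of_ne_top ENNReal.ofNat_ne_top, smul_eq_mul,
    ← eLpNorm_congr_ae (fourier_snd_ae f)]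
  have h1 := MeasureTheory.Lp.norm_fourier_eq (sndCLM f)
  rw [Lp.norm_def, Lp.norm_def,
    ENNReal.toReal_eq_toReal_iff' (Lp.eLpNorm_ne_top _) (Lp.eLpNorm_ne_top _)] at h1
  rw [h1, eLpNorm_congr_ae f.fn_ae_snd]
  congr 2
  · simp [abs_of_pos Real.pi_pos]
  · simp

/-- Through this consequence of Plancherel, identities in `X`, the ring axioms included, are checked
pointwise on transforms. -/
lemma hat_injective {f g : X} (h : ∀ ξ, hat ξ f = hat ξ g) : f = g := by
  have h1 := eLpNorm_hat (f - g)
  have h2 : (fun ξ => hat ξ (f - g)) = fun _ => 0 := funext fun ξ => by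
    rw [map_sub, h, sub_self]
  rw [h2, eLpNorm_zero', eq_comm, mul_eq_zero] at h1
  rcases h1 with h1 | h1
  · simp [Real.pi_pos.not_ge] at h1
  · rw [eLpNorm_eq_zero_iff (f - g).memX.2.1 two_ne_zero] at h1
    rw [← sub_eq_zero]
    refine ext_ae (h1.trans ?_)
    have := Lp.coeFn_zero ℂ 1 (volume : Measure ℝ)
    rw [← map_zero fstCLM] at this
    exact this.symm

open FourierTransform in
lemma parseval (f g : X) :
    ∫ ξ, conj (hat ξ g) * hat ξ f = Real.pi * ∫ x, conj (g.fn x) * f.fn x := by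
  have e : ∀ (f : X) (ξ : ℝ), hat ξ f = 𝓕 f.fn (-Real.pi⁻¹ * ξ) := fun f ξ => by
    rw [hat_eq, fourierX_eq_fourier]
  have h1 := MeasureTheory.Lp.inner_fourier_eq (sndCLM g) (sndCLM f)
  simp only [L2.inner_def, RCLike.inner_apply] at h1
  simp only [e]
  rw [Measure.integral_comp_mul_left (fun η => conj (𝓕 g.fn η) * 𝓕 f.fn η)]
  rw [show |(-Real.pi⁻¹)⁻¹| = Real.pi by simp [abs_of_pos Real.pi_pos], Complex.real_smul]
  congr 1
  refine Eq.trans (integral_congr_ae ?_) (h1.trans (integral_congr_ae ?_))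
  · filter_upwards [fourier_snd_ae f, fourier_snd_ae g] with x h2 h3
    rw [h2, h3, mul_comm]
  · filter_upwards [fn_ae_snd f, fn_ae_snd g] with x h2 h3
    rw [h2, h3, mul_comm]

/-! ### The convolution algebra -/

lemma continuous_trans_left (g : X) : Continuous fun x => trans x g :=
  continuous_trans.comp (continuous_id.prodMk continuous_const)

lemma integrable_smul_trans (f g : X) : Integrable (fun x => f.fn x • trans x g) volume := by
  refine f.integrable.smul_bdd ‖g‖ (continuous_trans_left g).aestronglyMeasurable
    (Eventually.of_forall fun x => (norm_trans x g).le)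

/-- Convolution as a Bochner integral of translates, so that continuous linear maps pass under the
integral. -/
instance : Mul X := ⟨fun f g => ∫ x, f.fn x • trans x g⟩

lemma mul_def (f g : X) : f * g = ∫ x, f.fn x • trans x g := rfl

lemma clm_mul {E : Type*} [NormedAddCommGroup E] [NormedSpace ℂ E] [CompleteSpace E]
    (L : X →L[ℂ] E) (f g : X) : L (f * g) = ∫ x, f.fn x • L (trans x g) := by
  rw [mul_def, ← L.integral_comp_comm (integrable_smul_trans f g)]
  simp only [map_smul]

lemma hat_mul (ξ : ℝ) (f g : X) : hat ξ (f * g) = hat ξ f * hat ξ g := by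
  rw [clm_mul]
  simp only [hat_trans, smul_eq_mul, ← mul_assoc]
  rw [integral_mul_const, hat_eq ξ f, fourierX]
  simp only [mul_comm (f.fn _)]

lemma norm_mul_le' (f g : X) : ‖f * g‖ ≤ ‖f‖ * ‖g‖ := by
  refine (norm_integral_le_integral_norm _).trans ?_
  simp only [norm_smul, norm_trans]
  rw [integral_mul_const]
  exact mul_le_mul_of_nonneg_right f.integral_norm_le (norm_nonneg _)

instance : NonUnitalNormedCommRing X :=
  { (inferInstance : NormedAddCommGroup X) with
    mul := (· * ·)
    left_distrib := fun f g h => hat_injective fun ξ => by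
      simp only [hat_mul, map_add, mul_add]
    right_distrib := fun f g h => hat_injective fun ξ => by
      simp only [hat_mul, map_add, add_mul]
    zero_mul := fun f => hat_injective fun ξ => by simp only [hat_mul, map_zero, zero_mul]
    mul_zero := fun f => hat_injective fun ξ => by simp only [hat_mul, map_zero, mul_zero]
    mul_assoc := fun f g h => hat_injective fun ξ => by simp only [hat_mul, mul_assoc]
    mul_comm := fun f g => hat_injective fun ξ => by simp only [hat_mul, mul_comm]
    norm_mul_le := norm_mul_le' }

instance : IsScalarTower ℂ X X := ⟨fun c f g => hat_injective fun ξ => by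
  simp only [smul_eq_mul, hat_mul, map_smul, mul_assoc]⟩

instance : SMulCommClass ℂ X X := ⟨fun c f g => hat_injective fun ξ => by
  simp only [smul_eq_mul, hat_mul, map_smul, mul_left_comm]⟩

end X

/-! ### The unital algebra -/

/-- The Banach algebra `ℂ ⊕ X`. -/
abbrev A : Type := WithLp 1 (Unitization ℂ X)

namespace A

instance : NormedCommRing A :=
  { (inferInstance : NormedRing A) with
    mul_comm := fun a b => by
      apply WithLp.ofLp_injective
      simp only [WithLp.unitization_mul]
      exact mul_comm _ _ }

/-- The inclusion of `X`. -/
def ofX (f : X) : A := WithLp.toLp 1 (Unitization.inr f)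

/-- The component in `X`. -/
def snd (a : A) : X := (WithLp.ofLp a).snd

/-- The value at infinity. -/
def evInf : A →ₐ[ℂ] ℂ :=
  (Unitization.fstHom ℂ X).comp (WithLp.unitizationAlgEquiv (𝕜 := ℂ) (A := X) ℂ).toAlgHom

lemma continuous_ofX : Continuous ofX := WithLp.unitization_isometry_inr.continuous

lemma ofX_add (f g : X) : ofX (f + g) = ofX f + ofX g :=
  congrArg (WithLp.toLp 1) (Unitization.inr_add ℂ f g)

lemma ofX_mul (f g : X) : ofX (f * g) = ofX f * ofX g :=
  congrArg (WithLp.toLp 1) (Unitization.inr_mul ℂ f g)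

lemma norm_def (a : A) : ‖a‖ = ‖evInf a‖ + ‖snd a‖ := WithLp.unitization_norm_def a

lemma snd_sub (a b : A) : snd (a - b) = snd a - snd b := rfl

lemma evInf_ofX (f : X) : evInf (ofX f) = 0 := rfl

lemma snd_ofX (f : X) : snd (ofX f) = f := rfl

lemma continuous_snd : Continuous snd := by
  refine LipschitzWith.continuous (K := 1) (LipschitzWith.of_dist_le_mul fun a b => ?_)
  rw [dist_eq_norm, dist_eq_norm, ← snd_sub, NNReal.coe_one, one_mul, norm_def (a - b)]
  linarith [norm_nonneg (evInf (a - b))]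

lemma eq_add (a : A) : a = algebraMap ℂ A (evInf a) + ofX (snd a) := by
  apply WithLp.ofLp_injective
  exact (Unitization.inl_fst_add_inr_snd_eq (WithLp.ofLp a)).symm

/-- The value at `ξ ∈ ℝ`. -/
def ev (ξ : ℝ) : A →ₐ[ℂ] ℂ where
  toFun a := evInf a + X.hat ξ (snd a)
  map_one' := by
    have h : snd (1 : A) = 0 := rfl
    rw [h, map_one, map_zero, add_zero]
  map_zero' := by
    have h : snd (0 : A) = 0 := rfl
    rw [h, map_zero, map_zero, add_zero]
  map_add' a b := by
    have h : snd (a + b) = snd a + snd b := rfl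
    rw [h, map_add, map_add]
    ring
  map_mul' a b := by
    have h : snd (a * b) = evInf a • snd b + evInf b • snd a + snd a * snd b := rfl
    rw [h, map_mul, map_add, map_add, X.hat_mul, map_smul, map_smul, smul_eq_mul, smul_eq_mul]
    ring
  commutes' c := by
    have h : snd (algebraMap ℂ A c) = 0 := rfl
    rw [h, map_zero, add_zero]
    exact AlgHom.commutes evInf c

lemma ev_apply (ξ : ℝ) (a : A) : ev ξ a = evInf a + X.hat ξ (snd a) := rfl

lemma ev_ofX (ξ : ℝ) (f : X) : ev ξ (ofX f) = X.hat ξ f := by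
  rw [ev_apply, evInf_ofX, snd_ofX, zero_add]

lemma norm_ev_le (ξ : ℝ) (a : A) : ‖ev ξ a‖ ≤ ‖a‖ := by
  rw [ev_apply, norm_def]
  exact (norm_add_le _ _).trans (by gcongr; exact X.norm_hat_le ξ _)

lemma norm_evInf_le (a : A) : ‖evInf a‖ ≤ ‖a‖ := by
  rw [norm_def]
  linarith [norm_nonneg (snd a)]

lemma continuous_ev (ξ : ℝ) : Continuous (ev ξ) :=
  AddMonoidHomClass.continuous_of_bound (ev ξ) 1 fun a => by
    rw [one_mul]; exact norm_ev_le ξ a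

lemma continuous_evInf : Continuous evInf :=
  AddMonoidHomClass.continuous_of_bound evInf 1 fun a => by
    rw [one_mul]; exact norm_evInf_le a

lemma continuous_ev_apply (a : A) : Continuous fun ξ => ev ξ a :=
  continuous_const.add (X.continuous_hat _)

lemma tendsto_ev (a : A) : Tendsto (fun ξ => ev ξ a) (cocompact ℝ) (𝓝 (evInf a)) := by
  simpa only [add_zero, ← ev_apply] using
    (X.tendsto_hat_cocompact (snd a)).const_add (evInf a)

instance : NormedAlgebra ℚ A := NormedAlgebra.restrictScalars ℚ ℂ A

lemma ev_exp (ξ : ℝ) (a : A) : ev ξ (NormedSpace.exp a) = Complex.exp (ev ξ a) := by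
  rw [NormedSpace.map_exp (ev ξ) (continuous_ev ξ), Complex.exp_eq_exp_ℂ]

lemma evInf_exp (a : A) : evInf (NormedSpace.exp a) = Complex.exp (evInf a) := by
  rw [NormedSpace.map_exp evInf continuous_evInf, Complex.exp_eq_exp_ℂ]

end A

/-! ### Wiener's lemma -/

/-- Bounded continuous one-parameter groups of complex numbers. -/
lemma exists_eq_exp_of_add {χ : ℝ → ℂ} (hc : Continuous χ) (h0 : χ 0 = 1)
    (hadd : ∀ x y, χ (x + y) = χ x * χ y) {C : ℝ} (hb : ∀ x, ‖χ x‖ ≤ C) :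
    ∃ ξ : ℝ, ∀ x : ℝ, χ x = Complex.exp (2 * Complex.I * (ξ : ℂ) * (x : ℂ)) := by
  have hF : ∀ x, HasDerivAt (fun x => ∫ s in (0 : ℝ)..x, χ s) (χ x) x := fun x =>
    intervalIntegral.integral_hasDerivAt_right (hc.intervalIntegrable _ _)
      (hc.stronglyMeasurableAtFilter _ _) hc.continuousAt
  -- The primitive of χ has derivative χ(0) = 1 at 0, so it is not identically zero. Dividing by its
  -- value at such a δ expresses χ by its own primitive and makes χ differentiable.
  obtain ⟨δ, hδ⟩ : ∃ δ, (∫ s in (0 : ℝ)..δ, χ s) ≠ 0 := by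
    by_contra! h
    have h1 := hF 0
    have h2 : (fun x => ∫ s in (0 : ℝ)..x, χ s) = fun _ => 0 := funext h
    rw [h2, h0] at h1
    exact zero_ne_one ((hasDerivAt_const (0 : ℝ) (0 : ℂ)).unique h1)
  set c := ∫ s in (0 : ℝ)..δ, χ s
  have he : ∀ x, χ x = ((∫ s in (0 : ℝ)..(x + δ), χ s) - ∫ s in (0 : ℝ)..x, χ s) / c := by
    intro x
    rw [eq_div_iff hδ, intervalIntegral.integral_interval_sub_left
      (hc.intervalIntegrable _ _) (hc.intervalIntegrable _ _),
      ← intervalIntegral.integral_const_mul]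
    have := intervalIntegral.integral_comp_add_left (a := 0) (b := δ) χ x
    simp only [hadd, add_zero] at this
    exact this
  set l : ℂ := (χ δ - 1) / c
  have hd : ∀ x, HasDerivAt χ (l * χ x) x := by
    intro x
    have h1 := (((hF (x + δ)).comp_add_const x δ).sub (hF x)).div_const c
    have h3 : HasDerivAt χ ((χ (x + δ) - χ x) / c) x :=
      h1.congr_of_eventuallyEq (Eventually.of_forall he)
    refine h3.congr_deriv ?_
    rw [hadd]
    simp only [l]
    ring
  have hcx : ∀ x : ℝ, χ x = Complex.exp (l * x) := by
    have h2 : ∀ x : ℝ, HasDerivAt (fun x : ℝ => χ x * Complex.exp (-l * x)) 0 x := by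
      intro x
      have h1 := ((hasDerivAt_id' (x : ℂ)).const_mul (-l)).cexp.comp_ofReal
      exact ((hd x).fun_mul h1).congr_deriv (by ring)
    intro x
    have h3 := is_const_of_deriv_eq_zero (fun x => (h2 x).differentiableAt)
      (fun x => (h2 x).deriv) x 0
    simp only [h0, Complex.ofReal_zero, mul_zero, Complex.exp_zero, mul_one] at h3
    rw [neg_mul, Complex.exp_neg] at h3
    exact (mul_inv_eq_one₀ (Complex.exp_ne_zero _)).1 h3
  -- Otherwise |χ| would equal exp(C + 1) > C at the point (C + 1) / Re l.
  have hre : l.re = 0 := by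
    by_contra hne
    have hC : 0 < C := by
      have := hb 0
      rw [h0, norm_one] at this
      linarith
    have h1 := hb ((C + 1) / l.re)
    rw [hcx, Complex.norm_exp] at h1
    have h2 : (l * (((C + 1) / l.re : ℝ) : ℂ)).re = C + 1 := by
      rw [Complex.re_mul_ofReal]
      field_simp
    rw [h2] at h1
    linarith [Real.add_one_le_exp (C + 1)]
  refine ⟨l.im / 2, fun x => ?_⟩
  rw [hcx]
  congr 2
  apply Complex.ext
  · simp [hre]
  · simp
    ring

namespace X

lemma trans_mul (x : ℝ) (f g : X) : trans x f * g = f * trans x g := hat_injective fun ξ => by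
  rw [hat_mul, hat_mul, hat_trans, hat_trans]
  ring

lemma trans_add (x y : ℝ) (f : X) : trans (x + y) f = trans x (trans y f) :=
  hat_injective fun ξ => by
    rw [hat_trans, hat_trans, hat_trans, ← mul_assoc, ← Complex.exp_add]
    congr 2
    push_cast
    ring

lemma trans_zero (f : X) : trans 0 f = f := hat_injective fun ξ => by simp [hat_trans]

/-- Since τₓg * h = g * τₓh, the quotient L(τₓh) / L(h) does not depend on h. It is a bounded
continuous character of ℝ, hence an exponential. Inserting it into L(f * g) = ∫ f(x) L(τₓg) dx
identifies L. -/
lemma eq_hat_of_multiplicative (L : X →L[ℂ] ℂ) (hL : ∀ f g, L (f * g) = L f * L g) (hne : L ≠ 0) :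
    ∃ ξ, L = hat ξ := by
  obtain ⟨g, hg⟩ : ∃ g, L g ≠ 0 := by
    by_contra! h
    exact hne (ContinuousLinearMap.ext h)
  have h1 : ∀ x h, L (trans x h) = L (trans x g) / L g * L h := fun x h => by
    have := congrArg L (trans_mul x g h)
    rw [hL, hL] at this
    field_simp
    linear_combination -this
  obtain ⟨ξ, hξ⟩ := exists_eq_exp_of_add (χ := fun x => L (trans x g) / L g)
    (C := ‖L‖ * ‖g‖ / ‖L g‖) ((L.continuous.comp (continuous_trans_left g)).div_const _)
    (by simp only [trans_zero]; exact div_self hg)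
    (fun x y => by
      rw [trans_add, h1 x]
      ring)
    (fun x => by
      rw [norm_div]
      gcongr
      rw [← norm_trans x g]
      exact L.le_opNorm _)
  refine ⟨ξ, ContinuousLinearMap.ext fun f => ?_⟩
  have h2 := clm_mul L f g
  rw [hL] at h2
  have h3 := fun x => (div_eq_iff hg).1 (hξ x)
  simp only [h3, smul_eq_mul, ← mul_assoc] at h2
  rw [integral_mul_const] at h2
  rw [mul_right_cancel₀ hg h2, hat_eq, fourierX]
  exact integral_congr_ae (Eventually.of_forall fun x => mul_comm _ _)

end X

namespace A

/-- The inclusion of `X` as a continuous linear map. -/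
def ofXL : X →L[ℂ] A where
  toFun := ofX
  map_add' := ofX_add
  map_smul' c f := congrArg (WithLp.toLp 1) (Unitization.inr_smul ℂ c f)
  cont := continuous_ofX

/-- Wiener's lemma. -/
lemma isUnit_of_ev_ne_zero {a : A} (hi : evInf a ≠ 0) (h : ∀ ξ, ev ξ a ≠ 0) : IsUnit a := by
  by_contra hu
  -- By Gelfand theory a non-unit is annihilated by a character. A character of `A` either vanishes
  -- on `X`, and is `evInf`, or restricts to an evaluation on `X`.
  obtain ⟨φ, hφ⟩ := WeakDual.CharacterSpace.exists_apply_eq_zero hu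
  have hsum := eq_add a
  have h1 : φ a = evInf a + φ (ofX (snd a)) := by
    conv_lhs => rw [hsum]
    rw [map_add, AlgHomClass.commutes]
    rfl
  let L : X →L[ℂ] ℂ := (WeakDual.CharacterSpace.toCLM φ).comp ofXL
  have hLa : ∀ f, L f = φ (ofX f) := fun f => rfl
  by_cases hL : L = 0
  · rw [← hLa, hL, zero_apply, add_zero, hφ] at h1
    exact hi h1.symm
  · obtain ⟨ξ, hξ⟩ := X.eq_hat_of_multiplicative L (fun f g => by
      rw [hLa, ofX_mul, map_mul, hLa, hLa]) hL
    rw [← hLa, hξ, ← ev_apply, hφ] at h1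
    exact h ξ h1.symm

/-! ### Logarithms -/

/-- The elements with positive values, and with value `1` at infinity. -/
def IsPos (a : A) : Prop := evInf a = 1 ∧ ∀ ξ, ∃ r : ℝ, 0 < r ∧ ev ξ a = r

lemma IsPos.isUnit {a : A} (h : IsPos a) : IsUnit a :=
  isUnit_of_ev_ne_zero (by rw [h.1]; exact one_ne_zero) fun ξ => by
    obtain ⟨r, hr, he⟩ := h.2 ξ
    rw [he]
    exact_mod_cast hr.ne'

/-- `ℓ` is the logarithm of `a`. -/
def IsLog (a : A) (l : X) : Prop := ∀ ξ, X.hat ξ l = (Real.log (ev ξ a).re : ℝ)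

/-- By the inverse function theorem, exp is locally invertible at 0. Where the inverse has norm
below π, its pointwise values have imaginary part in (-π, π), so they are principal logarithms. The
value at infinity is then log 1 = 0, and the logarithm lies in `X`. -/
lemma exists_local_log : ∃ Λ : A → X, ContinuousAt Λ 1 ∧ Λ 1 = 0 ∧
    ∀ᶠ b in 𝓝 (1 : A), IsPos b → IsLog b (Λ b) := by
  have hs : HasStrictFDerivAt (NormedSpace.exp : A → A)
      ((ContinuousLinearEquiv.refl ℂ A : A ≃L[ℂ] A) : A →L[ℂ] A) 0 :=
    hasStrictFDerivAt_exp_zero (𝕂 := ℂ)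
  have e0 : NormedSpace.exp (0 : A) = 1 := NormedSpace.exp_zero
  have hc := hs.localInverse_continuousAt
  have hz := hs.localInverse_apply_image
  have hr := hs.eventually_right_inverse
  rw [e0] at hc hz hr
  set Λ := hs.localInverse
  have hsm : ∀ᶠ b in 𝓝 (1 : A), ‖Λ b‖ < Real.pi := by
    have : Tendsto (fun b => ‖Λ b‖) (𝓝 1) (𝓝 ‖Λ 1‖) := hc.norm
    rw [hz, norm_zero] at this
    exact this.eventually_lt_const Real.pi_pos
  refine ⟨fun b => snd (Λ b), continuous_snd.continuousAt.comp hc, by simp only [hz]; rfl, ?_⟩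
  filter_upwards [hr, hsm] with b h1 h2 hb
  have key : ∀ w z : ℂ, ‖w‖ < Real.pi → Complex.exp w = z → w = Complex.log z := by
    intro w z hw hz
    rw [← hz, Complex.log_exp]
    · linarith [neg_abs_le w.im, Complex.abs_im_le_norm w]
    · linarith [le_abs_self w.im, Complex.abs_im_le_norm w]
  have hI : evInf (Λ b) = 0 := by
    rw [key (evInf (Λ b)) 1 ((norm_evInf_le _).trans_lt h2) (by rw [← evInf_exp, h1, hb.1]),
      Complex.log_one]
  intro ξ
  obtain ⟨r, hr0, hr⟩ := hb.2 ξ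
  have h3 := key (ev ξ (Λ b)) (ev ξ b) ((norm_ev_le ξ _).trans_lt h2) (by rw [← ev_exp, h1])
  rw [ev_apply, hI, zero_add] at h3
  rw [h3, hr, Complex.ofReal_re, Complex.ofReal_log hr0.le]

lemma IsPos.mul {a b : A} (ha : IsPos a) (hb : IsPos b) : IsPos (a * b) := by
  refine ⟨by rw [map_mul, ha.1, hb.1, one_mul], fun ξ => ?_⟩
  obtain ⟨r, hr, h1⟩ := ha.2 ξ
  obtain ⟨s, hs, h2⟩ := hb.2 ξ
  exact ⟨r * s, mul_pos hr hs, by rw [map_mul, h1, h2, Complex.ofReal_mul]⟩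

lemma IsPos.of_mul_eq_one {a b : A} (ha : IsPos a) (hab : a * b = 1) : IsPos b := by
  refine ⟨?_, fun ξ => ?_⟩
  · have := congrArg evInf hab
    rwa [map_mul, ha.1, one_mul, map_one] at this
  · obtain ⟨r, hr, h1⟩ := ha.2 ξ
    refine ⟨r⁻¹, inv_pos.2 hr, ?_⟩
    have := congrArg (ev ξ) hab
    rw [map_mul, h1, map_one] at this
    rw [Complex.ofReal_inv]
    exact eq_inv_of_mul_eq_one_right this

lemma IsLog.mul {a b : A} (ha : IsPos a) (hb : IsPos b) {l m : X} (hl : IsLog a l)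
    (hm : IsLog b m) : IsLog (a * b) (l + m) := fun ξ => by
  obtain ⟨r, hr, h1⟩ := ha.2 ξ
  obtain ⟨s, hs, h2⟩ := hb.2 ξ
  rw [map_add, hl, hm, map_mul, h1, h2, ← Complex.ofReal_mul, Complex.ofReal_re, Complex.ofReal_re,
    Complex.ofReal_re, Real.log_mul hr.ne' hs.ne', Complex.ofReal_add]

/-- The local logarithm at 1, transported by division by `a`: log b = log a + log (b / a). The
equivalence form serves both existence along a path and continuity. -/
lemma exists_local_log_at {a : A} (ha : IsPos a) : ∃ Λ : A → X, ContinuousAt Λ a ∧ Λ a = 0 ∧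
    ∀ᶠ b in 𝓝 a, IsPos b → ∀ l, IsLog a l ↔ IsLog b (l + Λ b) := by
  obtain ⟨Λ, hc, h1, hL⟩ := exists_local_log
  obtain ⟨c, hac⟩ := ha.isUnit.exists_right_inv
  have hcp := ha.of_mul_eq_one hac
  have ht : Tendsto (fun b => b * c) (𝓝 a) (𝓝 1) := by
    have : Tendsto (fun b => b * c) (𝓝 a) (𝓝 (a * c)) := (continuous_mul_const c).tendsto a
    rwa [hac] at this
  refine ⟨fun b => Λ (b * c), ?_, by simp only [hac, h1], ?_⟩
  · change Tendsto _ _ _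
    simp only [hac]
    exact hc.tendsto.comp ht
  · filter_upwards [ht.eventually hL] with b hb hbp l
    have h2 := hb (hbp.mul hcp)
    constructor
    · intro hl
      have h3 := hl.mul ha (hbp.mul hcp) h2
      rwa [show a * (b * c) = b * (a * c) by ring, hac, mul_one] at h3
    · intro hl ξ
      have h3 := hl ξ
      obtain ⟨r, hr, e1⟩ := ha.2 ξ
      obtain ⟨s, hs, e2⟩ := (hbp.mul hcp).2 ξ
      have e3 : ev ξ b = (r * s : ℝ) := by
        rw [Complex.ofReal_mul, ← e1, ← e2, ← map_mul,
          show a * (b * c) = b * (a * c) by ring, hac, mul_one]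
      rw [map_add, h2 ξ, e2, e3, Complex.ofReal_re, Complex.ofReal_re,
        Real.log_mul hr.ne' hs.ne', Complex.ofReal_add] at h3
      rw [e1, Complex.ofReal_re]
      exact add_right_cancel h3

/-- The segment from 1 to `a` consists of positive elements, and having a logarithm is a locally
constant property along it. At 1 the logarithm is 0. -/
lemma IsPos.exists_isLog {a : A} (ha : IsPos a) : ∃ l, IsLog a l := by
  let g : unitInterval → A := fun s => 1 + ((s : ℝ) : ℂ) • (a - 1)
  have hg : ∀ s, IsPos (g s) := fun s => by
    refine ⟨by
      simp only [g, map_add, map_smul, map_sub, map_one, ha.1, sub_self, smul_zero, add_zero], fun ξ => ?_⟩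
    obtain ⟨r, hr, h1⟩ := ha.2 ξ
    refine ⟨1 + s * (r - 1), ?_, by
      simp only [g, map_add, map_smul, map_sub, map_one, h1, smul_eq_mul]
      push_cast
      ring⟩
    have h2 := s.2.1
    have h3 := s.2.2
    rcases h3.eq_or_lt with h3 | h3
    · rw [h3]; linarith
    · nlinarith
  have hcont : Continuous g := by fun_prop
  have hl : IsLocallyConstant fun s => (∃ l, IsLog (g s) l) := by
    rw [IsLocallyConstant.iff_eventually_eq]
    intro s
    obtain ⟨Λ, -, -, h⟩ := exists_local_log_at (hg s)
    filter_upwards [(hcont.tendsto s).eventually h] with t ht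
    refine propext ⟨fun ⟨l, hl⟩ => ⟨l - Λ (g t), ?_⟩, fun ⟨l, hl⟩ => ⟨_, (ht (hg t) l).1 hl⟩⟩
    rw [ht (hg t), sub_add_cancel]
    exact hl
  have h01 := hl.apply_eq_of_preconnectedSpace (0 : unitInterval) 1
  have h0 : ∃ l, IsLog (g 0) l := ⟨0, fun ξ => by simp [g]⟩
  rw [h01] at h0
  simpa [g] using h0

/-- The logarithm of a positive element. -/
def log (a : A) : X := Classical.epsilon (IsLog a)

lemma IsPos.isLog_log {a : A} (ha : IsPos a) : IsLog a (log a) :=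
  Classical.epsilon_spec ha.exists_isLog

/-- Logarithms are unique by `X.hat_injective`, so the chosen one agrees near `a` with the local
one. -/
lemma continuousOn_log : ContinuousOn log {a | IsPos a} := by
  intro a ha
  obtain ⟨Λ, hc, h0, h⟩ := exists_local_log_at ha
  have h1 : ∀ᶠ b in 𝓝[{a | IsPos a}] a, log b = log a + Λ b := by
    filter_upwards [self_mem_nhdsWithin, mem_nhdsWithin_of_mem_nhds h] with b hb hb2
    have h2 := (hb2 hb _).1 (IsPos.isLog_log ha)
    exact X.hat_injective fun ξ => by rw [h2 ξ, IsPos.isLog_log hb ξ]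
  refine ContinuousWithinAt.congr_of_eventuallyEq ?_ h1 (by rw [h0, add_zero])
  exact (continuousAt_const.add hc).continuousWithinAt

end A

/-! ### The Cauchy projection as restriction to a half-line -/

lemma memX_exp_decay {a : ℂ} (ha : a.re < 0) :
    MemX ((Ioi (0 : ℝ)).indicator fun x : ℝ => Complex.exp (a * x)) := by
  have hc : AEStronglyMeasurable (fun x : ℝ => Complex.exp (a * x))
    (volume.restrict (Ioi (0 : ℝ))) := Continuous.aestronglyMeasurable (by fun_prop)
  refine ⟨?_, ?_⟩
  · rw [memLp_indicator_iff_restrict measurableSet_Ioi, memLp_one_iff_integrable]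
    exact integrableOn_exp_mul_complex_Ioi ha 0
  · rw [memLp_indicator_iff_restrict measurableSet_Ioi, memLp_two_iff_integrable_sq_norm hc]
    have h : IntegrableOn (fun x : ℝ => ‖Complex.exp ((2 * a) * x)‖) (Ioi 0) :=
      (integrableOn_exp_mul_complex_Ioi (a := 2 * a) (by simp; linarith) 0).norm
    refine h.congr_fun (fun x _ => ?_) measurableSet_Ioi
    simp only
    rw [← norm_pow, ← Complex.exp_nat_mul]
    congr 2
    push_cast
    ring

namespace X

/-- The function `x ↦ exp (a x)` on `(0, ∞)`. -/
def expDecay (a : ℂ) (ha : a.re < 0) : X := mk _ (memX_exp_decay ha)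

lemma hat_expDecay (ξ : ℝ) (a : ℂ) (ha : a.re < 0) :
    hat ξ (expDecay a ha) = -(2 * Complex.I * ξ + a)⁻¹ := by
  rw [expDecay, hat_mk, fourierX]
  have h1 : ∀ x : ℝ, Complex.exp (2 * Complex.I * ξ * x) *
      (Ioi (0 : ℝ)).indicator (fun x : ℝ => Complex.exp (a * x)) x =
      (Ioi (0 : ℝ)).indicator (fun x : ℝ => Complex.exp ((2 * Complex.I * ξ + a) * x)) x := by
    intro x
    by_cases hx : x ∈ Ioi (0 : ℝ)
    · rw [indicator_of_mem hx, indicator_of_mem hx, ← Complex.exp_add]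
      ring_nf
    · rw [indicator_of_notMem hx, indicator_of_notMem hx, mul_zero]
  simp only [h1]
  rw [integral_indicator measurableSet_Ioi, integral_exp_mul_complex_Ioi (by simpa using ha)]
  simp [neg_div]

/-- The restriction to `(0, ∞)`. -/
def plus : X →L[ℂ] X := ind (Ioi 0) measurableSet_Ioi

lemma fn_plus (f : X) : (plus f).fn =ᵐ[volume] (Ioi (0 : ℝ)).indicator f.fn := fn_ind _ _ f

lemma memX_damp (f : X) {ε : ℝ} (hε : 0 < ε) :
    MemX ((Ioi (0 : ℝ)).indicator fun x : ℝ => Complex.exp (-2 * ε * x) * f.fn x) := by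
  have hm : AEStronglyMeasurable
      ((Ioi (0 : ℝ)).indicator fun x : ℝ => Complex.exp (-2 * ε * x) * f.fn x) volume :=
    ((Continuous.aestronglyMeasurable (by fun_prop)).mul f.memX.1.1).indicator measurableSet_Ioi
  have hle : ∀ x, ‖(Ioi (0 : ℝ)).indicator (fun x : ℝ => Complex.exp (-2 * ε * x) * f.fn x) x‖ ≤
      ‖f.fn x‖ := by
    intro x
    by_cases hx : x ∈ Ioi (0 : ℝ)
    · rw [indicator_of_mem hx, norm_mul, Complex.norm_exp]
      refine mul_le_of_le_one_left (norm_nonneg _) (Real.exp_le_one_iff.2 ?_)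
      have : (-2 * (ε : ℂ) * (x : ℂ)).re = -2 * (ε * x) := by simp [mul_assoc]
      rw [this]
      have := mul_pos hε hx
      linarith
    · rw [indicator_of_notMem hx, norm_zero]
      exact norm_nonneg _
  exact ⟨f.memX.1.of_le hm (Eventually.of_forall hle), f.memX.2.of_le hm (Eventually.of_forall hle)⟩

/-- The Cauchy integral of a Fourier transform. -/
lemma cauchyIntegral_hat (f : X) (s : ℝ) {ε : ℝ} (hε : 0 < ε) :
    cauchyIntegral (fun ξ => hat ξ f) ((s : ℂ) + (ε : ℂ) * Complex.I) =
      hat s (mk _ (memX_damp f hε)) := by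
  -- With this exponent the conjugate of the transform of exp(ax) on (0, ∞) is the Cauchy kernel 1 /
  -- (ξ - s - iε) up to the factor 2i. Parseval then turns the Cauchy integral into a half-line
  -- integral.
  set a : ℂ := -2 * Complex.I * s - 2 * ε with ha_def
  have ha : a.re < 0 := by simp [a, hε]
  have hp := parseval f (expDecay a ha)
  have hne : ∀ ξ : ℝ, (ξ : ℂ) - (s + ε * Complex.I) ≠ 0 := fun ξ h => by
    have := congrArg Complex.im h
    simp at this
    exact hε.ne' this
  have h1 : ∀ ξ : ℝ, conj (hat ξ (expDecay a ha)) * hat ξ f =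
      (2 * Complex.I)⁻¹ * (hat ξ f / ((ξ : ℂ) - (s + ε * Complex.I))) := by
    intro ξ
    rw [hat_expDecay]
    have h2 : conj (-(2 * Complex.I * ξ + a)⁻¹) =
        (2 * Complex.I * ((ξ : ℂ) - (s + ε * Complex.I)))⁻¹ := by
      rw [map_neg, map_inv₀, ← inv_neg]
      congr 1
      simp only [a, map_add, map_mul, map_sub, map_neg, Complex.conj_I, Complex.conj_ofReal,
        Complex.conj_ofNat]
      ring_nf
      simp only [Complex.I_sq]
      ring
    rw [h2, mul_inv]
    ring
  simp only [h1] at hp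
  rw [integral_const_mul] at hp
  have h3 : ∫ x, conj ((expDecay a ha).fn x) * f.fn x = hat s (mk _ (memX_damp f hε)) := by
    rw [hat_mk, fourierX]
    refine integral_congr_ae ?_
    filter_upwards [fn_mk (memX_exp_decay ha)] with x hx
    rw [expDecay, hx]
    by_cases hx : x ∈ Ioi (0 : ℝ)
    · rw [indicator_of_mem hx, indicator_of_mem hx, ← mul_assoc, ← Complex.exp_add,
        ← Complex.exp_conj]
      congr 2
      simp only [a, map_mul, map_sub, map_neg, Complex.conj_I, Complex.conj_ofReal,
        Complex.conj_ofNat]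
      ring
    · rw [indicator_of_notMem hx, indicator_of_notMem hx, map_zero, zero_mul, mul_zero]
  rw [← h3, cauchyIntegral]
  have hpi : (Real.pi : ℂ) ≠ 0 := by exact_mod_cast Real.pi_ne_zero
  have hI := Complex.I_ne_zero
  set Z := ∫ ξ : ℝ, hat ξ f / ((ξ : ℂ) - (s + ε * Complex.I))
  set W := ∫ x, conj ((expDecay a ha).fn x) * f.fn x
  field_simp at hp ⊢
  linear_combination hp

/-- At height ε the Cauchy integral is the transform of exp(-2εx) f(x) on (0, ∞). By Plancherel it
remains to let ε → 0 in L², by dominated convergence. -/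
lemma isCauchyPlus_hat (f : X) :
    IsCauchyPlus (fun ξ => hat ξ f) (fun ξ => hat ξ (plus f)) := by
  refine ⟨continuous_hat _, ?_⟩
  have h1 : ∀ ε : ℝ, 0 < ε → eLpNorm (fun s : ℝ => cauchyIntegral (fun ξ => hat ξ f)
      ((s : ℂ) + (ε : ℂ) * Complex.I) - hat s (plus f)) 2 volume =
      ENNReal.ofReal Real.pi ^ (1 / 2 : ℝ) * eLpNorm ((Ioi (0 : ℝ)).indicator fun x : ℝ =>
        (Complex.exp (-2 * ε * x) - 1) * f.fn x) 2 volume := by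
    intro ε hε
    simp only [cauchyIntegral_hat f _ hε, ← map_sub]
    rw [eLpNorm_hat]
    congr 1
    refine eLpNorm_congr_ae ?_
    have h2 := fn_add (mk _ (memX_damp f hε) - plus f) (plus f)
    rw [sub_add_cancel] at h2
    filter_upwards [h2, fn_plus f, fn_mk (memX_damp f hε)] with x h3 h4 h5
    rw [h5, h4] at h3
    rw [← sub_eq_iff_eq_add] at h3
    rw [← h3]
    by_cases hx : x ∈ Ioi (0 : ℝ)
    · simp only [indicator_of_mem hx]
      ring
    · simp only [indicator_of_notMem hx, sub_zero]
  have h2 : Tendsto (fun ε : ℝ => eLpNorm ((Ioi (0 : ℝ)).indicator fun x : ℝ =>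
      (Complex.exp (-2 * ε * x) - 1) * f.fn x) 2 volume) (𝓝[>] 0) (𝓝 0) := by
    have h3 : Tendsto (fun ε : ℝ => ∫⁻ x, ‖(Ioi (0 : ℝ)).indicator (fun x : ℝ =>
        (Complex.exp (-2 * ε * x) - 1) * f.fn x) x‖ₑ ^ (2 : ℝ)) (𝓝[>] 0) (𝓝 (∫⁻ _ : ℝ, 0)) := by
      refine tendsto_lintegral_filter_of_dominated_convergence'
        (fun x => (2 * ‖f.fn x‖ₑ) ^ (2 : ℝ)) ?_ ?_ ?_ ?_
      · refine Eventually.of_forall fun ε => ?_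
        exact (((((Continuous.aestronglyMeasurable (by fun_prop)).mul f.memX.1.1).indicator
          measurableSet_Ioi)).enorm).pow_const _
      · filter_upwards [self_mem_nhdsWithin] with ε hε
        refine Eventually.of_forall fun x => ?_
        refine ENNReal.rpow_le_rpow ?_ (by norm_num)
        by_cases hx : x ∈ Ioi (0 : ℝ)
        · rw [indicator_of_mem hx, enorm_mul]
          gcongr
          have h4 : ‖Complex.exp (-2 * ε * x) - 1‖ ≤ 2 := by
            refine (norm_sub_le _ _).trans ?_
            rw [Complex.norm_exp, norm_one]
            have : (-2 * (ε : ℂ) * (x : ℂ)).re = -2 * (ε * x) := by simp [mul_assoc]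
            rw [this]
            have h5 := mul_pos (show 0 < ε from hε) hx
            have h6 : Real.exp (-2 * (ε * x)) ≤ 1 := Real.exp_le_one_iff.2 (by linarith)
            linarith
          rw [← ofReal_norm]
          exact (ENNReal.ofReal_le_ofReal h4).trans (by simp)
        · rw [indicator_of_notMem hx, enorm_zero]
          exact bot_le
      · have h4 : ∫⁻ x, ‖f.fn x‖ₑ ^ (2 : ℝ) < ∞ :=
          (eLpNorm_lt_top_iff_lintegral_rpow_enorm_lt_top two_ne_zero ENNReal.ofNat_ne_top).1
            f.memX.2.2
        simp only [ENNReal.mul_rpow_of_nonneg _ _ (show (0 : ℝ) ≤ 2 by norm_num)]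
        rw [lintegral_const_mul' _ _ (by norm_num)]
        exact ENNReal.mul_ne_top (by norm_num) h4.ne
      · refine Eventually.of_forall fun x => ?_
        have h4 : Tendsto (fun ε : ℝ => (Ioi (0 : ℝ)).indicator (fun x : ℝ =>
            (Complex.exp (-2 * ε * x) - 1) * f.fn x) x) (𝓝[>] 0) (𝓝 0) := by
          by_cases hx : x ∈ Ioi (0 : ℝ)
          · simp only [indicator_of_mem hx]
            have : Continuous fun ε : ℝ => (Complex.exp (-2 * ε * x) - 1) * f.fn x := by
              fun_prop
            refine (this.tendsto' 0 0 (by simp)).mono_left nhdsWithin_le_nhds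
          · simp only [indicator_of_notMem hx]
            exact tendsto_const_nhds
        have h5 := (ENNReal.continuous_rpow_const (y := (2 : ℝ))).tendsto _ |>.comp h4.enorm
        simpa [Function.comp_def] using h5
    have h4 := (ENNReal.continuous_rpow_const (y := (1 / 2 : ℝ))).tendsto _ |>.comp h3
    refine Tendsto.congr' (Eventually.of_forall fun ε => ?_) (h4.mono_right (by simp))
    simp only [Function.comp_def]
    rw [eLpNorm_eq_lintegral_rpow_enorm_toReal two_ne_zero ENNReal.ofNat_ne_top]
    simp
  have h3 : Tendsto (fun ε : ℝ => ENNReal.ofReal Real.pi ^ (1 / 2 : ℝ) *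
      eLpNorm ((Ioi (0 : ℝ)).indicator fun x : ℝ =>
      (Complex.exp (-2 * ε * x) - 1) * f.fn x) 2 volume) (𝓝[>] 0) (𝓝 0) := by
    have := ENNReal.Tendsto.const_mul (a := ENNReal.ofReal Real.pi ^ (1 / 2 : ℝ)) h2
      (Or.inr (ENNReal.rpow_ne_top_of_nonneg (by norm_num) ENNReal.ofReal_ne_top))
    rwa [mul_zero] at this
  refine h3.congr' ?_
  filter_upwards [self_mem_nhdsWithin] with ε hε
  exact (h1 ε hε).symm

end X

/-- Continuous functions that agree a.e. are equal, so the choice made in `cauchyPlus` is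
immaterial. -/
lemma IsCauchyPlus.unique {f g h : ℝ → ℂ} (hg : IsCauchyPlus f g) (hh : IsCauchyPlus f h)
    (hm : ∀ᶠ ε : ℝ in 𝓝[>] (0 : ℝ), AEStronglyMeasurable
      (fun s : ℝ => cauchyIntegral f ((s : ℂ) + (ε : ℂ) * Complex.I)) volume) : g = h := by
  have h1 : Tendsto (fun _ : ℝ => eLpNorm (g - h) 2 volume) (𝓝[>] 0) (𝓝 0) := by
    have h2 := hg.2.add hh.2
    rw [add_zero] at h2
    refine tendsto_of_tendsto_of_tendsto_of_le_of_le' tendsto_const_nhds h2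
      (Eventually.of_forall fun _ => bot_le) ?_
    filter_upwards [hm] with ε hε
    rw [add_comm]
    have e : g - h = (fun s : ℝ => cauchyIntegral f ((s : ℂ) + (ε : ℂ) * Complex.I) - h s) -
        fun s : ℝ => cauchyIntegral f ((s : ℂ) + (ε : ℂ) * Complex.I) - g s := by
      funext s
      simp
    rw [e]
    exact eLpNorm_sub_le (hε.sub hh.1.aestronglyMeasurable) (hε.sub hg.1.aestronglyMeasurable)
      one_le_two
  have h3 := tendsto_nhds_unique h1 tendsto_const_nhds
  rw [eq_comm, eLpNorm_eq_zero_iff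
    (hg.1.sub hh.1).aestronglyMeasurable two_ne_zero] at h3
  have h4 := (hg.1.sub hh.1).ae_eq_iff_eq (μ := volume) continuous_zero |>.1 h3
  exact sub_eq_zero.1 h4

lemma X.cauchyPlus_hat (f : X) :
    cauchyPlus (fun ξ => X.hat ξ f) = fun ξ => X.hat ξ (X.plus f) := by
  have h := X.isCauchyPlus_hat f
  refine IsCauchyPlus.unique (Classical.epsilon_spec ⟨_, h⟩) h ?_
  filter_upwards [self_mem_nhdsWithin] with ε hε
  simp only [X.cauchyIntegral_hat f _ hε]
  exact (X.continuous_hat _).aestronglyMeasurable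

namespace X

/-! ### Symmetries of the projection -/

/-- The element of `X` with Fourier transform `1 / (k + i)`. -/
def pole : X := (-2 * Complex.I) • expDecay (-2) (by simp)

lemma add_I_ne_zero (k : ℝ) : (k : ℂ) + Complex.I ≠ 0 := fun h => by
  have := congrArg Complex.im h
  simp at this

lemma sub_I_ne_zero (k : ℝ) : (k : ℂ) - Complex.I ≠ 0 := fun h => by
  have := congrArg Complex.im h
  simp at this

lemma hat_pole (k : ℝ) : hat k pole = ((k : ℂ) + Complex.I)⁻¹ := by
  have h := add_I_ne_zero k
  have e : 2 * Complex.I * (k : ℂ) + -2 = 2 * Complex.I * (k + Complex.I) := by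
    linear_combination (-2) * Complex.I_sq
  rw [pole, map_smul, hat_expDecay, smul_eq_mul, e]
  have hI := Complex.I_ne_zero
  field_simp

lemma ae_ne_zero : ∀ᵐ x : ℝ, x ≠ 0 := by
  simp [ae_iff]

/-- `inv` carries the part of `l` on (0, ∞) to its part on (-∞, 0). On transforms, twice the real
part of 𝒞₊ applied to a real function gives that function back. -/
lemma plus_add_inv_plus {l : X} (h : inv l = l) : plus l + inv (plus l) = l := by
  refine ext_ae ?_
  have h1 := measurePreserving_neg.quasiMeasurePreserving.ae_eq_comp (fn_plus l)
  have h2 := fn_inv l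
  rw [h] at h2
  filter_upwards [fn_add (plus l) (inv (plus l)), fn_plus l, fn_inv (plus l), h1, h2, ae_ne_zero]
    with x e1 e2 e3 e4 e5 hx
  simp only [Function.comp_def] at e4
  rw [e1, e2, e3, e4]
  rcases hx.lt_or_gt with hx | hx
  · rw [indicator_of_notMem (by simpa using hx.le), indicator_of_mem (by simpa using hx), e5,
      zero_add]
  · rw [indicator_of_mem (by simpa using hx), indicator_of_notMem (by simpa using hx.le), map_zero,
      add_zero]

/-- Both symmetries together make `l` real-valued a.e. This is the source of t̃(-k) = conj t̃(k). -/
lemma refl_plus_eq_inv_plus {l : X} (h : inv l = l) (h' : refl l = l) :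
    refl (plus l) = inv (plus l) := by
  refine ext_ae ?_
  have h1 := measurePreserving_neg.quasiMeasurePreserving.ae_eq_comp (fn_plus l)
  have h2 := fn_inv l
  have h3 := fn_refl l
  rw [h] at h2
  rw [h'] at h3
  filter_upwards [fn_refl (plus l), fn_inv (plus l), h1, h2, h3] with x e1 e2 e3 e4 e5
  simp only [Function.comp_def] at e3
  rw [e1, e2, e3]
  by_cases hx : -x ∈ Ioi (0 : ℝ)
  · rw [indicator_of_mem hx, ← e4, e5]
  · rw [indicator_of_notMem hx, map_zero]

/-! ### The norm of the space of Fourier transforms -/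

lemma normXhat_hat (f : X) :
    normXhat (fun ξ => hat ξ f) = ENNReal.ofReal (‖fstCLM f‖ + ‖sndCLM f‖) := by
  rw [← normX_fn]
  refine le_antisymm (iInf₂_le f.fn ⟨f.memX, rfl⟩) (le_iInf₂ fun g hg => ?_)
  have h : mk g hg.1 = f := hat_injective fun ξ => by rw [hat_mk, hg.2]
  have h2 : f.fn =ᵐ[volume] g := by
    rw [← h]
    exact fn_mk hg.1
  rw [normX, normX, eLpNorm_congr_ae h2, eLpNorm_congr_ae h2]

/-- `X` carries the maximum of the two norms and `normXhat` their sum, so they are equivalent with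
constants 1 and 2. -/
lemma le_normXhat_hat (f : X) : ENNReal.ofReal ‖f‖ ≤ normXhat fun ξ => hat ξ f := by
  rw [normXhat_hat]
  refine ENNReal.ofReal_le_ofReal ?_
  rw [norm_def]
  exact max_le (le_add_of_nonneg_right (norm_nonneg _)) (le_add_of_nonneg_left (norm_nonneg _))

lemma normXhat_hat_le (f : X) : normXhat (fun ξ => hat ξ f) ≤ ENNReal.ofReal (2 * ‖f‖) := by
  rw [normXhat_hat]
  refine ENNReal.ofReal_le_ofReal ?_
  linarith [norm_fst_le f, norm_snd_le f]

end X

/-! ### Reflection coefficients as elements of the algebra -/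

lemma rTilde_congr {r s : ℝ → ℂ} (h : ∀ k, ‖r k‖ = ‖s k‖) : rTilde r = rTilde s := by
  simp only [rTilde, h]

lemma rTilde_of_ne {r : ℝ → ℂ} {k : ℝ} (hk : k ≠ 0) : rTilde r k = (1 - ‖r k‖ ^ 2) / k ^ 2 := by
  rw [rTilde, Function.update_of_ne hk]

namespace RPos

/-- The inverse Fourier transform of `r`. -/
def coef (r : RPos) : X := (X.memXhat_iff.1 r.memR.memXhat).choose

lemma hat_coef (r : RPos) (ξ : ℝ) : X.hat ξ r.coef = r ξ :=
  (X.memXhat_iff.1 r.memR.memXhat).choose_spec ξ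

/-- The inverse Fourier transform of `r̃`. -/
def tildeCoef (r : RPos) : X := (X.memXhat_iff.1 r.tilde_memXhat).choose

lemma hat_tildeCoef (r : RPos) (ξ : ℝ) : X.hat ξ r.tildeCoef = (rTilde r ξ : ℂ) :=
  (X.memXhat_iff.1 r.tilde_memXhat).choose_spec ξ

lemma one_sub_sq (r : RPos) (k : ℝ) : 1 - ‖r k‖ ^ 2 = k ^ 2 * rTilde r k := by
  rcases eq_or_ne k 0 with rfl | hk
  · simp [r.apply_zero]
  · rw [rTilde_of_ne hk]
    field_simp

lemma rTilde_pos (r : RPos) (k : ℝ) : 0 < rTilde r k := by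
  rcases eq_or_ne k 0 with rfl | hk
  · exact r.tilde_zero_pos
  · rw [rTilde_of_ne hk]
    have h := r.memR.norm_lt_one k hk
    have : ‖r k‖ ^ 2 < 1 := pow_lt_one₀ (norm_nonneg _) h two_ne_zero
    exact div_pos (by linarith) (by positivity)

lemma norm_neg (r : RPos) (k : ℝ) : ‖r (-k)‖ = ‖r k‖ := by
  rw [r.memR.conj_symm, RCLike.norm_conj]

lemma rTilde_neg (r : RPos) (k : ℝ) : rTilde r (-k) = rTilde r k := by
  rcases eq_or_ne k 0 with rfl | hk
  · rw [neg_zero]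
  · rw [rTilde_of_ne hk, rTilde_of_ne (neg_ne_zero.2 hk), r.norm_neg, neg_sq]

/-- The function `(k² + 1) r̃(k)` as an element of the algebra. -/
def symbol (r : RPos) : A := 1 - A.ofX (r.coef * X.inv r.coef) + A.ofX r.tildeCoef

/-- By `one_sub_sq`, k² r̃ = 1 - |r|², so the factor k² + 1, which is unbounded, does not lead out
of the algebra. -/
lemma ev_symbol (r : RPos) (ξ : ℝ) : A.ev ξ r.symbol = (((ξ ^ 2 + 1) * rTilde r ξ : ℝ) : ℂ) := by
  have h : r ξ * conj (r ξ) = ((‖r ξ‖ ^ 2 : ℝ) : ℂ) := by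
    rw [Complex.mul_conj, Complex.normSq_eq_norm_sq]
  rw [symbol, map_add, map_sub, map_one, A.ev_ofX, A.ev_ofX, X.hat_mul, X.hat_inv, hat_coef,
    hat_tildeCoef, h, ← Complex.ofReal_one, ← Complex.ofReal_sub, one_sub_sq, ← Complex.ofReal_add]
  congr 1
  ring

lemma isPos_symbol (r : RPos) : A.IsPos r.symbol := by
  refine ⟨by simp [symbol, A.evInf_ofX], fun ξ => ⟨_, ?_, r.ev_symbol ξ⟩⟩
  have := r.rTilde_pos ξ
  positivity

/-- The inverse Fourier transform of `log [(k² + 1) r̃(k)]`. -/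
def logCoef (r : RPos) : X := A.log r.symbol

lemma hat_logCoef (r : RPos) (ξ : ℝ) : X.hat ξ r.logCoef = logSymbol r ξ := by
  rw [logCoef, r.isPos_symbol.isLog_log ξ, ev_symbol, Complex.ofReal_re, logSymbol]

lemma logSymbol_eq (r : RPos) : logSymbol r = fun ξ => X.hat ξ r.logCoef :=
  funext fun ξ => (r.hat_logCoef ξ).symm

lemma inv_logCoef (r : RPos) : X.inv r.logCoef = r.logCoef := X.hat_injective fun ξ => by
  rw [X.hat_inv, hat_logCoef, logSymbol, Complex.conj_ofReal]

lemma refl_logCoef (r : RPos) : X.refl r.logCoef = r.logCoef := X.hat_injective fun ξ => by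
  rw [X.hat_refl, hat_logCoef, hat_logCoef, logSymbol, logSymbol, rTilde_neg, neg_sq]

lemma isCauchyPlus_logSymbol (r : RPos) :
    IsCauchyPlus (logSymbol r) (cauchyPlus (logSymbol r)) := by
  rw [logSymbol_eq, X.cauchyPlus_hat]
  exact X.isCauchyPlus_hat _

/-- The inverse Fourier transform of `log t̃`. -/
def logTrans (r : RPos) : X := X.plus r.logCoef

lemma tTilde_eq (r : RPos) (k : ℝ) : tTilde r k = Complex.exp (X.hat k r.logTrans) := by
  rw [tTilde, logSymbol_eq, X.cauchyPlus_hat, logTrans]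

lemma hat_neg_logTrans (r : RPos) (k : ℝ) :
    X.hat (-k) r.logTrans = conj (X.hat k r.logTrans) := by
  rw [← X.hat_refl, ← X.hat_inv, logTrans, X.refl_plus_eq_inv_plus r.inv_logCoef r.refl_logCoef]

lemma hat_logTrans_add_conj (r : RPos) (k : ℝ) :
    X.hat k r.logTrans + conj (X.hat k r.logTrans) = logSymbol r k := by
  rw [← X.hat_inv, ← map_add, logTrans, X.plus_add_inv_plus r.inv_logCoef, hat_logCoef]

lemma tTilde_neg (r : RPos) (k : ℝ) : tTilde r (-k) = conj (tTilde r k) := by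
  rw [tTilde_eq, tTilde_eq, hat_neg_logTrans, Complex.exp_conj]

/-- Twice the real part of log t̃ is the logarithm of the symbol. -/
lemma norm_tTilde_sq (r : RPos) (k : ℝ) : ‖tTilde r k‖ ^ 2 = (k ^ 2 + 1) * rTilde r k := by
  have h := r.hat_logTrans_add_conj k
  rw [Complex.add_conj, logSymbol] at h
  have h' : 2 * (X.hat k r.logTrans).re = Real.log ((k ^ 2 + 1) * rTilde r k) := by
    exact_mod_cast h
  have := r.rTilde_pos k
  rw [tTilde_eq, Complex.norm_exp, ← Real.exp_nat_mul, Nat.cast_ofNat, h',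
    Real.exp_log (by positivity)]

lemma tTilde_ne_zero (r : RPos) (k : ℝ) : tTilde r k ≠ 0 := Complex.exp_ne_zero _

lemma transmission_ne_zero (r : RPos) {k : ℝ} (hk : k ≠ 0) : transmission r k ≠ 0 :=
  div_ne_zero (mul_ne_zero (by exact_mod_cast hk) (r.tTilde_ne_zero k)) (X.add_I_ne_zero k)

/-! ### The involution -/

/-- The inverse Fourier transform of the image of `r`. -/
def dualCoef (r : RPos) : X :=
  A.snd (-((1 - A.ofX ((2 * Complex.I) • X.pole)) *
    NormedSpace.exp (A.ofX (r.logTrans - X.refl r.logTrans)) * A.ofX (X.refl r.coef)))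

lemma hat_dualCoef (r : RPos) (k : ℝ) : X.hat k r.dualCoef =
    -(((k : ℂ) - Complex.I) / (k + Complex.I) * (tTilde r k / tTilde r (-k)) * r (-k)) := by
  have h : ∀ a : A, A.evInf a = 0 → X.hat k (A.snd a) = A.ev k a := fun a ha => by
    rw [A.ev_apply, ha, zero_add]
  rw [dualCoef, h _ (by rw [map_neg, map_mul, A.evInf_ofX, mul_zero, neg_zero]), map_neg, map_mul,
    map_mul, A.ev_exp, A.ev_ofX, A.ev_ofX, map_sub, map_sub, map_one, A.ev_ofX, X.hat_refl,
    X.hat_refl, hat_coef, map_smul, X.hat_pole, Complex.exp_sub, tTilde_eq, tTilde_eq]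
  congr 3
  have := X.add_I_ne_zero k
  rw [smul_eq_mul]
  field_simp
  ring

/-- The zeros of t(k) and t(-k) at k = 0 cancel and leave the factor (k - i) / (k + i), which is -1
at 0. -/
lemma hat_dualCoef_of_ne (r : RPos) {k : ℝ} (hk : k ≠ 0) : X.hat k r.dualCoef =
    -(transmission r k / transmission r (-k)) * r (-k) := by
  rw [hat_dualCoef, transmission, transmission]
  have h1 := X.add_I_ne_zero k
  have h2 := X.add_I_ne_zero (-k)
  have h3 := r.tTilde_ne_zero k
  have h4 := r.tTilde_ne_zero (-k)
  have h5 : (k : ℂ) ≠ 0 := by exact_mod_cast hk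
  push_cast at h2 ⊢
  field_simp
  ring

lemma hat_dualCoef_zero (r : RPos) : X.hat 0 r.dualCoef = -1 := by
  rw [hat_dualCoef, neg_zero, r.apply_zero, div_self (r.tTilde_ne_zero 0)]
  simp

/-- The multipliers (k - i) / (k + i) and t̃(k) / t̃(-k) are unimodular. This is why r̃, and with it
t, is invariant. -/
lemma norm_hat_dualCoef (r : RPos) (k : ℝ) : ‖X.hat k r.dualCoef‖ = ‖r k‖ := by
  have h1 : (k : ℂ) - Complex.I = conj ((k : ℂ) + Complex.I) := by
    rw [map_add, Complex.conj_ofReal, Complex.conj_I, sub_eq_add_neg]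
  have h2 : ‖(k : ℂ) + Complex.I‖ ≠ 0 := norm_ne_zero_iff.2 (X.add_I_ne_zero k)
  have h3 : ‖tTilde r k‖ ≠ 0 := norm_ne_zero_iff.2 (r.tTilde_ne_zero k)
  rw [hat_dualCoef, _root_.norm_neg, norm_mul, norm_mul, norm_div, norm_div, h1, RCLike.norm_conj,
    div_self h2, tTilde_neg, RCLike.norm_conj, div_self h3, r.norm_neg, one_mul, one_mul]

/-- The involution `r ↦ r^#`. -/
def dual (r : RPos) : RPos where
  toFun k := X.hat k r.dualCoef
  memR := by
    refine ⟨X.memXhat_hat _, fun k => ?_, fun k hk => ?_⟩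
    · simp only [hat_dualCoef, tTilde_neg, r.memR.conj_symm, map_neg, map_mul, map_div₀, map_sub,
        map_add, Complex.conj_ofReal, Complex.conj_I, Complex.conj_conj, Complex.ofReal_neg]
      congr 3
      rw [← neg_div_neg_eq]
      ring
    · rw [norm_hat_dualCoef]
      exact r.memR.norm_lt_one k hk
  apply_zero := r.hat_dualCoef_zero
  tilde_memXhat := by
    rw [rTilde_congr r.norm_hat_dualCoef]
    exact r.tilde_memXhat
  tilde_zero_pos := by
    rw [rTilde_congr r.norm_hat_dualCoef]
    exact r.tilde_zero_pos

lemma dual_apply (r : RPos) (k : ℝ) : r.dual k = X.hat k r.dualCoef := rfl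

lemma dual_of_ne (r : RPos) {k : ℝ} (hk : k ≠ 0) :
    r.dual k = -(transmission r k / transmission r (-k)) * r (-k) := r.hat_dualCoef_of_ne hk

lemma rTilde_dual (r : RPos) : rTilde r.dual = rTilde r := rTilde_congr r.norm_hat_dualCoef

lemma transmission_dual (r : RPos) : transmission r.dual = transmission r := by
  have h : logSymbol r.dual = logSymbol r := by
    funext k
    rw [logSymbol, logSymbol, rTilde_dual]
  funext k
  rw [transmission, transmission, tTilde, tTilde, h]

lemma ext_of_ne {r s : RPos} (h : ∀ k, k ≠ 0 → r k = s k) : r = s := by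
  refine RPos.ext (funext fun k => ?_)
  rcases eq_or_ne k 0 with rfl | hk
  · rw [r.apply_zero, s.apply_zero]
  · exact h k hk

/-- As t is the same for r and r^#, the factors t(k) / t(-k) and t(-k) / t(k) cancel. -/
lemma involutive_dual : Function.Involutive dual := fun r => ext_of_ne fun k hk => by
  have h1 := r.transmission_ne_zero hk
  have h2 := r.transmission_ne_zero (neg_ne_zero.2 hk)
  rw [dual_of_ne _ hk, transmission_dual, dual_of_ne _ (neg_ne_zero.2 hk), neg_neg]
  field_simp

/-! ### Continuity -/

lemma edist_def (r s : RPos) : edist r s = normXhat (fun k => r k - s k)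
    + normXhat (fun k => (rTilde r k : ℂ) - (rTilde s k : ℂ)) := rfl

lemma edist_eq (r s : RPos) : edist r s = normXhat (fun k => X.hat k (r.coef - s.coef))
    + normXhat (fun k => X.hat k (r.tildeCoef - s.tildeCoef)) := by
  simp only [map_sub, hat_coef, hat_tildeCoef, edist_def]

lemma continuous_coef : Continuous coef := by
  refine LipschitzWith.continuous (K := 1) fun r s => ?_
  rw [ENNReal.coe_one, one_mul, edist_eq_enorm_sub, ← ofReal_norm, edist_eq]
  exact (X.le_normXhat_hat _).trans le_self_add

lemma continuous_tildeCoef : Continuous tildeCoef := by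
  refine LipschitzWith.continuous (K := 1) fun r s => ?_
  rw [ENNReal.coe_one, one_mul, edist_eq_enorm_sub, ← ofReal_norm, edist_eq]
  exact (X.le_normXhat_hat _).trans le_add_self

/-- The metric is equivalent to the one pulled back from `X` by the pair `coef`, `tildeCoef`. -/
lemma continuous_of_coef {f : RPos → RPos} (h1 : Continuous fun r => (f r).coef)
    (h2 : Continuous fun r => (f r).tildeCoef) : Continuous f := by
  refine continuous_iff_continuousAt.2 fun r => tendsto_iff_edist_tendsto_0.2 ?_
  have h3 : Tendsto (fun s => ENNReal.ofReal (2 * ‖(f s).coef - (f r).coef‖) +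
      ENNReal.ofReal (2 * ‖(f s).tildeCoef - (f r).tildeCoef‖)) (𝓝 r) (𝓝 0) := by
    have : Continuous fun s => ENNReal.ofReal (2 * ‖(f s).coef - (f r).coef‖) +
      ENNReal.ofReal (2 * ‖(f s).tildeCoef - (f r).tildeCoef‖) :=
      (ENNReal.continuous_ofReal.comp (by fun_prop)).add (ENNReal.continuous_ofReal.comp (by fun_prop))
    exact this.tendsto' _ _ (by simp)
  refine tendsto_of_tendsto_of_tendsto_of_le_of_le tendsto_const_nhds h3 (fun _ => bot_le)
    fun s => ?_
  rw [edist_eq]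
  exact add_le_add (X.normXhat_hat_le _) (X.normXhat_hat_le _)

lemma continuous_symbol : Continuous symbol := by
  have h1 : Continuous fun r : RPos => r.coef * X.inv r.coef :=
    continuous_coef.mul (X.continuous_inv.comp continuous_coef)
  exact (continuous_const.sub (A.continuous_ofX.comp h1)).add
    (A.continuous_ofX.comp continuous_tildeCoef)

lemma continuous_logTrans : Continuous logTrans := by
  refine X.plus.continuous.comp ?_
  exact A.continuousOn_log.comp_continuous continuous_symbol fun r => r.isPos_symbol

lemma continuous_dualCoef : Continuous dualCoef := by
  refine A.continuous_snd.comp (Continuous.neg (Continuous.mul (Continuous.mul continuous_const ?_)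
    (A.continuous_ofX.comp (X.refl.continuous.comp continuous_coef))))
  refine NormedSpace.exp_continuous.comp (A.continuous_ofX.comp (continuous_logTrans.sub
    (X.refl.continuous.comp continuous_logTrans)))

/-- The second coordinate of the metric is preserved exactly, so only `dualCoef` needs an argument.
-/
lemma continuous_dual : Continuous dual := by
  refine continuous_of_coef ?_ ?_
  · have h : ∀ r : RPos, r.dual.coef = r.dualCoef := fun r => X.hat_injective fun k => by
      rw [hat_coef, dual_apply]
    simpa only [h] using continuous_dualCoef
  · have h : ∀ r : RPos, r.dual.tildeCoef = r.tildeCoef := fun r => X.hat_injective fun k => by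
      rw [hat_tildeCoef, hat_tildeCoef, rTilde_dual]
    simpa only [h] using continuous_tildeCoef

end RPos

/-! ### Volterra equations on the half-line -/

section Volterra

variable {E : Type*} [NormedAddCommGroup E] [NormedSpace ℝ E]

lemma integrableOn_smul_of_bound {u : ℝ → ℝ} {x C : ℝ} (hu : IntegrableOn u (Ioi x)) {g : ℝ → E}
    (hg : Continuous g) (hb : ∀ s, x < s → ‖g s‖ ≤ C) :
    IntegrableOn (fun s => u s • g s) (Ioi x) := by
  refine Integrable.smul_bdd hu C hg.aestronglyMeasurable ?_
  exact (ae_restrict_iff' measurableSet_Ioi).2 (Eventually.of_forall fun s hs => hb s hs)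

lemma continuous_setIntegral_Ioi {g : ℝ → E} (hg : ∀ x, IntegrableOn g (Ioi x)) :
    Continuous fun x => ∫ s in Ioi x, g s := by
  exact (isPrim_sub_setIntegral_Ioi 0 hg).continuous.neg.congr fun x => by simp

/-- The mass of `u` on `(x, ∞)`. -/
def tailMass (u : ℝ → ℝ) (x : ℝ) : ℝ := ∫ s in Ioi x, |u s|

variable {u : ℝ → ℝ}

lemma continuous_tailMass (hu : ∀ x, IntegrableOn u (Ioi x)) : Continuous (tailMass u) :=
  continuous_setIntegral_Ioi fun x => (hu x).abs

lemma tailMass_nonneg (x : ℝ) : 0 ≤ tailMass u x := integral_nonneg fun _ => abs_nonneg _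

lemma antitone_tailMass (hu : ∀ x, IntegrableOn u (Ioi x)) :
    Antitone (tailMass u) := fun _ _ hxy =>
  setIntegral_mono_set (hu _).abs (Eventually.of_forall fun _ => abs_nonneg _)
    (Ioi_subset_Ioi hxy).eventuallyLE

lemma isPrim_exp_tailMass (hu : ∀ x, IntegrableOn u (Ioi x)) :
    IsPrim (fun x => Real.exp (2 * tailMass u x))
    fun x => Real.exp (2 * tailMass u x) * (-2 * |u x|) := by
  have h : ∀ x, IntegrableOn (fun s => -2 * |u s|) (Ioi x) := fun x => (hu x).abs.const_mul _
  have h2 := isPrim_sub_setIntegral_Ioi 0 h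
  simp only [integral_const_mul] at h2
  convert h2.rexp using 4 <;> rw [tailMass] <;> ring

lemma integrableOn_exp_tailMass (hu : ∀ x, IntegrableOn u (Ioi x)) (x : ℝ) :
    IntegrableOn (fun s => |u s| * Real.exp (2 * tailMass u s)) (Ioi x) := by
  refine integrableOn_smul_of_bound (C := Real.exp (2 * tailMass u x)) (hu x).abs
    (Real.continuous_exp.comp ((continuous_tailMass hu).const_mul 2)) fun s hs => ?_
  rw [Real.norm_eq_abs, Real.abs_exp]
  have := antitone_tailMass hu hs.le
  gcongr

/-- The integrand is -1/2 times the derivative of exp(2 `tailMass`). The factor 1/2 becomes the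
contraction constant below. -/
lemma setIntegral_exp_tailMass_le (hu : ∀ x, IntegrableOn u (Ioi x)) (x : ℝ) :
    ∫ s in Ioi x, |u s| * Real.exp (2 * tailMass u s) ≤ Real.exp (2 * tailMass u x) / 2 := by
  refine le_of_tendsto (intervalIntegral_tendsto_integral_Ioi x (integrableOn_exp_tailMass hu x)
    tendsto_id) (Eventually.of_forall fun b => ?_)
  have h := (isPrim_exp_tailMass hu).sub_eq x b
  have e : (fun s => Real.exp (2 * tailMass u s) * (-2 * |u s|)) =
      fun s => -2 * (|u s| * Real.exp (2 * tailMass u s)) := by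
    funext s
    ring
  rw [e, intervalIntegral.integral_const_mul] at h
  have := Real.exp_pos (2 * tailMass u b)
  simp only [id]
  linarith

/-- Solvability of Volterra equations with an integrable density. -/
lemma exists_volterra [CompleteSpace E] (hu : ∀ x, IntegrableOn u (Ioi x)) {B : ℝ → E → E} (hB : Continuous fun p : ℝ × E => B p.1 p.2)
    (hL : ∀ s p q, ‖B s p - B s q‖ ≤ ‖p - q‖) (h0 : ∀ s, B s 0 = 0) {Q : ℝ → E}
    (hQ : Continuous Q) {C : ℝ} (hC : ∀ x, ‖Q x‖ ≤ C + tailMass u x) :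
    ∃ P : ℝ → E, Continuous P ∧ (∀ x, IntegrableOn (fun s => u s • B s (P s)) (Ioi x)) ∧
      ∀ x, P x = Q x - ∫ s in Ioi x, u s • B s (P s) := by
  have hn : ∀ s p, ‖B s p‖ ≤ ‖p‖ := fun s p => by simpa [h0] using hL s p 0
  have hσ := continuous_tailMass hu
  -- With the unknown written as P = W H, H bounded, the equation becomes a fixed point problem with
  -- contraction constant 1/2, without any smallness of `u`.
  set W : ℝ → ℝ := fun x => Real.exp (2 * tailMass u x) with hW
  have hWc : Continuous W := Real.continuous_exp.comp (hσ.const_mul 2)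
  have hWpos : ∀ x, 0 < W x := fun x => Real.exp_pos _
  have hW1 : ∀ x, 1 ≤ W x := fun x => Real.one_le_exp (by
    have := tailMass_nonneg (u := u) x; linarith)
  -- `Q` may grow like `tailMass` towards -∞; the weight absorbs this.
  have hWσ : ∀ x, tailMass u x ≤ W x := fun x => by
    have h1 := Real.add_one_le_exp (2 * tailMass u x)
    have := tailMass_nonneg (u := u) x
    linarith
  have hWanti : ∀ x s, x < s → W s ≤ W x := fun x s h => by
    have := antitone_tailMass hu h.le
    simp only [hW]
    gcongr
  have hc : ∀ H : BoundedContinuousFunction ℝ E, Continuous fun s => B s (W s • H s) := fun H =>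
    hB.comp (continuous_id.prodMk (hWc.smul H.continuous))
  have hle : ∀ (H : BoundedContinuousFunction ℝ E) s, ‖B s (W s • H s)‖ ≤ W s * ‖H‖ := fun H s => by
    refine (hn _ _).trans ?_
    rw [norm_smul, Real.norm_of_nonneg (hWpos s).le]
    exact mul_le_mul_of_nonneg_left (H.norm_coe_le_norm s) (hWpos s).le
  have hi : ∀ (H : BoundedContinuousFunction ℝ E) x,
      IntegrableOn (fun s => u s • B s (W s • H s)) (Ioi x) := fun H x =>
    integrableOn_smul_of_bound (C := W x * ‖H‖) (hu x) (hc H) fun s hs =>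
      (hle H s).trans (by have := hWanti x s hs; gcongr)
  have hest : ∀ (g : ℝ → E) (M x : ℝ), (∀ s, ‖g s‖ ≤ W s * M) →
      ‖∫ s in Ioi x, u s • g s‖ ≤ W x / 2 * M := by
    intro g M x hg
    have h1 : ‖∫ s in Ioi x, u s • g s‖ ≤ ∫ s in Ioi x, (|u s| * W s) * M := by
      refine norm_integral_le_of_norm_le ((integrableOn_exp_tailMass hu x).mul_const M)
        (Eventually.of_forall fun s => ?_)
      rw [norm_smul, Real.norm_eq_abs, mul_assoc]
      gcongr
      exact hg s
    rw [integral_mul_const] at h1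
    refine h1.trans ?_
    have hM : 0 ≤ M := by
      have := (norm_nonneg _).trans (hg 0)
      exact nonneg_of_mul_nonneg_right this (hWpos 0)
    exact mul_le_mul_of_nonneg_right (setIntegral_exp_tailMass_le hu x) hM
  let Φ : BoundedContinuousFunction ℝ E → BoundedContinuousFunction ℝ E := fun H =>
    BoundedContinuousFunction.ofNormedAddCommGroup
      (fun x => (W x)⁻¹ • (Q x - ∫ s in Ioi x, u s • B s (W s • H s)))
      ((hWc.inv₀ fun x => (hWpos x).ne').smul (hQ.sub (continuous_setIntegral_Ioi (hi H))))
      (|C| + 1 + ‖H‖) (by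
        intro x
        rw [norm_smul, norm_inv, Real.norm_of_nonneg (hWpos x).le, inv_mul_le_iff₀ (hWpos x)]
        refine (norm_sub_le _ _).trans ?_
        have h1 := hest _ _ x (hle H)
        have h2 := hC x
        have h3 := hWσ x
        have h4 := le_abs_self C
        have h5 : |C| ≤ W x * |C| := le_mul_of_one_le_left (abs_nonneg C) (hW1 x)
        have h6 : 0 ≤ W x * ‖H‖ := mul_nonneg (hWpos x).le (norm_nonneg _)
        linarith)
  have hΦ : ContractingWith (1 / 2) Φ := by
    refine ⟨by norm_num, LipschitzWith.of_dist_le_mul fun G H => ?_⟩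
    rw [BoundedContinuousFunction.dist_le (by positivity)]
    intro x
    simp only [Φ, BoundedContinuousFunction.coe_ofNormedAddCommGroup]
    rw [dist_eq_norm, ← smul_sub, sub_sub_sub_cancel_left, ← integral_sub (hi H x) (hi G x),
      norm_smul, norm_inv, Real.norm_of_nonneg (hWpos x).le, inv_mul_le_iff₀ (hWpos x)]
    simp only [← smul_sub]
    refine (hest (fun s => B s (W s • H s) - B s (W s • G s)) (dist G H) x fun s => ?_).trans_eq ?_
    · refine (hL _ _ _).trans ?_
      rw [← smul_sub, norm_smul, Real.norm_of_nonneg (hWpos s).le, ← dist_eq_norm, dist_comm]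
      exact mul_le_mul_of_nonneg_left (BoundedContinuousFunction.dist_coe_le_dist s) (hWpos s).le
    · simp
      ring
  set H := ContractingWith.fixedPoint Φ hΦ
  have hfix : Φ H = H := ContractingWith.fixedPoint_isFixedPt hΦ
  refine ⟨fun x => W x • H x, hWc.smul H.continuous, hi H, fun x => ?_⟩
  have := DFunLike.congr_fun hfix x
  simp only
  rw [← this]
  simp only [Φ, BoundedContinuousFunction.coe_ofNormedAddCommGroup]
  rw [smul_inv_smul₀ (hWpos x).ne']

end Volterra

/-! ### The Laplace transform -/

lemma norm_cexp_two_I_le {z : ℂ} (hz : 0 ≤ z.im) {t : ℝ} (ht : 0 ≤ t) :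
    ‖Complex.exp (2 * Complex.I * z * t)‖ ≤ 1 := by
  rw [Complex.norm_exp, Real.exp_le_one_iff]
  have : (2 * Complex.I * z * t).re = -2 * (z.im * t) := by simp [mul_assoc]
  rw [this]
  have := mul_nonneg hz ht
  linarith

namespace X

/-- The functional `f ↦ ∫_0^∞ exp (2 i z t) f t dt` for `Im z ≥ 0`. -/
def lap (z : ℂ) (hz : 0 ≤ z.im) : X →L[ℂ] ℂ :=
  pairing ((Ioi (0 : ℝ)).indicator fun t : ℝ => Complex.exp (2 * Complex.I * z * t))
    ((Continuous.aestronglyMeasurable (by fun_prop)).indicator measurableSet_Ioi) fun t => by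
      by_cases ht : t ∈ Ioi (0 : ℝ)
      · rw [indicator_of_mem ht]
        exact norm_cexp_two_I_le hz (le_of_lt ht)
      · rw [indicator_of_notMem ht, norm_zero]
        exact zero_le_one

lemma lap_apply (z : ℂ) (hz : 0 ≤ z.im) (f : X) : lap z hz f =
    ∫ t in Ioi (0 : ℝ), Complex.exp (2 * Complex.I * z * t) * f.fn t := by
  rw [lap, pairing_apply, ← integral_indicator measurableSet_Ioi]
  simp only [indicator_mul_left]

lemma norm_lap_le (z : ℂ) (hz : 0 ≤ z.im) (f : X) : ‖lap z hz f‖ ≤ ‖f‖ := norm_pairing_le _ _ f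

lemma lap_ofReal (ξ : ℝ) (h : 0 ≤ (ξ : ℂ).im) (f : X) : lap ξ h f = hat ξ (plus f) := by
  rw [lap_apply, hat_eq, fourierX_congr (fn_plus f), fourierX, ← integral_indicator measurableSet_Ioi]
  simp only [indicator_mul_right]

/-- A translate to the right of a function supported in (0, ∞) stays there, so no mass is cut off.
-/
lemma lap_trans_plus (z : ℂ) (hz : 0 ≤ z.im) {h : ℝ} (hh : 0 ≤ h) (f : X) :
    lap z hz (trans h (plus f)) = Complex.exp (2 * Complex.I * z * h) * lap z hz f := by
  rw [lap_apply, lap_apply, ← integral_const_mul, ← integral_indicator measurableSet_Ioi,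
    ← integral_indicator measurableSet_Ioi, ← integral_add_right_eq_self _ h]
  have h1 := (measurePreserving_add_right volume h).quasiMeasurePreserving.ae_eq_comp
    (fn_trans h (plus f))
  refine integral_congr_ae ?_
  filter_upwards [h1, fn_plus f] with t h2 h3
  simp only [Function.comp_def, add_sub_cancel_right] at h2
  by_cases ht : t ∈ Ioi (0 : ℝ)
  · have ht' : t + h ∈ Ioi (0 : ℝ) := by
      simp only [mem_Ioi] at ht ⊢
      linarith
    rw [indicator_of_mem ht, indicator_of_mem ht', h2, h3, indicator_of_mem ht, ← mul_assoc,
      ← Complex.exp_add]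
    congr 2
    push_cast
    ring
  · rw [indicator_of_notMem ht]
    by_cases ht' : t + h ∈ Ioi (0 : ℝ)
    · rw [indicator_of_mem ht', h2, h3, indicator_of_notMem ht, mul_zero]
    · rw [indicator_of_notMem ht']

end X

/-! ### Existence of Jost pairs -/

/-- The amplitudes of the Jost solution `y = exp (i z x) (p + m)`, whose quasi-derivative `y' - u y`
is `i z exp (i z x) (p - m)`. -/
structure IsJostPair (u : ℝ → ℝ) (z : ℂ) (p m : ℝ → ℂ) : Prop where
  prim_fst : IsPrim p fun x => u x * m x
  prim_snd : IsPrim m fun x => -2 * Complex.I * z * m x + u x * p x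
  tendsto_fst : Tendsto p atTop (𝓝 1)
  tendsto_snd : Tendsto m atTop (𝓝 0)

section Kernel

variable {u : ℝ → ℝ}

lemma memX_tail (h2 : MemLp u 2 volume) (h1 : ∀ x, IntegrableOn u (Ioi x)) (x : ℝ) :
    MemX ((Ioi x).indicator fun t => -(u t : ℂ)) := by
  refine ⟨?_, (h2.ofReal (K := ℂ)).neg.indicator measurableSet_Ioi⟩
  rw [memLp_one_iff_integrable, integrable_indicator_iff measurableSet_Ioi]
  exact (h1 x).ofReal.neg

/-- The restriction of `-u` to `(x, ∞)`. -/
def tailX (h2 : MemLp u 2 volume) (h1 : ∀ x, IntegrableOn u (Ioi x)) (x : ℝ) : X :=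
  X.mk _ (memX_tail h2 h1 x)

lemma fn_tailX (h2 : MemLp u 2 volume) (h1 : ∀ x, IntegrableOn u (Ioi x)) (x : ℝ) :
    (tailX h2 h1 x).fn =ᵐ[volume] (Ioi x).indicator fun t => -(u t : ℂ) := X.fn_mk _

lemma norm_tailX_le (h2 : MemLp u 2 volume) (h1 : ∀ x, IntegrableOn u (Ioi x)) (x : ℝ) :
    ‖tailX h2 h1 x‖ ≤ (eLpNorm u 2 volume).toReal + tailMass u x := by
  rw [X.norm_eq, eLpNorm_congr_ae (fn_tailX h2 h1 x), eLpNorm_congr_ae (fn_tailX h2 h1 x)]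
  refine max_le ?_ ?_
  · have : (eLpNorm ((Ioi x).indicator fun t => -(u t : ℂ)) 1 volume).toReal = tailMass u x := by
      rw [eLpNorm_indicator_eq_eLpNorm_restrict measurableSet_Ioi, eLpNorm_one_eq_lintegral_enorm,
        tailMass]
      have h3 := integral_norm_eq_lintegral_enorm (h1 x).1
      simp only [Real.norm_eq_abs] at h3
      rw [h3]
      congr 1
      refine lintegral_congr fun t => ?_
      rw [enorm_neg, ← ofReal_norm, ← ofReal_norm, Complex.norm_real]
    rw [this]
    exact le_add_of_nonneg_left ENNReal.toReal_nonneg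
  · refine le_trans (ENNReal.toReal_mono h2.2.ne ?_) (le_add_of_nonneg_right (tailMass_nonneg x))
    refine (eLpNorm_indicator_le _).trans (eLpNorm_mono fun t => ?_)
    simp

lemma tailX_sub (h2 : MemLp u 2 volume) (h1 : ∀ x, IntegrableOn u (Ioi x)) {x₀ x y : ℝ}
    (hx : x₀ ≤ x) (hxy : x ≤ y) :
    tailX h2 h1 x - tailX h2 h1 y = X.ind (Ioc x y) measurableSet_Ioc (tailX h2 h1 x₀) := by
  rw [sub_eq_iff_eq_add]
  refine X.ext_ae ?_
  filter_upwards [X.fn_add (X.ind (Ioc x y) measurableSet_Ioc (tailX h2 h1 x₀)) (tailX h2 h1 y),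
    X.fn_ind (Ioc x y) measurableSet_Ioc (tailX h2 h1 x₀), fn_tailX h2 h1 x, fn_tailX h2 h1 y,
    fn_tailX h2 h1 x₀] with t e1 e2 e3 e4 e5
  rw [e1, e2, e3, e4]
  rcases le_or_gt t x with h | h
  · rw [indicator_of_notMem (by simpa using h), indicator_of_notMem (fun h' => h.not_gt h'.1),
      indicator_of_notMem (by simpa using h.trans hxy), add_zero]
  · rcases le_or_gt t y with h' | h'
    · rw [indicator_of_mem (by simpa using h), indicator_of_mem (show t ∈ Ioc x y from ⟨h, h'⟩),
        indicator_of_notMem (by simpa using h'), add_zero, e5,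
        indicator_of_mem (by simpa using hx.trans_lt h)]
    · rw [indicator_of_mem (by simpa using h), indicator_of_notMem fun h'' => h''.2.not_gt h',
        indicator_of_mem (by simpa using h'), zero_add]

/-- Absolute continuity of the L¹ and L² norms. -/
lemma X.exists_norm_ind_le (f : X) {ε : ℝ} (hε : 0 < ε) : ∃ δ > 0, ∀ s (hs : MeasurableSet s),
    volume s ≤ ENNReal.ofReal δ → ‖X.ind s hs f‖ ≤ ε := by
  obtain ⟨δ₁, hδ₁, e1⟩ := f.memX.1.eLpNorm_indicator_le le_rfl ENNReal.one_ne_top hε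
  obtain ⟨δ₂, hδ₂, e2⟩ := f.memX.2.eLpNorm_indicator_le one_le_two ENNReal.ofNat_ne_top hε
  refine ⟨min δ₁ δ₂, lt_min hδ₁ hδ₂, fun s hs h => ?_⟩
  rw [X.norm_eq, eLpNorm_congr_ae (X.fn_ind s hs f), eLpNorm_congr_ae (X.fn_ind s hs f)]
  refine max_le ?_ ?_
  · exact ENNReal.toReal_le_of_le_ofReal hε.le
      (e1 s hs (h.trans (ENNReal.ofReal_le_ofReal (min_le_left _ _))))
  · exact ENNReal.toReal_le_of_le_ofReal hε.le
      (e2 s hs (h.trans (ENNReal.ofReal_le_ofReal (min_le_right _ _))))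

/-- Increments are restrictions of one fixed function to short intervals. -/
lemma continuous_tailX (h2 : MemLp u 2 volume) (h1 : ∀ x, IntegrableOn u (Ioi x)) :
    Continuous (tailX h2 h1) := by
  refine Metric.continuous_iff.2 fun x ε hε => ?_
  obtain ⟨δ, hδ, h⟩ := X.exists_norm_ind_le (tailX h2 h1 (x - 1)) (half_pos hε)
  refine ⟨min δ 1, lt_min hδ zero_lt_one, fun y hy => ?_⟩
  rw [Real.dist_eq] at hy
  have hy1 := abs_lt.1 (hy.trans_le (min_le_left _ _))
  have hy2 := abs_lt.1 (hy.trans_le (min_le_right _ _))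
  rw [dist_eq_norm]
  refine lt_of_le_of_lt ?_ (half_lt_self hε)
  rcases le_total x y with hxy | hxy
  · rw [norm_sub_rev, tailX_sub h2 h1 (sub_one_lt x).le hxy]
    refine h _ _ ?_
    rw [Real.volume_Ioc]
    exact ENNReal.ofReal_le_ofReal (by linarith)
  · rw [tailX_sub h2 h1 (x₀ := x - 1) (by linarith) hxy]
    refine h _ _ ?_
    rw [Real.volume_Ioc]
    exact ENNReal.ofReal_le_ofReal (by linarith)

/-- This is the inhomogeneous term in the Volterra equation for the amplitude m. -/
lemma lap_trans_tailX (h2 : MemLp u 2 volume) (h1 : ∀ x, IntegrableOn u (Ioi x)) (z : ℂ)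
    (hz : 0 ≤ z.im) (x : ℝ) : X.lap z hz (X.trans (-x) (tailX h2 h1 x)) =
      -∫ s in Ioi x, Complex.exp (2 * Complex.I * z * (s - x)) * u s := by
  rw [X.lap_apply, ← integral_neg, ← integral_indicator measurableSet_Ioi,
    ← integral_indicator measurableSet_Ioi, ← integral_sub_right_eq_self _ x]
  have e1 := (measurePreserving_sub_right volume x).quasiMeasurePreserving.ae_eq_comp
    (X.fn_trans (-x) (tailX h2 h1 x))
  refine integral_congr_ae ?_
  filter_upwards [e1, fn_tailX h2 h1 x] with s e2 e3
  simp only [Function.comp_def, sub_neg_eq_add, sub_add_cancel] at e2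
  by_cases hs : s ∈ Ioi x
  · rw [indicator_of_mem hs, indicator_of_mem (by simpa using hs), e2, e3, indicator_of_mem hs]
    push_cast
    ring
  · rw [indicator_of_notMem hs, indicator_of_notMem (by simpa using hs)]

/-- The transformation operators of a potential. -/
lemma exists_kernel (h2 : MemLp u 2 volume) (h1 : ∀ x, IntegrableOn u (Ioi x)) :
    ∃ K L : ℝ → X,
      (∀ x, IntegrableOn (fun s => u s • X.trans (-s) (L s)) (Ioi x)) ∧
      (∀ x, IntegrableOn (fun s => u s • X.trans s (X.plus (K s))) (Ioi x)) ∧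
      (∀ x, K x = -∫ s in Ioi x, u s • X.trans (-s) (L s)) ∧
      ∀ x, L x = tailX h2 h1 x - ∫ s in Ioi x, u s • X.trans s (X.plus (K s)) := by
  -- The kernels are designed so that p = 1 + `lap z` (K x) and m = `lap z` (`trans` (-x) (L x))
  -- solve the amplitude equations for every z with Im z ≥ 0. Translations are isometric and `plus`
  -- is a contraction, so the coupling has norm at most one.
  have hB : Continuous fun p : ℝ × X × X => (X.trans (-p.1) p.2.2, X.trans p.1 (X.plus p.2.1)) := by
    refine Continuous.prodMk ?_ ?_
    · exact X.continuous_trans.comp (continuous_fst.neg.prodMk (continuous_snd.comp continuous_snd))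
    · exact X.continuous_trans.comp (continuous_fst.prodMk
        (X.plus.continuous.comp (continuous_fst.comp continuous_snd)))
  obtain ⟨P, -, hi, hP⟩ := exists_volterra (E := X × X) h1
    (B := fun s p => (X.trans (-s) p.2, X.trans s (X.plus p.1))) hB
    (fun s p q => by
      rw [Prod.mk_sub_mk, Prod.norm_mk, ← map_sub, ← map_sub, ← map_sub, X.norm_trans, X.norm_trans]
      exact max_le (norm_snd_le (p - q)) ((X.norm_ind_le _ _ _).trans (norm_fst_le (p - q))))
    (fun s => by simp)
    (Q := fun x => (0, tailX h2 h1 x)) (continuous_const.prodMk (continuous_tailX h2 h1))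
    (C := (eLpNorm u 2 volume).toReal) (fun x => by
      rw [Prod.norm_mk, norm_zero, max_eq_right (norm_nonneg _)]
      exact norm_tailX_le h2 h1 x)
  refine ⟨fun x => (P x).1, fun x => (P x).2, fun x => ?_, fun x => ?_, fun x => ?_, fun x => ?_⟩
  · exact (hi x).fst
  · exact (hi x).snd
  · have := congrArg Prod.fst (hP x)
    rw [Prod.fst_sub, fst_integral (hi x), zero_sub] at this
    exact this
  · have := congrArg Prod.snd (hP x)
    rw [Prod.snd_sub, snd_integral (hi x)] at this
    exact this

lemma isJostPair_of_eq {z : ℂ} (hz : 0 ≤ z.im) (h1 : ∀ x, IntegrableOn u (Ioi x)) {p m : ℝ → ℂ}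
    (hi : ∀ x, IntegrableOn (fun s => u s * m s) (Ioi x))
    (hp : ∀ x, p x = 1 - ∫ s in Ioi x, u s * m s)
    (hm : ∀ x, m x = -∫ s in Ioi x, Complex.exp (2 * Complex.I * z * (s - x)) * (u s * p s)) :
    IsJostPair u z p m := by
  have hpp : IsPrim p fun x => u x * m x := by
    have := isPrim_sub_setIntegral_Ioi 1 hi
    simpa only [← hp] using this
  have hb : ∀ x, ∃ C, 0 ≤ C ∧ ∀ s, x ≤ s → ‖p s‖ ≤ C := fun x => by
    refine ⟨1 + ∫ s in Ioi x, ‖u s * m s‖, by positivity, fun s hs => ?_⟩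
    rw [hp s]
    refine (norm_sub_le _ _).trans (add_le_add (by simp) ?_)
    refine (norm_integral_le_integral_norm _).trans ?_
    exact setIntegral_mono_set (hi x).norm (Eventually.of_forall fun _ => norm_nonneg _)
      (Ioi_subset_Ioi hs).eventuallyLE
  have hdec : ∀ x s : ℝ, x ≤ s → ‖Complex.exp (2 * Complex.I * z * (s - x))‖ ≤ 1 :=
    fun x s hs => by
      rw [← Complex.ofReal_sub]
      exact norm_cexp_two_I_le hz (sub_nonneg.2 hs)
  have hup : ∀ x, IntegrableOn (fun s => (u s : ℂ) * p s) (Ioi x) := fun x => by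
    obtain ⟨C, -, hC⟩ := hb x
    refine (h1 x).ofReal.mul_bdd (c := C) hpp.continuous.aestronglyMeasurable ?_
    exact (ae_restrict_iff' measurableSet_Ioi).2 (Eventually.of_forall fun s hs => hC s (le_of_lt hs))
  have hw : ∀ x, IntegrableOn (fun s : ℝ => Complex.exp (2 * Complex.I * z * s) * (u s * p s))
      (Ioi x) := fun x => by
    have h3 : IntegrableOn (fun s : ℝ => Complex.exp (2 * Complex.I * z * x) *
        (Complex.exp (2 * Complex.I * z * (s - x)) * (u s * p s))) (Ioi x) := by
      refine Integrable.const_mul ?_ _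
      refine (hup x).bdd_mul (c := 1) (Continuous.aestronglyMeasurable (by fun_prop)) ?_
      exact (ae_restrict_iff' measurableSet_Ioi).2
        (Eventually.of_forall fun s hs => hdec x s (le_of_lt hs))
    refine h3.congr_fun (fun s _ => ?_) measurableSet_Ioi
    simp only
    rw [← mul_assoc, ← Complex.exp_add]
    ring_nf
  have hwp := isPrim_sub_setIntegral_Ioi 0 hw
  -- Splitting exp(2iz(s - x)) makes m a product of an exponential and a primitive, to which the
  -- product rule applies.
  have hme : ∀ x : ℝ, m x = Complex.exp (-2 * Complex.I * z * x) *
      (0 - ∫ s in Ioi x, Complex.exp (2 * Complex.I * z * s) * (u s * p s)) := fun x => by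
    rw [hm x, zero_sub, mul_neg, ← integral_const_mul]
    congr 2
    funext s
    rw [← mul_assoc (Complex.exp (-2 * Complex.I * z * x)), ← Complex.exp_add]
    ring_nf
  have hE : IsPrim (fun x : ℝ => Complex.exp (-2 * Complex.I * z * x))
      fun x : ℝ => -2 * Complex.I * z * Complex.exp (-2 * Complex.I * z * x) := by
    refine isPrim_of_hasDerivAt (fun x => ?_) (by fun_prop)
    have h3 := ((hasDerivAt_id (x : ℂ)).const_mul (-2 * Complex.I * z)).cexp.comp_ofReal
    refine h3.congr_deriv ?_
    simp only [id, mul_one]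
    ring
  have hmp := hE.mul hwp
  simp only [← hme] at hmp
  refine ⟨hpp, hmp.congr_ae (Eventually.of_forall fun x => ?_), ?_, ?_⟩
  · simp only
    rw [mul_assoc (-2 * Complex.I * z), ← hme, ← mul_assoc (Complex.exp _), ← Complex.exp_add]
    ring_nf
    simp
  · have := (tendsto_setIntegral_Ioi_atTop (hi 0)).const_sub 1
    simpa only [← hp, sub_zero] using this
  · obtain ⟨C, h0, hC⟩ := hb 0
    have h3 : Tendsto (fun x => C * tailMass u x) atTop (𝓝 0) := by
      simpa [tailMass] using (tendsto_setIntegral_Ioi_atTop (h1 0).abs).const_mul C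
    refine squeeze_zero_norm' ?_ h3
    filter_upwards [eventually_ge_atTop 0] with x hx
    rw [hm x, norm_neg, tailMass, ← integral_const_mul]
    refine norm_integral_le_of_norm_le ((h1 x).abs.const_mul C) ?_
    refine (ae_restrict_iff' measurableSet_Ioi).2 (Eventually.of_forall fun s hs => ?_)
    rw [norm_mul, norm_mul, Complex.norm_real, Real.norm_eq_abs, mul_comm C]
    have h4 := hdec x s (le_of_lt hs)
    have h5 := hC s (hx.trans (le_of_lt hs))
    calc _ ≤ 1 * (|u s| * C) := by gcongr
      _ = _ := one_mul _

/-- The kernels do not depend on z. Applying `lap z` to them solves the amplitude equations for all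
z, and at x = 0 the translation disappears. -/
lemma exists_isJostPair (h2 : MemLp u 2 volume) (h1 : ∀ x, IntegrableOn u (Ioi x)) :
    ∃ f g : X, ∀ z (hz : 0 ≤ z.im), ∃ p m, IsJostPair u z p m ∧
      p 0 = 1 + X.lap z hz f ∧ m 0 = X.lap z hz g := by
  obtain ⟨K, L, hiL, hiK, hK, hL⟩ := exists_kernel h2 h1
  refine ⟨K 0, L 0, fun z hz => ⟨fun x => 1 + X.lap z hz (K x),
    fun x => X.lap z hz (X.trans (-x) (L x)), ?_, rfl, by simp [X.trans_zero]⟩⟩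
  refine isJostPair_of_eq hz h1 (fun x => ?_) (fun x => ?_) fun x => ?_
  · have := (X.lap z hz).integrable_comp (hiL x)
    simp only [ContinuousLinearMap.map_smul_of_tower, Complex.real_smul] at this
    exact this
  · have := (X.lap z hz).integral_comp_comm (hiL x)
    rw [hK x, map_neg, ← this, sub_eq_add_neg]
    simp [Complex.real_smul]
  · have h3 := ((X.lap z hz).comp (X.trans (-x))).integral_comp_comm (hiK x)
    have h4 := ((X.lap z hz).comp (X.trans (-x))).integrable_comp (hiK x)
    have e : ∀ s ∈ Ioi x, ((X.lap z hz).comp (X.trans (-x))) (u s • X.trans s (X.plus (K s))) =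
        Complex.exp (2 * Complex.I * z * (s - x)) * (u s * X.lap z hz (K s)) := fun s hs => by
      rw [ContinuousLinearMap.map_smul_of_tower, ContinuousLinearMap.comp_apply, ← X.trans_add,
        neg_add_eq_sub, X.lap_trans_plus z hz (sub_nonneg.2 (le_of_lt hs)), Complex.real_smul]
      push_cast
      ring
    have h5 : IntegrableOn (fun s : ℝ => Complex.exp (2 * Complex.I * z * (s - x)) *
        (u s * X.lap z hz (K s))) (Ioi x) := IntegrableOn.congr_fun h4 e measurableSet_Ioi
    have h6 : IntegrableOn (fun s : ℝ => Complex.exp (2 * Complex.I * z * (s - x)) * (u s : ℂ))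
        (Ioi x) := by
      refine (h1 x).ofReal.bdd_mul (c := 1) (Continuous.aestronglyMeasurable (by fun_prop)) ?_
      refine (ae_restrict_iff' measurableSet_Ioi).2 (Eventually.of_forall fun s hs => ?_)
      rw [← Complex.ofReal_sub]
      exact norm_cexp_two_I_le hz (sub_nonneg.2 (le_of_lt hs))
    rw [setIntegral_congr_fun measurableSet_Ioi e] at h3
    rw [hL x, map_sub, map_sub, lap_trans_tailX]
    rw [ContinuousLinearMap.comp_apply] at h3
    rw [← h3, ← neg_add', ← integral_add h6 h5]
    congr 2
    funext s
    ring

end Kernel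

/-! ### Conservation laws for Jost pairs -/

namespace IsJostPair

variable {u : ℝ → ℝ} {z : ℂ} {k : ℝ} {p m p' m' : ℝ → ℂ}

/-- The derivative of |p|² - |m|² is -4 Im z |m|² ≤ 0, and its limit at infinity is 1. -/
lemma one_le (h : IsJostPair u z p m) (hz : 0 ≤ z.im) (x : ℝ) :
    1 ≤ ‖p x‖ ^ 2 - ‖m x‖ ^ 2 := by
  have hD : ∀ x, ((fun x => p x * conj (p x) - m x * conj (m x)) x).re = ‖p x‖ ^ 2 - ‖m x‖ ^ 2 :=
    fun x => by
      simp only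
      rw [Complex.mul_conj, Complex.mul_conj, Complex.normSq_eq_norm_sq, Complex.normSq_eq_norm_sq]
      rw [Complex.sub_re, Complex.ofReal_re, Complex.ofReal_re]
  have h1 := ((h.prim_fst.mul h.prim_fst.conj).sub (h.prim_snd.mul h.prim_snd.conj)).re
  simp only at hD
  simp only [hD] at h1
  have h2 : Antitone fun x => ‖p x‖ ^ 2 - ‖m x‖ ^ 2 := fun a b hab => by
    rw [← sub_nonpos, h1.sub_eq a b]
    rw [← neg_nonneg, ← intervalIntegral.integral_neg]
    refine intervalIntegral.integral_nonneg hab fun x _ => ?_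
    have e : (↑(u x) * m x * conj (p x) + p x * conj (↑(u x) * m x) -
        ((-2 * Complex.I * z * m x + ↑(u x) * p x) * conj (m x) +
          m x * conj (-2 * Complex.I * z * m x + ↑(u x) * p x))).re =
        -4 * (z.im * ((m x).re ^ 2 + (m x).im ^ 2)) := by
      simp
      ring
    rw [e]
    have := mul_nonneg hz (add_nonneg (sq_nonneg (m x).re) (sq_nonneg (m x).im))
    linarith
  have h3 : Tendsto (fun x => ‖p x‖ ^ 2 - ‖m x‖ ^ 2) atTop (𝓝 1) := by
    simpa using (h.tendsto_fst.norm.pow 2).sub (h.tendsto_snd.norm.pow 2)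
  exact h2.le_of_tendsto h3 x

lemma conjugate (h : IsJostPair u (k : ℂ) p m) :
    IsJostPair u ((-k : ℝ) : ℂ) (fun x => conj (p x)) fun x => conj (m x) := by
  refine ⟨h.prim_fst.conj.congr_ae (Eventually.of_forall fun x => ?_),
    h.prim_snd.conj.congr_ae (Eventually.of_forall fun x => ?_), ?_, ?_⟩
  · simp
  · simp [Complex.conj_ofNat]
  · simpa [Function.comp_def] using (Complex.continuous_conj.tendsto _).comp h.tendsto_fst
  · simpa [Function.comp_def] using (Complex.continuous_conj.tendsto _).comp h.tendsto_snd

lemma mul_conj_sub (h : IsJostPair u (k : ℂ) p m) (h' : IsJostPair u (k : ℂ) p' m') (x : ℝ) :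
    p x * conj (p' x) - m x * conj (m' x) = 1 := by
  have h1 := (h.prim_fst.mul h'.prim_fst.conj).sub (h.prim_snd.mul h'.prim_snd.conj)
  have h2 := h1.eq_of_deriv_zero (Eventually.of_forall fun x => by
    simp only [map_mul, map_add, map_neg, Complex.conj_ofReal, Complex.conj_I, Complex.conj_ofNat,
      Pi.zero_apply]
    ring)
  have hc := (Complex.continuous_conj.tendsto (1 : ℂ)).comp h'.tendsto_fst
  have hc' := (Complex.continuous_conj.tendsto (0 : ℂ)).comp h'.tendsto_snd
  have h3 := (h.tendsto_fst.mul hc).sub (h.tendsto_snd.mul hc')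
  simp only [map_one, map_zero, mul_one, mul_zero, sub_zero, Function.comp_def] at h3
  have h4 := tendsto_nhds_unique (h3.congr h2) tendsto_const_nhds
  rw [h2 x, h4]

/-- The expression w satisfies w' = -2ikw, so |w|² is constant for real k, and it tends to 0. -/
lemma mul_sub_mul (h : IsJostPair u (k : ℂ) p m) (h' : IsJostPair u (k : ℂ) p' m') (x : ℝ) :
    p x * m' x - m x * p' x = 0 := by
  have h1 := (h.prim_fst.mul h'.prim_snd).sub (h.prim_snd.mul h'.prim_fst)
  have h2 := (h1.mul h1.conj).eq_of_deriv_zero (Eventually.of_forall fun x => by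
    simp only [map_mul, map_add, map_neg, map_sub, Complex.conj_ofReal, Complex.conj_I,
      Complex.conj_ofNat, Pi.zero_apply]
    ring)
  have h3 := (h.tendsto_fst.mul h'.tendsto_snd).sub (h.tendsto_snd.mul h'.tendsto_fst)
  simp only [mul_zero, zero_mul, sub_zero] at h3
  have h4 := h3.mul ((Complex.continuous_conj.tendsto (0 : ℂ)).comp h3)
  simp only [Function.comp_def, zero_mul] at h4
  have h5 := tendsto_nhds_unique (h4.congr h2) tendsto_const_nhds
  have h6 := h2 x
  rw [← h5, Complex.mul_conj, Complex.ofReal_eq_zero, Complex.normSq_eq_zero] at h6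
  exact h6

/-- Pure algebra from the two preceding identities. -/
lemma unique (h : IsJostPair u (k : ℂ) p m) (h' : IsJostPair u (k : ℂ) p' m') (x : ℝ) :
    p x = p' x ∧ m x = m' x := by
  have h1 := h.mul_conj_sub h x
  have h2 := h'.mul_conj_sub h x
  have h3 := h.mul_sub_mul h' x
  constructor
  · linear_combination (-p x) * h2 - conj (m x) * h3 + p' x * h1
  · linear_combination (-m x) * h2 + m' x * h1 - conj (p x) * h3

/-! ### Jost solutions -/

lemma isSystem (h : IsJostPair u (k : ℂ) p m) :
    IsSystem u k (fun x => Complex.exp (Complex.I * k * x) * (p x + m x))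
      fun x => Complex.I * k * (Complex.exp (Complex.I * k * x) * (p x - m x)) := by
  have hE : IsPrim (fun x : ℝ => Complex.exp (Complex.I * k * x))
      fun x : ℝ => Complex.I * k * Complex.exp (Complex.I * k * x) := by
    refine isPrim_of_hasDerivAt (fun x => ?_) (by fun_prop)
    have h3 := ((hasDerivAt_id (x : ℂ)).const_mul (Complex.I * k)).cexp.comp_ofReal
    refine h3.congr_deriv ?_
    simp only [id, mul_one]
    ring
  refine ⟨(hE.mul (h.prim_fst.add h.prim_snd)).congr_ae (Eventually.of_forall fun x => ?_),
    ((hE.mul (h.prim_fst.sub h.prim_snd)).const_mul (Complex.I * k)).congr_ae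
      (Eventually.of_forall fun x => ?_)⟩
  · simp only
    ring
  · simp only
    linear_combination k ^ 2 * Complex.exp (Complex.I * k * x) * (p x + m x) * Complex.I_sq

lemma tendsto_sub_exp (h : IsJostPair u (k : ℂ) p m) :
    Tendsto (fun x : ℝ => Complex.exp (Complex.I * k * x) * (p x + m x) -
      Complex.exp (Complex.I * k * x)) atTop (𝓝 0) := by
  have h1 := ((h.tendsto_fst.add h.tendsto_snd).sub_const 1).norm
  simp only [add_zero, sub_self, norm_zero] at h1
  refine squeeze_zero_norm (fun x => le_of_eq ?_) h1
  rw [← mul_sub_one, norm_mul, Complex.norm_exp]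
  simp

end IsJostPair

namespace IsSystem

variable {u : ℝ → ℝ} {k : ℝ} {y η y' η' y₁ η₁ y₂ η₂ : ℝ → ℂ}

lemma neg (h : IsSystem u k y η) : IsSystem u (-k) y η :=
  ⟨h.prim_fst, by simpa using h.prim_snd⟩

lemma combine (h₁ : IsSystem u k y₁ η₁) (h₂ : IsSystem u k y₂ η₂) (c d : ℂ) :
    IsSystem u k (fun x => c * y₁ x + d * y₂ x) fun x => c * η₁ x + d * η₂ x :=
  ⟨((h₁.prim_fst.const_mul c).add (h₂.prim_fst.const_mul d)).congr_ae
      (Eventually.of_forall fun x => by simp only; ring),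
    ((h₁.prim_snd.const_mul c).add (h₂.prim_snd.const_mul d)).congr_ae
      (Eventually.of_forall fun x => by simp only; ring)⟩

/-- Both quasi-derivatives equal y' - uy a.e. and are continuous. -/
lemma snd_unique (h : IsSystem u k y η) (h' : IsSystem u k y η') : η = η' := by
  have h1 := h.prim_fst.ae_eq h'.prim_fst
  refine (h.prim_snd.continuous.ae_eq_iff_eq (μ := volume) h'.prim_snd.continuous).1 ?_
  filter_upwards [h1] with x hx
  exact add_left_cancel hx

lemma wronskian (h₁ : IsSystem u k y₁ η₁) (h₂ : IsSystem u k y₂ η₂) (x : ℝ) :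
    y₁ x * η₂ x - η₁ x * y₂ x = y₁ 0 * η₂ 0 - η₁ 0 * y₂ 0 :=
  ((h₁.prim_fst.mul h₂.prim_snd).sub (h₁.prim_snd.mul h₂.prim_fst)).eq_of_deriv_zero
    (Eventually.of_forall fun x => by simp only [Pi.zero_apply]; ring) x

/-- Reduces the left half-line to the right one. -/
lemma reflect (h : IsSystem u k y η) :
    IsSystem (fun x => -u (-x)) k (fun x => y (-x)) fun x => -η (-x) :=
  ⟨h.prim_fst.comp_neg.congr_ae (Eventually.of_forall fun x => by simp; ring),
    h.prim_snd.comp_neg.neg.congr_ae (Eventually.of_forall fun x => by simp; ring)⟩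

/-- Zero data at 0 give zero Wronskians with two independent solutions. This serves as uniqueness
for the initial value problem. -/
lemma eq_zero_of_wronskian (h : IsSystem u k y η) (h₁ : IsSystem u k y₁ η₁)
    (h₂ : IsSystem u k y₂ η₂) (hW : y₁ 0 * η₂ 0 - η₁ 0 * y₂ 0 ≠ 0) (hy : y 0 = 0) (hη : η 0 = 0)
    (x : ℝ) : y x = 0 := by
  have e1 := h.wronskian h₁ x
  have e2 := h.wronskian h₂ x
  have e3 := h₁.wronskian h₂ x
  rw [hy, hη] at e1 e2
  have h3 : y x * (y₁ 0 * η₂ 0 - η₁ 0 * y₂ 0) = 0 := by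
    rw [← e3]
    linear_combination y₁ x * e2 - y₂ x * e1
  exact (mul_eq_zero.1 h3).resolve_right hW

end IsSystem

/-- After multiplication by exp(ikx) the second term oscillates. A shift by π / (2k) reverses its
sign, so adding the shifted expression isolates 2c. -/
lemma eq_zero_of_tendsto_exp {k : ℝ} (hk : k ≠ 0) {c d : ℂ}
    (h : Tendsto (fun x : ℝ => c * Complex.exp (-(Complex.I * k * x)) -
      d * Complex.exp (Complex.I * k * x)) atTop (𝓝 0)) : c = 0 ∧ d = 0 := by
  have hn : ∀ x : ℝ, ‖Complex.exp (Complex.I * k * x)‖ = 1 := fun x => by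
    rw [Complex.norm_exp]
    simp
  have h1 : Tendsto (fun x : ℝ => c - d * Complex.exp (2 * Complex.I * k * x)) atTop (𝓝 0) := by
    have h0 := h.norm
    rw [norm_zero] at h0
    refine squeeze_zero_norm (fun x => le_of_eq ?_) h0
    rw [← one_mul ‖c * _ - _‖, ← hn x, ← norm_mul]
    congr 1
    rw [mul_sub, mul_left_comm, ← Complex.exp_add, mul_left_comm, ← Complex.exp_add]
    ring_nf
    simp
  have h2 := h1.comp (tendsto_atTop_add_const_right atTop (Real.pi / (2 * k)) tendsto_id)
  have e : ∀ x : ℝ, Complex.exp (2 * Complex.I * k * ((x + Real.pi / (2 * k) : ℝ) : ℂ)) =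
      -Complex.exp (2 * Complex.I * k * x) := fun x => by
    have hk' : (k : ℂ) ≠ 0 := by exact_mod_cast hk
    have : 2 * Complex.I * k * ((x + Real.pi / (2 * k) : ℝ) : ℂ) =
        2 * Complex.I * k * x + Real.pi * Complex.I := by
      push_cast
      field_simp
    rw [this, Complex.exp_add, Complex.exp_pi_mul_I]
    ring
  simp only [Function.comp_def, id, e] at h2
  have h3 := h1.add h2
  have hc : c = 0 := by
    have h4 : Tendsto (fun _ : ℝ => 2 * c) atTop (𝓝 (0 + 0)) := h3.congr fun x => by ring
    have := tendsto_nhds_unique h4 tendsto_const_nhds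
    simpa using this.symm
  refine ⟨hc, ?_⟩
  have h4 := h.norm
  simp only [hc, zero_mul, zero_sub, norm_neg, norm_mul, hn, mul_one, norm_zero] at h4
  have := tendsto_nhds_unique h4 tendsto_const_nhds
  exact norm_eq_zero.1 this.symm

/-- Constancy of Wronskians writes `y` as a combination of `y₁` and `y₂`; the asymptotics then force
both coefficients to vanish. Nothing about the quasi-derivative at infinity is needed. -/
lemma IsSystem.eq_zero_of_tendsto {u : ℝ → ℝ} {k : ℝ} (hk : k ≠ 0) {y η y₁ η₁ y₂ η₂ : ℝ → ℂ}
    (h : IsSystem u k y η) (h₁ : IsSystem u k y₁ η₁) (h₂ : IsSystem u k y₂ η₂)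
    (hW : y₁ 0 * η₂ 0 - η₁ 0 * y₂ 0 ≠ 0) (ht : Tendsto y atTop (𝓝 0))
    (t₁ : Tendsto (fun x : ℝ => y₁ x - Complex.exp (Complex.I * k * x)) atTop (𝓝 0))
    (t₂ : Tendsto (fun x : ℝ => y₂ x - Complex.exp (-(Complex.I * k * x))) atTop (𝓝 0)) (x : ℝ) :
    y x = 0 := by
  obtain ⟨c₁, e₁⟩ : ∃ c, ∀ x, y x * η₁ x - η x * y₁ x = c := ⟨_, h.wronskian h₁⟩
  obtain ⟨c₂, e₂⟩ : ∃ c, ∀ x, y x * η₂ x - η x * y₂ x = c := ⟨_, h.wronskian h₂⟩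
  have e₃ := h₁.wronskian h₂
  set W := y₁ 0 * η₂ 0 - η₁ 0 * y₂ 0
  have key : ∀ x, W * y x = c₂ * y₁ x - c₁ * y₂ x := fun x => by
    rw [← e₃ x, ← e₁ x, ← e₂ x]
    ring
  have h3 : c₁ = 0 ∧ c₂ = 0 := by
    refine eq_zero_of_tendsto_exp hk ?_
    have h4 := ((t₁.const_mul c₂).sub (t₂.const_mul c₁)).sub (ht.const_mul W)
    simp only [mul_zero, sub_zero] at h4
    refine h4.congr fun x => ?_
    rw [key x]
    ring
  have h5 := key x
  rw [h3.1, h3.2, zero_mul, zero_mul, sub_zero] at h5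
  exact (mul_eq_zero.1 h5).resolve_left hW

/-- Uniqueness of the Jost solution. -/
lemma IsJostPair.eq_of_tendsto {u : ℝ → ℝ} {k : ℝ} (hk : k ≠ 0) {p m y η : ℝ → ℂ}
    (h : IsJostPair u (k : ℂ) p m) (hy : IsSystem u k y η)
    (ht : Tendsto (fun x : ℝ => y x - Complex.exp (Complex.I * k * x)) atTop (𝓝 0)) (x : ℝ) :
    y x = Complex.exp (Complex.I * k * x) * (p x + m x) := by
  have h1 := h.isSystem
  -- The conjugate solution solves the same equation with asymptotics exp(-ikx). Its Wronskian with
  -- the Jost solution is -2ik by the conservation law.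
  have h2 := h.conjugate.isSystem.neg
  rw [neg_neg] at h2
  have hY := hy.combine h1 1 (-1)
  have t1 := h.tendsto_sub_exp
  have t2 := h.conjugate.tendsto_sub_exp
  have hexp : ∀ x : ℝ, Complex.exp (Complex.I * ((-k : ℝ) : ℂ) * x) =
      Complex.exp (-(Complex.I * k * x)) := fun x => by
    push_cast
    ring_nf
  simp only [hexp] at h2 t2
  have hD := h.mul_conj_sub h 0
  have h3 := hY.eq_zero_of_tendsto hk h1 h2 ?_ ?_ t1 t2 x
  · linear_combination h3
  · simp only [Complex.ofReal_zero, mul_zero, neg_zero, Complex.exp_zero, one_mul]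
    have e : (p 0 + m 0) * (Complex.I * ((-k : ℝ) : ℂ) * (conj (p 0) - conj (m 0))) -
        Complex.I * k * (p 0 - m 0) * (conj (p 0) + conj (m 0)) = -2 * Complex.I * k := by
      push_cast
      linear_combination (-2 * Complex.I * k) * hD
    rw [e]
    have : (k : ℂ) ≠ 0 := by exact_mod_cast hk
    simp [Complex.I_ne_zero, this]
  · have h4 := ht.sub t1
    rw [sub_zero] at h4
    exact h4.congr fun x => by ring

/-! ### The sign of the difference of the extremal Riccati representatives -/

/-- Here v' = -2u₁v + v². If v(0) = 0, then v vanishes identically. If v(0) > 0, then v exp(2∫u₁ -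
∫v) is constant, so v exp(-∫v) stays above a positive constant on (0, ∞), as ∫u₁ is bounded above
there. But it is minus the derivative of exp(-∫v), which would have to reach 0 in finite time. -/
lemma neg_of_riccati_difference {u₁ u₂ v : ℝ → ℝ} (hv : IsPrim v fun x => -(u₁ x + u₂ x) * v x)
    (hae : (fun x => u₁ x - u₂ x) =ᵐ[volume] v) (l₁ : LocallyIntegrable u₁ volume)
    (l₂ : LocallyIntegrable u₂ volume) (hi : IntegrableOn u₁ (Ioi 0))
    (hne : ¬ u₁ =ᵐ[volume] u₂) : v 0 < 0 := by
  have hprim : ∀ {f : ℝ → ℝ}, LocallyIntegrable f volume →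
      IsPrim (fun x => ∫ s in (0 : ℝ)..x, f s) f := fun hf => ⟨hf, fun x => by simp⟩
  by_contra! h0
  rcases h0.eq_or_lt with h0 | h0
  · have hS := hprim (l₁.add l₂)
    have h1 := (hv.mul hS.rexp).eq_of_deriv_zero (Eventually.of_forall fun x => by
      simp only [Pi.add_apply, Pi.zero_apply]
      ring)
    refine hne ?_
    filter_upwards [hae] with x hx
    have h2 := h1 x
    rw [← h0, zero_mul] at h2
    rw [(mul_eq_zero.1 h2).resolve_right (Real.exp_ne_zero _)] at hx
    exact sub_eq_zero.1 hx
  · have hV := (hprim hv.continuous.locallyIntegrable).neg.rexp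
    have hU := (hprim l₁).add (hprim l₁)
    have h1 := ((hv.mul hV).mul hU.rexp).eq_of_deriv_zero (by
      filter_upwards [hae] with x hx
      simp only [Pi.zero_apply]
      rw [← hx]
      ring)
    simp only [intervalIntegral.integral_same, neg_zero, Real.exp_zero, add_zero, mul_one] at h1
    set M := ∫ s in Ioi (0 : ℝ), |u₁ s|
    have hM : ∀ x, 0 ≤ x → ∫ s in (0 : ℝ)..x, u₁ s ≤ M := fun x hx => by
      rw [intervalIntegral.integral_of_le hx]
      refine (le_abs_self _).trans ((abs_integral_le_integral_abs).trans ?_)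
      exact setIntegral_mono_set hi.abs (Eventually.of_forall fun _ => abs_nonneg _)
        Ioc_subset_Ioi_self.eventuallyLE
    -- At this point the lower bound integrates to exactly 1, the initial value of exp(-∫v).
    set b := Real.exp (2 * M) / v 0
    have hb : 0 ≤ b := by positivity
    have h2 := hV.sub_eq 0 b
    have h3 : ∫ _ in (0 : ℝ)..b, v 0 * Real.exp (-(2 * M)) ≤
        ∫ s in (0 : ℝ)..b, -(Real.exp (-∫ s in (0 : ℝ)..s, v s) * -v s) := by
      refine intervalIntegral.integral_mono_on hb (by simp) (hV.intervalIntegrable _ _).neg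
        fun x hx => ?_
      rw [← h1 x]
      have h4 := hM x hx.1
      have h5 : Real.exp ((∫ s in (0 : ℝ)..x, u₁ s) + ∫ s in (0 : ℝ)..x, u₁ s) *
          Real.exp (-(2 * M)) ≤ 1 := by
        rw [← Real.exp_add, Real.exp_le_one_iff]
        linarith
      have h6 : 0 ≤ v x * Real.exp (-∫ s in (0 : ℝ)..x, v s) := by
        have h7 := h1 x
        refine nonneg_of_mul_nonneg_left ?_ (Real.exp_pos ((∫ s in (0 : ℝ)..x, u₁ s) + ∫ s in (0 : ℝ)..x, u₁ s))
        rw [h7]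
        exact h0.le
      rw [mul_assoc]
      refine (mul_le_of_le_one_right h6 h5).trans_eq (by ring)
    rw [intervalIntegral.integral_neg, ← h2] at h3
    simp only [intervalIntegral.integral_const, intervalIntegral.integral_same, neg_zero,
      Real.exp_zero, sub_zero, smul_eq_mul] at h3
    have h4 : b * (v 0 * Real.exp (-(2 * M))) = 1 := by
      rw [Real.exp_neg]
      have := Real.exp_ne_zero (2 * M)
      simp only [b]
      field_simp
    have := Real.exp_pos (-∫ s in (0 : ℝ)..b, v s)
    linarith

/-! ### Holomorphic extensions to the upper half-plane -/

lemma isOpen_upper : IsOpen {z : ℂ | 0 < z.im} := isOpen_lt continuous_const Complex.continuous_im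

lemma closure_upper : closure {z : ℂ | 0 < z.im} = {z : ℂ | 0 ≤ z.im} := Complex.closure_setOfPred_lt_im 0

namespace X

/-- The holomorphic extension of the Fourier transform of `plus f`. -/
def laplace (f : X) (z : ℂ) : ℂ :=
  ∫ t in Ioi (0 : ℝ), Complex.exp (2 * Complex.I * z * t) * f.fn t

lemma laplace_eq (f : X) {z : ℂ} (hz : 0 ≤ z.im) : laplace f z = lap z hz f :=
  (lap_apply z hz f).symm

lemma laplace_ofReal (f : X) (ξ : ℝ) : laplace f ξ = hat ξ (plus f) := by
  rw [laplace_eq f (by simp), lap_ofReal]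

lemma norm_laplace_le (f : X) {z : ℂ} (hz : 0 ≤ z.im) : ‖laplace f z‖ ≤ ‖f‖ := by
  rw [laplace_eq f hz]
  exact norm_lap_le z hz f

lemma aestronglyMeasurable_laplace (f : X) (z : ℂ) : AEStronglyMeasurable
    (fun t : ℝ => Complex.exp (2 * Complex.I * z * t) * f.fn t) (volume.restrict (Ioi 0)) :=
  (Continuous.aestronglyMeasurable (by fun_prop)).mul f.memX.1.1.restrict

lemma continuousOn_laplace (f : X) : ContinuousOn (laplace f) {z : ℂ | 0 ≤ z.im} := by
  refine continuousOn_of_dominated (bound := fun t => ‖f.fn t‖)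
    (fun z _ => aestronglyMeasurable_laplace f z) (fun z hz => ?_) f.integrable.norm.integrableOn
    (Eventually.of_forall fun t => by fun_prop)
  refine (ae_restrict_iff' measurableSet_Ioi).2 (Eventually.of_forall fun t ht => ?_)
  rw [norm_mul]
  exact mul_le_of_le_one_left (norm_nonneg _) (norm_cexp_two_I_le hz (le_of_lt ht))

lemma differentiableOn_laplace (f : X) : DifferentiableOn ℂ (laplace f) {z : ℂ | 0 < z.im} := by
  intro z hz
  have hz' : 0 < z.im := hz
  -- On this half-plane 2t exp(-2t Im w) ≤ 2 / Im z for t > 0, which dominates the derivative of the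
  -- kernel.
  have hs : {w : ℂ | z.im / 2 < w.im} ∈ 𝓝 z :=
    (isOpen_lt continuous_const Complex.continuous_im).mem_nhds (half_lt_self hz')
  refine (hasDerivAt_integral_of_dominated_loc_of_deriv_le
    (F' := fun w t => 2 * Complex.I * t * Complex.exp (2 * Complex.I * w * t) * f.fn t)
    (bound := fun t => 2 / z.im * ‖f.fn t‖) hs
    (Eventually.of_forall fun w => aestronglyMeasurable_laplace f w) ?_ ?_ ?_
    (f.integrable.norm.integrableOn.const_mul _) ?_).2.differentiableAt.differentiableWithinAt
  · refine f.integrable.integrableOn.bdd_mul (c := 1)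
      (Continuous.aestronglyMeasurable (by fun_prop)) ?_
    exact (ae_restrict_iff' measurableSet_Ioi).2
      (Eventually.of_forall fun t ht => norm_cexp_two_I_le hz'.le (le_of_lt ht))
  · exact (Continuous.aestronglyMeasurable (by fun_prop)).mul f.memX.1.1.restrict
  · refine (ae_restrict_iff' measurableSet_Ioi).2 (Eventually.of_forall fun t ht w hw => ?_)
    have ht' : 0 < t := ht
    have hw' : z.im / 2 < w.im := hw
    rw [norm_mul]
    refine mul_le_mul_of_nonneg_right ?_ (norm_nonneg _)
    rw [norm_mul, Complex.norm_exp]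
    have e1 : ‖2 * Complex.I * (t : ℂ)‖ = 2 * t := by
      simp [abs_of_pos ht']
    have e2 : (2 * Complex.I * w * t).re = -(2 * (w.im * t)) := by simp [mul_assoc]
    rw [e1, e2, Real.exp_neg, ← div_eq_mul_inv, div_le_iff₀ (Real.exp_pos _)]
    have h1 := Real.add_one_le_exp (2 * (w.im * t))
    have h2 : z.im * t ≤ 2 * (w.im * t) := by nlinarith
    calc 2 * t = 2 / z.im * (z.im * t) := by field_simp
      _ ≤ _ := by gcongr; linarith
  · refine Eventually.of_forall fun t w _ => ?_
    have h3 := (((hasDerivAt_id w).const_mul (2 * Complex.I)).mul_const (t : ℂ)).cexp.mul_const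
      (f.fn t)
    refine h3.congr_deriv ?_
    simp only [id]
    ring

lemma diffContOnCl_laplace (f : X) : DiffContOnCl ℂ (laplace f) {z : ℂ | 0 < z.im} :=
  ⟨differentiableOn_laplace f, by rw [closure_upper]; exact continuousOn_laplace f⟩

end X

/-- Phragmén–Lindelöf for the right half-plane, after a rotation by `Complex.I`. -/
lemma norm_le_one_of_norm_le_one_real {F : ℂ → ℂ} (hd : DiffContOnCl ℂ F {z : ℂ | 0 < z.im})
    {C : ℝ} (hb : ∀ z : ℂ, 0 ≤ z.im → ‖F z‖ ≤ C) (h1 : ∀ x : ℝ, ‖F x‖ ≤ 1) {z : ℂ}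
    (hz : 0 ≤ z.im) : ‖F z‖ ≤ 1 := by
  have hd' : DiffContOnCl ℂ (fun w => F (Complex.I * w)) {w : ℂ | 0 < w.re} := by
    refine hd.comp (Differentiable.diffContOnCl (by fun_prop)) fun w hw => ?_
    simpa using hw
  have h := PhragmenLindelof.right_half_plane_of_bounded_on_real (C := 1) (z := -Complex.I * z) hd'
    ⟨1, by norm_num, 0, ?_⟩ ?_ ?_ (by simpa using hz)
  · simpa [← mul_assoc] using h
  · refine Asymptotics.IsBigO.of_bound C ?_
    rw [eventually_inf_principal]
    refine Eventually.of_forall fun w hw => ?_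
    have : 0 ≤ (Complex.I * w).im := by simpa using le_of_lt hw
    simpa using hb _ this
  · refine isBoundedUnder_of_eventually_le (a := C) ?_
    filter_upwards [eventually_ge_atTop 0] with x hx
    exact hb _ (by simpa using hx)
  · intro x
    have : Complex.I * (x * Complex.I) = ((-x : ℝ) : ℂ) := by
      push_cast
      linear_combination (x : ℂ) * Complex.I_sq
    rw [this]
    exact h1 _

/-- The bound by 1 applies to F and to 1/F, so |F| = 1 in the half-plane. The maximum principle
makes F constant, and the limit identifies the constant. -/
lemma eq_one_of_norm_eq_one_real {F : ℂ → ℂ} (hd : DiffContOnCl ℂ F {z : ℂ | 0 < z.im})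
    {C c : ℝ} (hb : ∀ z : ℂ, 0 ≤ z.im → ‖F z‖ ≤ C) (hc : 0 < c)
    (hb' : ∀ z : ℂ, 0 ≤ z.im → c ≤ ‖F z‖) (h1 : ∀ x : ℝ, ‖F x‖ = 1)
    (hlim : Tendsto (fun x : ℝ => F x) atTop (𝓝 1)) (x : ℝ) : F x = 1 := by
  have hne : ∀ z ∈ closure {z : ℂ | 0 < z.im}, F z ≠ 0 := fun z hz => by
    rw [closure_upper] at hz
    exact norm_pos_iff.1 (hc.trans_le (hb' z hz))
  have h2 : ∀ z : ℂ, 0 ≤ z.im → ‖F z‖ = 1 := fun z hz => by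
    refine le_antisymm (norm_le_one_of_norm_le_one_real hd hb (fun x => (h1 x).le) hz) ?_
    have h3 := norm_le_one_of_norm_le_one_real (hd.inv hne) (C := c⁻¹) (fun w hw => ?_)
      (fun x => ?_) hz
    · rw [Pi.inv_apply, norm_inv] at h3
      exact (inv_le_one₀ (hc.trans_le (hb' z hz))).1 h3
    · rw [Pi.inv_apply, norm_inv]
      exact inv_anti₀ hc (hb' w hw)
    · rw [Pi.inv_apply, norm_inv, h1, inv_one]
  have hpre : IsPreconnected {z : ℂ | 0 < z.im} := (convex_halfSpace_im_gt 0).isPreconnected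
  have hI : Complex.I ∈ {z : ℂ | 0 < z.im} := by simp
  have h3 := Complex.eqOn_of_isPreconnected_of_isMaxOn_norm hpre isOpen_upper
    hd.differentiableOn hI fun z hz => by
      simp only [mem_ofPred_eq, Function.comp_apply]
      rw [h2 z (le_of_lt hz), h2 _ (by simp)]
  have h4 : EqOn F (fun _ => F Complex.I) {z : ℂ | 0 ≤ z.im} := by
    rw [← closure_upper]
    exact h3.of_subset_closure hd.continuousOn continuousOn_const subset_closure subset_rfl
  have h5 : ∀ x : ℝ, F x = F Complex.I := fun x => h4 (by simp)
  have h6 := tendsto_nhds_unique hlim (tendsto_const_nhds.congr fun x => (h5 x).symm)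
  rw [h5, h6]

/-! ### Reflection coefficients from quotients in the algebra -/

namespace A

/-- The complex conjugate. -/
def bar (a : A) : A := algebraMap ℂ A (conj (evInf a)) + ofX (X.inv (snd a))

lemma ev_algebraMap (k : ℝ) (c : ℂ) : ev k (algebraMap ℂ A c) = c := (ev k).commutes c

lemma evInf_algebraMap (c : ℂ) : evInf (algebraMap ℂ A c) = c := evInf.commutes c

lemma ev_bar (k : ℝ) (a : A) : ev k (bar a) = conj (ev k a) := by
  rw [bar, map_add, ev_algebraMap, ev_ofX, X.hat_inv, ← map_add, ev_apply k a]

lemma evInf_bar (a : A) : evInf (bar a) = conj (evInf a) := by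
  rw [bar, map_add, evInf_algebraMap, evInf_ofX, add_zero]

lemma memXhat_ev {a : A} (h : evInf a = 0) : MemXhat fun k => ev k a := by
  simpa only [ev_apply, h, zero_add] using X.memXhat_hat (snd a)

/-- The function `k / (k + i)`. -/
def ratio : A := 1 - ofX (Complex.I • X.pole)

lemma ev_ratio (k : ℝ) : ev k ratio = k / ((k : ℂ) + Complex.I) := by
  have := X.add_I_ne_zero k
  rw [ratio, map_sub, map_one, ev_ofX, map_smul, X.hat_pole, smul_eq_mul]
  field_simp
  ring

lemma evInf_ratio : evInf ratio = 1 := by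
  rw [ratio, map_sub, map_one, evInf_ofX, sub_zero]

/-- The function `(k - i) / (k + i)`. -/
def blaschke : A := 1 - ofX ((2 * Complex.I) • X.pole)

lemma ev_blaschke (k : ℝ) : ev k blaschke = ((k : ℂ) - Complex.I) / ((k : ℂ) + Complex.I) := by
  have := X.add_I_ne_zero k
  rw [blaschke, map_sub, map_one, ev_ofX, map_smul, X.hat_pole, smul_eq_mul]
  field_simp
  ring

end A

/-- Reflection coefficients as quotients of amplitudes. -/
lemma exists_rPos {a b : A} (ha : A.evInf a = 1) (hb : A.evInf b = 0) (hne : ∀ k, A.ev k a ≠ 0)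
    (hab : ∀ k : ℝ, ‖A.ev k a‖ ^ 2 - ‖A.ev k b‖ ^ 2 = k ^ 2 / (k ^ 2 + 1))
    (sa : ∀ k, A.ev (-k) a = conj (A.ev k a)) (sb : ∀ k, A.ev (-k) b = conj (A.ev k b))
    (h0 : A.ev 0 b = -A.ev 0 a) : ∃ r : RPos, (∀ k, r k = A.ev k b / A.ev k a) ∧
      ∀ k, (k ^ 2 + 1) * rTilde r k * ‖A.ev k a‖ ^ 2 = 1 := by
  -- Wiener's lemma makes the denominator invertible in the algebra, so the quotient stays in X̂.
  obtain ⟨c, hc⟩ := (A.isUnit_of_ev_ne_zero (by rw [ha]; exact one_ne_zero) hne).exists_right_inv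
  have hck : ∀ k, A.ev k c = (A.ev k a)⁻¹ := fun k => by
    have := congrArg (A.ev k) hc
    rw [map_mul, map_one] at this
    exact eq_inv_of_mul_eq_one_right this
  have hnorm : ∀ k : ℝ, (1 - ‖A.ev k b / A.ev k a‖ ^ 2) =
      k ^ 2 * ((k ^ 2 + 1) * ‖A.ev k a‖ ^ 2)⁻¹ := fun k => by
    have h1 := hab k
    have h2 : ‖A.ev k a‖ ≠ 0 := norm_ne_zero_iff.2 (hne k)
    have h3 : k ^ 2 + 1 ≠ 0 := by positivity
    rw [norm_div]
    field_simp
    field_simp at h1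
    linarith
  have hcont : Continuous fun k : ℝ => ((k ^ 2 + 1) * ‖A.ev k a‖ ^ 2)⁻¹ := by
    refine Continuous.inv₀ (by have := A.continuous_ev_apply a; fun_prop) fun k => ?_
    have h2 : ‖A.ev k a‖ ≠ 0 := norm_ne_zero_iff.2 (hne k)
    positivity
  have hpos : ∀ k : ℝ, 0 < ((k ^ 2 + 1) * ‖A.ev k a‖ ^ 2)⁻¹ := fun k => by
    have h2 : 0 < ‖A.ev k a‖ := norm_pos_iff.2 (hne k)
    positivity
  have htilde : rTilde (fun k => A.ev k b / A.ev k a) =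
      fun k => ((k ^ 2 + 1) * ‖A.ev k a‖ ^ 2)⁻¹ := by
    have hq : ∀ k : ℝ, k ≠ 0 → (1 - ‖A.ev k b / A.ev k a‖ ^ 2) / k ^ 2 =
        ((k ^ 2 + 1) * ‖A.ev k a‖ ^ 2)⁻¹ := fun k hk => by
      rw [hnorm k]
      field_simp
    funext k
    rcases eq_or_ne k 0 with rfl | hk
    · rw [rTilde, Function.update_self]
      refine Tendsto.limUnder_eq ?_
      refine ((hcont.tendsto 0).mono_left nhdsWithin_le_nhds).congr' ?_
      filter_upwards [self_mem_nhdsWithin] with k hk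
      exact (hq k hk).symm
    · rw [rTilde_of_ne hk, hq k hk]
  refine ⟨⟨fun k => A.ev k b / A.ev k a, ⟨?_, fun k => ?_, fun k hk => ?_⟩, ?_, ?_, ?_⟩,
    fun k => rfl, fun k => ?_⟩
  · have h := A.memXhat_ev (a := b * c) (by rw [map_mul, hb, zero_mul])
    simpa only [map_mul, hck, ← div_eq_mul_inv] using h
  · rw [sa, sb, map_div₀]
  · have h1 := hnorm k
    have h2 := mul_pos (pow_pos (abs_pos.2 hk) 2) (hpos k)
    rw [sq_abs, ← h1] at h2
    refine (sq_lt_one_iff₀ (norm_nonneg _)).1 (by linarith)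
  · rw [h0, neg_div, div_self (hne 0)]
  · rw [htilde]
    -- By the determinant identity r̃ = 1 / ((k² + 1)|a|²), the product of 1 / (k + i), 1 / a and
    -- their conjugates.
    have h := A.memXhat_ev (a := A.ofX (X.pole * X.inv X.pole) * (c * A.bar c)) (by
      rw [map_mul, A.evInf_ofX, zero_mul])
    have e : (fun k => A.ev k (A.ofX (X.pole * X.inv X.pole) * (c * A.bar c))) =
        fun k : ℝ => ((((k ^ 2 + 1) * ‖A.ev k a‖ ^ 2)⁻¹ : ℝ) : ℂ) := by
      funext k
      rw [map_mul, map_mul, A.ev_ofX, A.ev_bar, X.hat_mul, X.hat_inv, X.hat_pole, hck,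
        Complex.mul_conj, Complex.mul_conj, ← Complex.ofReal_mul, map_inv₀, map_inv₀,
        Complex.normSq_eq_norm_sq (A.ev k a), mul_inv]
      congr 3
      simp [Complex.normSq_apply]
      ring
    rwa [e] at h
  · rw [htilde]
    exact hpos 0
  · simp only [htilde]
    rw [mul_right_comm]
    exact mul_inv_cancel₀ (fun h => (hpos k).ne' (by rw [h, inv_zero]))

/-! ### Amplitudes -/

/-- The functions `1 + laplace f` and `laplace g` are the values at `0` of a Jost pair. -/
structure IsAmplitude (f g : X) : Prop where
  one_le : ∀ z : ℂ, 0 ≤ z.im → 1 ≤ ‖1 + X.laplace f z‖ ^ 2 - ‖X.laplace g z‖ ^ 2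
  mul_conj_sub : ∀ k : ℝ, (1 + X.laplace f k) * conj (1 + X.laplace f k) -
    X.laplace g k * conj (X.laplace g k) = 1
  conj_fst : ∀ k : ℝ, X.laplace f ((-k : ℝ) : ℂ) = conj (X.laplace f k)
  conj_snd : ∀ k : ℝ, X.laplace g ((-k : ℝ) : ℂ) = conj (X.laplace g k)

/-- The symmetry in k holds because the conjugate of a Jost pair at k is the unique Jost pair at -k.
-/
lemma exists_isAmplitude {u : ℝ → ℝ} (h2 : MemLp u 2 volume) (h1 : ∀ x, IntegrableOn u (Ioi x)) :
    ∃ f g : X, IsAmplitude f g ∧ ∀ k : ℝ, ∃ p m, IsJostPair u (k : ℂ) p m ∧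
      p 0 = 1 + X.laplace f k ∧ m 0 = X.laplace g k := by
  obtain ⟨f, g, h⟩ := exists_isJostPair h2 h1
  have h' : ∀ k : ℝ, ∃ p m, IsJostPair u (k : ℂ) p m ∧
      p 0 = 1 + X.laplace f k ∧ m 0 = X.laplace g k := fun k => by
    obtain ⟨p, m, hp, e1, e2⟩ := h k (by simp)
    exact ⟨p, m, hp, by rw [e1, X.laplace_eq], by rw [e2, X.laplace_eq]⟩
  have hc : ∀ k : ℝ, X.laplace f ((-k : ℝ) : ℂ) = conj (X.laplace f k) ∧
      X.laplace g ((-k : ℝ) : ℂ) = conj (X.laplace g k) := fun k => by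
    obtain ⟨p, m, hp, e1, e2⟩ := h' k
    obtain ⟨p', m', hp', e3, e4⟩ := h' (-k)
    have h5 := hp'.unique hp.conjugate 0
    rw [e1, e2, e3, e4, map_add, map_one] at h5
    exact ⟨add_left_cancel h5.1, h5.2⟩
  refine ⟨f, g, ⟨fun z hz => ?_, fun k => ?_, fun k => (hc k).1, fun k => (hc k).2⟩, h'⟩
  · obtain ⟨p, m, hp, e1, e2⟩ := h z hz
    rw [X.laplace_eq f hz, X.laplace_eq g hz, ← e1, ← e2]
    exact hp.one_le hz 0
  · obtain ⟨p, m, hp, e1, e2⟩ := h' k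
    rw [← e1, ← e2]
    exact hp.mul_conj_sub hp 0

/-! ### The scattering amplitudes -/

/-- The function `k a(k)` for the amplitudes of the two Jost solutions. -/
def scatA (v : ℝ) (f g f' g' : X) (z : ℂ) : ℂ :=
  z * ((1 + X.laplace f z) * (1 + X.laplace f' z) - X.laplace g z * X.laplace g' z) +
    v / (2 * Complex.I) * (1 + X.laplace f z + X.laplace g z) * (1 + X.laplace f' z + X.laplace g' z)

/-- The function `k b(k)` for the amplitudes of the two Jost solutions. -/
def scatB (v : ℝ) (f g f' g' : X) (k : ℝ) : ℂ :=
  k * (X.laplace g k * conj (1 + X.laplace f' k) - (1 + X.laplace f k) * conj (X.laplace g' k)) -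
    v / (2 * Complex.I) * (1 + X.laplace f k + X.laplace g k) *
      conj (1 + X.laplace f' k + X.laplace g' k)

section

variable {f g f' g' : X} {v : ℝ}

/-- The element of the algebra for `k a(k) / (k + i)`. -/
def ampA (v : ℝ) (f g f' g' : X) : A :=
  A.ratio * ((1 + A.ofX f.plus) * (1 + A.ofX f'.plus) - A.ofX g.plus * A.ofX g'.plus) +
    A.ofX ((v / (2 * Complex.I) : ℂ) • X.pole) * (1 + A.ofX f.plus + A.ofX g.plus) *
      (1 + A.ofX f'.plus + A.ofX g'.plus)

/-- The element of the algebra for `k b(k) / (k + i)`. -/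
def ampB (v : ℝ) (f g f' g' : X) : A :=
  A.ratio * (A.ofX g.plus * A.bar (1 + A.ofX f'.plus) -
    (1 + A.ofX f.plus) * A.bar (A.ofX g'.plus)) -
    A.ofX ((v / (2 * Complex.I) : ℂ) • X.pole) * (1 + A.ofX f.plus + A.ofX g.plus) *
      A.bar (1 + A.ofX f'.plus + A.ofX g'.plus)

lemma ev_ampA (k : ℝ) : A.ev k (ampA v f g f' g') = scatA v f g f' g' k / (k + Complex.I) := by
  simp only [ampA, scatA, map_add, map_sub, map_mul, map_one, A.ev_ofX, A.ev_ratio, map_smul,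
    X.hat_pole, X.laplace_ofReal, smul_eq_mul]
  ring

lemma ev_ampB (k : ℝ) : A.ev k (ampB v f g f' g') = scatB v f g f' g' k / (k + Complex.I) := by
  simp only [ampB, scatB, map_add, map_sub, map_mul, map_one, A.ev_ofX, A.ev_ratio, map_smul,
    X.hat_pole, X.laplace_ofReal, smul_eq_mul, A.ev_bar]
  ring

lemma evInf_ampA : A.evInf (ampA v f g f' g') = 1 := by
  simp [ampA, A.evInf_ofX, A.evInf_ratio]

lemma evInf_ampB : A.evInf (ampB v f g f' g') = 0 := by
  simp [ampB, A.evInf_ofX, A.evInf_ratio, A.evInf_bar]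

lemma conj_div_two_I (v : ℝ) : conj ((v : ℂ) / (2 * Complex.I)) = -((v : ℂ) / (2 * Complex.I)) := by
  rw [map_div₀, map_mul, Complex.conj_ofReal, Complex.conj_I, Complex.conj_ofNat, mul_neg, div_neg]

lemma IsAmplitude.scatA_neg (h : IsAmplitude f g) (h' : IsAmplitude f' g') (k : ℝ) :
    scatA v f g f' g' ((-k : ℝ) : ℂ) = -conj (scatA v f g f' g' k) := by
  simp only [scatA, h.conj_fst, h.conj_snd, h'.conj_fst, h'.conj_snd]
  simp only [map_add, map_sub, map_mul, map_one, Complex.conj_ofReal, conj_div_two_I,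
    Complex.ofReal_neg]
  ring

lemma IsAmplitude.scatB_neg (h : IsAmplitude f g) (h' : IsAmplitude f' g') (k : ℝ) :
    scatB v f g f' g' (-k) = -conj (scatB v f g f' g' k) := by
  simp only [scatB, h.conj_fst, h.conj_snd, h'.conj_fst, h'.conj_snd]
  simp only [map_add, map_sub, map_mul, map_one, Complex.conj_ofReal, conj_div_two_I,
    Complex.ofReal_neg, Complex.conj_conj]
  ring

lemma conj_add_I (k : ℝ) : conj ((k : ℂ) + Complex.I) = k - Complex.I := by
  rw [map_add, Complex.conj_ofReal, Complex.conj_I, sub_eq_add_neg]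

lemma neg_conj_div (c : ℂ) (k : ℝ) :
    -conj c / (((-k : ℝ) : ℂ) + Complex.I) = conj (c / (k + Complex.I)) := by
  rw [map_div₀, conj_add_I, neg_div, ← div_neg]
  push_cast
  ring_nf

lemma IsAmplitude.ev_ampA_neg (h : IsAmplitude f g) (h' : IsAmplitude f' g') (k : ℝ) :
    A.ev (-k) (ampA v f g f' g') = conj (A.ev k (ampA v f g f' g')) := by
  rw [ev_ampA, ev_ampA, h.scatA_neg h', neg_conj_div]

lemma IsAmplitude.ev_ampB_neg (h : IsAmplitude f g) (h' : IsAmplitude f' g') (k : ℝ) :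
    A.ev (-k) (ampB v f g f' g') = conj (A.ev k (ampB v f g f' g')) := by
  rw [ev_ampB, ev_ampB, h.scatB_neg h', neg_conj_div]

/-- This is |a|² - |b|² = 1 multiplied by k². -/
lemma IsAmplitude.mul_conj_scat (h : IsAmplitude f g) (h' : IsAmplitude f' g') (k : ℝ) :
    scatA v f g f' g' k * conj (scatA v f g f' g' k) -
      scatB v f g f' g' k * conj (scatB v f g f' g' k) = k ^ 2 := by
  have h1 := h.mul_conj_sub k
  have h2 := h'.mul_conj_sub k
  simp only [scatA, scatB, map_add, map_sub, map_mul, map_one, Complex.conj_ofReal, conj_div_two_I,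
    Complex.conj_conj] at h1 h2 ⊢
  -- Values and their conjugates become independent variables, and the identity is polynomial.
  generalize X.laplace f k = a at *
  generalize X.laplace g k = b at *
  generalize X.laplace f' k = c at *
  generalize X.laplace g' k = d at *
  generalize (v : ℂ) / (2 * Complex.I) = w at *
  generalize conj a = a' at *
  generalize conj b = b' at *
  generalize conj c = c' at *
  generalize conj d = d' at *
  linear_combination (k : ℂ) ^ 2 * ((1 + c) * (1 + c') - d * d') * h1 + (k : ℂ) ^ 2 * h2

lemma IsAmplitude.norm_sq_scat (h : IsAmplitude f g) (h' : IsAmplitude f' g') (k : ℝ) :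
    ‖scatA v f g f' g' k‖ ^ 2 - ‖scatB v f g f' g' k‖ ^ 2 = k ^ 2 := by
  have := h.mul_conj_scat h' (v := v) k
  rw [Complex.mul_conj, Complex.mul_conj, Complex.normSq_eq_norm_sq,
    Complex.normSq_eq_norm_sq] at this
  exact_mod_cast this

lemma norm_sq_add_I (k : ℝ) : ‖(k : ℂ) + Complex.I‖ ^ 2 = k ^ 2 + 1 := by
  rw [← Complex.normSq_eq_norm_sq]
  simp [Complex.normSq_apply]
  ring

lemma IsAmplitude.norm_sq_amp (h : IsAmplitude f g) (h' : IsAmplitude f' g') (k : ℝ) :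
    ‖A.ev k (ampA v f g f' g')‖ ^ 2 - ‖A.ev k (ampB v f g f' g')‖ ^ 2 = k ^ 2 / (k ^ 2 + 1) := by
  rw [ev_ampA, ev_ampB, norm_div, norm_div, div_pow, div_pow, ← sub_div, h.norm_sq_scat h',
    norm_sq_add_I]

/-! ### The lower bound in the upper half-plane -/

/-- The real part of this Cayley transform is (|a|² - |b|²) / |a + b|². For the amplitudes at 0, the
quotient is the quasi-derivative over the solution, divided by iz. -/
lemma inv_le_re_div {a b : ℂ} (h : 1 ≤ ‖a‖ ^ 2 - ‖b‖ ^ 2) :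
    a + b ≠ 0 ∧ (‖a + b‖ ^ 2)⁻¹ ≤ ((a - b) / (a + b)).re := by
  have hne : a + b ≠ 0 := fun h0 => by
    rw [eq_neg_of_add_eq_zero_left h0, norm_neg, sub_self] at h
    linarith
  refine ⟨hne, ?_⟩
  have e : ((a - b) / (a + b)).re = (‖a‖ ^ 2 - ‖b‖ ^ 2) / ‖a + b‖ ^ 2 := by
    rw [Complex.div_re, ← add_div, Complex.normSq_eq_norm_sq]
    congr 1
    rw [← Complex.normSq_eq_norm_sq, ← Complex.normSq_eq_norm_sq, Complex.normSq_apply,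
      Complex.normSq_apply]
    simp
    ring
  rw [e, inv_eq_one_div]
  gcongr

/-- With α, β and γ, δ the right and left amplitudes, `scatA` is z(α + β)(γ + δ)w. Here w is the
mean of two Cayley transforms plus v / (2iz). The last term has real part -v Im z / (2|z|²) ≥ 0,
where the sign of v enters. By `inv_le_re_div` and the arithmetic-geometric mean inequality, |w| ≥ 1
/ (|α + β||γ + δ|). -/
lemma IsAmplitude.norm_le_scatA (h : IsAmplitude f g) (h' : IsAmplitude f' g') (hv : v < 0) {z : ℂ}
    (hz : 0 ≤ z.im) : ‖z‖ ≤ ‖scatA v f g f' g' z‖ := by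
  rcases eq_or_ne z 0 with rfl | hz0
  · simp
  obtain ⟨h1, h2⟩ := inv_le_re_div (h.one_le z hz)
  obtain ⟨h3, h4⟩ := inv_le_re_div (h'.one_le z hz)
  set a := 1 + X.laplace f z
  set b := X.laplace g z
  set c := 1 + X.laplace f' z
  set d := X.laplace g' z
  set w : ℂ := ((a - b) / (a + b) + (c - d) / (c + d)) / 2 + v / (2 * Complex.I) / z
  have e : scatA v f g f' g' z = z * ((a + b) * (c + d) * w) := by
    have hI := Complex.I_ne_zero
    simp only [scatA, w]
    field_simp
    ring
  have h5 : 0 ≤ ((v : ℂ) / (2 * Complex.I) / z).re := by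
    have e2 : (v : ℂ) / (2 * Complex.I) / z = ((-v / 2 : ℝ) : ℂ) * (Complex.I * z⁻¹) := by
      have hI := Complex.I_ne_zero
      push_cast
      field_simp
      linear_combination (v : ℂ) * Complex.I_sq
    rw [e2, Complex.re_ofReal_mul]
    refine mul_nonneg (by linarith) ?_
    simp only [Complex.mul_re, Complex.I_re, zero_mul, Complex.I_im, one_mul, Complex.inv_im]
    have := Complex.normSq_nonneg z
    rw [zero_sub, ← neg_div, neg_neg]
    positivity
  have hp : 0 < ‖a + b‖ := norm_pos_iff.2 h1
  have hq : 0 < ‖c + d‖ := norm_pos_iff.2 h3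
  have h6 : 1 ≤ ‖a + b‖ * ‖c + d‖ * ‖w‖ := by
    have h7 : ((‖a + b‖ ^ 2)⁻¹ + (‖c + d‖ ^ 2)⁻¹) / 2 ≤ ‖w‖ := by
      refine le_trans ?_ (Complex.re_le_norm w)
      have e3 : w.re = (((a - b) / (a + b)).re + ((c - d) / (c + d)).re) / 2 +
          ((v : ℂ) / (2 * Complex.I) / z).re := by
        simp only [w, Complex.add_re, Complex.div_ofNat_re]
      rw [e3]
      linarith
    refine le_trans ?_ (mul_le_mul_of_nonneg_left h7 (by positivity))
    have h8 := sq_nonneg (‖a + b‖ - ‖c + d‖)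
    field_simp
    linarith
  rw [e, norm_mul, norm_mul, norm_mul]
  exact le_mul_of_one_le_right (norm_nonneg _) h6

/-- The lower bound is empty at z = 0; there the term with v alone survives. -/
lemma IsAmplitude.scatA_ne_zero (h : IsAmplitude f g) (h' : IsAmplitude f' g') (hv : v < 0) {z : ℂ}
    (hz : 0 ≤ z.im) : scatA v f g f' g' z ≠ 0 := by
  rcases eq_or_ne z 0 with rfl | hz0
  · have h1 := (inv_le_re_div (h.one_le 0 hz)).1
    have h2 := (inv_le_re_div (h'.one_le 0 hz)).1
    rw [scatA, zero_mul, zero_add]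
    refine mul_ne_zero (mul_ne_zero (div_ne_zero ?_ ?_) h1) h2
    · exact_mod_cast hv.ne
    · simp [Complex.I_ne_zero]
  · exact norm_pos_iff.1 ((norm_pos_iff.2 hz0).trans_le (h.norm_le_scatA h' hv hz))

lemma IsAmplitude.ev_ampA_ne_zero (h : IsAmplitude f g) (h' : IsAmplitude f' g') (hv : v < 0)
    (k : ℝ) : A.ev k (ampA v f g f' g') ≠ 0 := by
  rw [ev_ampA]
  exact div_ne_zero (h.scatA_ne_zero h' hv (by simp)) (X.add_I_ne_zero k)

/-- At k = 0 the amplitudes are real. This gives the value -1 of the reflection coefficients. -/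
lemma IsAmplitude.scatB_zero (h' : IsAmplitude f' g') :
    scatB v f g f' g' 0 = -scatA v f g f' g' 0 := by
  have h1 := h'.conj_fst 0
  have h2 := h'.conj_snd 0
  rw [neg_zero, Complex.ofReal_zero] at h1 h2
  simp only [scatA, scatB, map_add, map_one, ← h1, ← h2, Complex.ofReal_zero]
  ring

/-! ### The transmission coefficient -/

lemma diffContOnCl_scatA : DiffContOnCl ℂ (scatA v f g f' g') {z : ℂ | 0 < z.im} := by
  have hz : DiffContOnCl ℂ (fun z : ℂ => z) {z : ℂ | 0 < z.im} :=
    Differentiable.diffContOnCl differentiable_id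
  have e : ∀ f : X, DiffContOnCl ℂ (fun z => X.laplace f z) {z : ℂ | 0 < z.im} :=
    X.diffContOnCl_laplace
  have e1 : ∀ f : X, DiffContOnCl ℂ (fun z => 1 + X.laplace f z) {z : ℂ | 0 < z.im} :=
    fun f => (e f).const_add 1
  exact (hz.smul (((e1 f).smul (e1 f')).sub ((e g).smul (e g')))).add
    (((((e1 f).add (e g))).const_smul (v / (2 * Complex.I) : ℂ)).smul ((e1 f').add (e g')))

lemma add_I_ne_zero_of_im {z : ℂ} (hz : 0 ≤ z.im) : z + Complex.I ≠ 0 := fun h => by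
  have := congrArg Complex.im h
  simp at this
  linarith

lemma one_le_norm_add_I {z : ℂ} (hz : 0 ≤ z.im) : 1 ≤ ‖z + Complex.I‖ := by
  have h := Complex.abs_im_le_norm (z + Complex.I)
  rw [Complex.add_im, Complex.I_im, abs_of_nonneg (by linarith)] at h
  linarith

lemma norm_le_norm_add_I {z : ℂ} (hz : 0 ≤ z.im) : ‖z‖ ≤ ‖z + Complex.I‖ := by
  refine le_of_sq_le_sq ?_ (norm_nonneg _)
  rw [← Complex.normSq_eq_norm_sq, ← Complex.normSq_eq_norm_sq, Complex.normSq_apply,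
    Complex.normSq_apply]
  simp
  nlinarith

lemma exists_norm_scatA_le : ∃ C, ∀ z : ℂ, 0 ≤ z.im →
    ‖scatA v f g f' g' z / (z + Complex.I)‖ ≤ C := by
  refine ⟨((1 + ‖f‖) * (1 + ‖f'‖) + ‖g‖ * ‖g'‖) +
    ‖(v : ℂ) / (2 * Complex.I)‖ * (1 + ‖f‖ + ‖g‖) * (1 + ‖f'‖ + ‖g'‖), fun z hz => ?_⟩
  have h0 := one_le_norm_add_I hz
  have h1 := norm_le_norm_add_I hz
  have hf := X.norm_laplace_le f hz
  have hg := X.norm_laplace_le g hz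
  have hf' := X.norm_laplace_le f' hz
  have hg' := X.norm_laplace_le g' hz
  have h2 : ∀ f : X, ‖X.laplace f z‖ ≤ ‖f‖ → ‖1 + X.laplace f z‖ ≤ 1 + ‖f‖ := fun f hf =>
    (norm_add_le _ _).trans (by simpa using hf)
  have h3 : ∀ f g : X, ‖X.laplace f z‖ ≤ ‖f‖ → ‖X.laplace g z‖ ≤ ‖g‖ →
      ‖1 + X.laplace f z + X.laplace g z‖ ≤ 1 + ‖f‖ + ‖g‖ := fun f g hf hg =>
    (norm_add_le _ _).trans (add_le_add (h2 f hf) hg)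
  rw [norm_div, div_le_iff₀ (by linarith), add_mul]
  refine (norm_add_le _ _).trans (add_le_add ?_ ?_)
  · rw [norm_mul, mul_comm]
    refine mul_le_mul ?_ h1 (norm_nonneg _) (by positivity)
    refine (norm_sub_le _ _).trans (add_le_add ?_ ?_)
    · rw [norm_mul]
      exact mul_le_mul (h2 f hf) (h2 f' hf') (norm_nonneg _) (by positivity)
    · rw [norm_mul]
      exact mul_le_mul hg hg' (norm_nonneg _) (norm_nonneg _)
  · refine le_trans ?_ (le_mul_of_one_le_right (by positivity) h0)
    rw [norm_mul, norm_mul]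
    exact mul_le_mul (mul_le_mul_of_nonneg_left (h3 f g hf hg) (norm_nonneg _)) (h3 f' g' hf' hg')
      (norm_nonneg _) (by positivity)

/-- Compactness on the closed unit half-disc, where there are no zeros. Outside it |`scatA` z| ≥ |z|
and |z + i| ≤ 2|z|. -/
lemma IsAmplitude.exists_le_norm_scatA (h : IsAmplitude f g) (h' : IsAmplitude f' g')
    (hv : v < 0) : ∃ c > 0, ∀ z : ℂ, 0 ≤ z.im →
    c ≤ ‖scatA v f g f' g' z / (z + Complex.I)‖ := by
  set K : Set ℂ := Metric.closedBall 0 1 ∩ {z : ℂ | 0 ≤ z.im}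
  have hK : IsCompact K := (isCompact_closedBall _ _).inter_right
    (isClosed_le continuous_const Complex.continuous_im)
  have hc : ContinuousOn (fun z => ‖scatA v f g f' g' z / (z + Complex.I)‖) K := by
    have h1 := (diffContOnCl_scatA (v := v) (f := f) (g := g) (f' := f') (g' := g')).continuousOn
    rw [closure_upper] at h1
    exact ((h1.mono inter_subset_right).div (by fun_prop)
      fun z hz => add_I_ne_zero_of_im hz.2).norm
  obtain ⟨z₀, hz₀, hmin⟩ := hK.exists_isMinOn ⟨0, by simp [K]⟩ hc
  set c := ‖scatA v f g f' g' z₀ / (z₀ + Complex.I)‖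
  have hc0 : 0 < c :=
    norm_pos_iff.2 (div_ne_zero (h.scatA_ne_zero h' hv hz₀.2) (add_I_ne_zero_of_im hz₀.2))
  refine ⟨min c (1 / 2), lt_min hc0 (by norm_num), fun z hz => ?_⟩
  rcases le_or_gt ‖z‖ 1 with h1 | h1
  · exact (min_le_left _ _).trans (hmin ⟨by simpa using h1, hz⟩)
  · refine (min_le_right _ _).trans ?_
    have h2 := h.norm_le_scatA h' hv hz
    have h3 : ‖z + Complex.I‖ ≤ ‖z‖ + 1 := (norm_add_le _ _).trans (by simp)
    have h4 := one_le_norm_add_I hz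
    rw [norm_div, le_div_iff₀ (by linarith)]
    linarith

/-- The transmission coefficient is the inverse of `a`. -/
lemma IsAmplitude.tTilde_mul (h : IsAmplitude f g) (h' : IsAmplitude f' g') (hv : v < 0)
    {r : RPos} (hr : ∀ k : ℝ, (k ^ 2 + 1) * rTilde r k * ‖A.ev k (ampA v f g f' g')‖ ^ 2 = 1)
    (k : ℝ) : tTilde r k * A.ev k (ampA v f g f' g') = 1 := by
  set l := r.logCoef
  -- The exponential extends t̃ holomorphically and is bounded above and below. So `F` has to be
  -- identified as 1 from its modulus on the line and its limit.
  set F : ℂ → ℂ := fun z => Complex.exp (X.laplace l z) * (scatA v f g f' g' z / (z + Complex.I))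
  have hF : ∀ k : ℝ, F k = tTilde r k * A.ev k (ampA v f g f' g') := fun k => by
    simp only [F, X.laplace_ofReal, RPos.tTilde_eq, RPos.logTrans, ev_ampA, l]
  rw [← hF]
  obtain ⟨C, hC⟩ := exists_norm_scatA_le (v := v) (f := f) (g := g) (f' := f') (g' := g')
  obtain ⟨c, hc0, hc⟩ := h.exists_le_norm_scatA h' hv
  have hre : ∀ z : ℂ, 0 ≤ z.im → |(X.laplace l z).re| ≤ ‖l‖ := fun z hz =>
    (Complex.abs_re_le_norm _).trans (X.norm_laplace_le l hz)
  refine eq_one_of_norm_eq_one_real (C := Real.exp ‖l‖ * C) (c := Real.exp (-‖l‖) * c) ?_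
    (fun z hz => ?_) (by positivity) (fun z hz => ?_) (fun x => ?_) ?_ k
  · have h1 : DiffContOnCl ℂ (fun z => Complex.exp (X.laplace l z)) {z : ℂ | 0 < z.im} :=
      (Complex.differentiable_exp.comp_diffContOnCl (X.diffContOnCl_laplace l))
    have h2 : DiffContOnCl ℂ (fun z : ℂ => z + Complex.I) {z : ℂ | 0 < z.im} :=
      Differentiable.diffContOnCl (by fun_prop)
    have h3 := h2.inv fun z hz => by
      rw [closure_upper] at hz
      exact add_I_ne_zero_of_im hz
    have h4 := h1.smul ((diffContOnCl_scatA (v := v) (f := f) (g := g) (f' := f') (g' := g')).smul h3)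
    simpa only [F, smul_eq_mul, Pi.inv_apply, ← div_eq_mul_inv] using h4
  · simp only [F]
    rw [norm_mul, Complex.norm_exp]
    have h1 := (le_abs_self _).trans (hre z hz)
    have h2 := hC z hz
    gcongr
  · simp only [F]
    rw [norm_mul, Complex.norm_exp]
    have h1 := neg_le_of_abs_le (hre z hz)
    have h2 := hc z hz
    gcongr
  · have h1 := hr x
    rw [← RPos.norm_tTilde_sq, ← mul_pow, ← norm_mul, ← hF] at h1
    exact (pow_eq_one_iff_of_nonneg (norm_nonneg _) two_ne_zero).1 h1
  · have h1 : Tendsto (fun k : ℝ => Complex.exp (X.hat k r.logTrans)) atTop (𝓝 1) := by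
      have h2 := (X.tendsto_hat_cocompact r.logTrans).mono_left atTop_le_cocompact
      have h3 := (Complex.continuous_exp.tendsto 0).comp h2
      rw [Complex.exp_zero] at h3
      exact h3
    have h2 := (A.tendsto_ev (ampA v f g f' g')).mono_left atTop_le_cocompact
    rw [evInf_ampA] at h2
    have h3 := h1.mul h2
    rw [one_mul] at h3
    refine h3.congr fun k => ?_
    rw [hF, RPos.tTilde_eq]

end

/-! ### The two reflection coefficients -/

/-- Both coefficients are quotients with the denominator `ampA`, so both have the transmission
coefficient k / `scatA` k. -/
lemma IsAmplitude.exists_reflection {f g f' g' : X} {v : ℝ} (h : IsAmplitude f g)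
    (h' : IsAmplitude f' g') (hv : v < 0) : ∃ rPlus rMinus : RPos,
    (∀ k : ℝ, rPlus k = scatB v f g f' g' (-k) / scatA v f g f' g' k) ∧
    (∀ k : ℝ, rMinus k = scatB v f g f' g' k / scatA v f g f' g' k) ∧
    rPlus.dual = rMinus := by
  have h0 : A.ev 0 (ampB v f g f' g') = -A.ev 0 (ampA v f g f' g') := by
    rw [ev_ampA, ev_ampB, h'.scatB_zero, Complex.ofReal_zero, neg_div]
  -- Conjugating `ampB` changes its denominator to k - i; the factor (k - i) / (k + i) restores k +
  -- i.
  have hb : ∀ k : ℝ, A.ev k (-(A.bar (ampB v f g f' g') * A.blaschke)) =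
      scatB v f g f' g' (-k) / (k + Complex.I) := fun k => by
    have h1 := X.sub_I_ne_zero k
    rw [map_neg, map_mul, A.ev_bar, A.ev_blaschke, ev_ampB, map_div₀, conj_add_I,
      h.scatB_neg h', div_mul_div_cancel₀ h1, neg_div]
  obtain ⟨rMinus, h1, h2⟩ := exists_rPos evInf_ampA evInf_ampB (h.ev_ampA_ne_zero h' hv)
    (h.norm_sq_amp h') (h.ev_ampA_neg h') (h.ev_ampB_neg h') h0
  obtain ⟨rPlus, h3, h4⟩ := exists_rPos (b := -(A.bar (ampB v f g f' g') * A.blaschke))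
    evInf_ampA (by rw [map_neg, map_mul, A.evInf_bar, evInf_ampB, map_zero, zero_mul, neg_zero])
    (h.ev_ampA_ne_zero h' hv)
    (fun k => by
      rw [← h.norm_sq_amp h' k, hb, ev_ampB, norm_div, norm_div, h.scatB_neg h', norm_neg,
        RCLike.norm_conj])
    (h.ev_ampA_neg h')
    (fun k => by
      rw [hb, hb, h.scatB_neg h', neg_conj_div])
    (by rw [hb, neg_zero, ← h0, ev_ampB])
  have hdiv : ∀ (c : ℂ) (k : ℝ), c / (k + Complex.I) /
      (scatA v f g f' g' k / (k + Complex.I)) = c / scatA v f g f' g' k := fun c k =>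
    div_div_div_cancel_right₀ (X.add_I_ne_zero k) _ _
  simp only [hb, ev_ampA, ev_ampB, hdiv] at h1 h3
  refine ⟨rPlus, rMinus, h3, h1, RPos.ext_of_ne fun k hk => ?_⟩
  have hk' : (k : ℂ) ≠ 0 := by exact_mod_cast hk
  have hA : ∀ k : ℝ, scatA v f g f' g' k ≠ 0 := fun k => h.scatA_ne_zero h' hv (by simp)
  have ht : ∀ k : ℝ, transmission rPlus k = k / scatA v f g f' g' k := fun k => by
    have h5 := h.tTilde_mul h' hv h4 k
    have h6 := X.add_I_ne_zero k
    have h7 := hA k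
    rw [ev_ampA] at h5
    rw [transmission]
    rw [div_eq_div_iff h6 h7]
    field_simp at h5
    linear_combination (k : ℂ) * h5
  have h5 := hA k
  have h6 := hA (-k)
  rw [RPos.dual_of_ne _ hk, ht, ht, h3, h1, neg_neg]
  push_cast at h6 ⊢
  field_simp

/-! ### Scattering data -/

lemma integrableOn_Ioi_of_locallyIntegrable {u : ℝ → ℝ} (h : LocallyIntegrable u volume)
    (h0 : IntegrableOn u (Ioi 0)) (x : ℝ) : IntegrableOn u (Ioi x) := by
  refine (((h.integrableOn_isCompact (isCompact_Icc (a := x) (b := 0))).union h0)).mono_set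
    fun t ht => ?_
  rcases le_or_gt t 0 with h1 | h1
  · exact Or.inl ⟨le_of_lt ht, h1⟩
  · exact Or.inr h1

section Coefficients

variable {k α β γ δ γ' δ' a b c : ℂ}

/-- α, β are the right amplitudes, γ, δ the left ones, γ', δ' the conjugates of the latter, and 2ic
= v. The hypotheses `h1` and `h2` match solutions and quasi-derivatives at 0; `h` normalizes the
determinant of this linear system. -/
lemma coefficients_eq (h : γ * γ' - δ * δ' = 1) (h1 : α + β = a * (γ' + δ') + b * (γ + δ))
    (h2 : Complex.I * k * (α - β) + 2 * Complex.I * c * (α + β) =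
      a * (Complex.I * k * (γ' - δ')) + b * -(Complex.I * k * (γ - δ))) :
    k * a = k * (α * γ - β * δ) + c * (α + β) * (γ + δ) ∧
    k * b = k * (β * γ' - α * δ') - c * (α + β) * (γ' + δ') := by
  have hI : 2 * Complex.I ≠ 0 := by simp [Complex.I_ne_zero]
  constructor
  · refine mul_left_cancel₀ hI ?_
    linear_combination -(Complex.I * k * (γ - δ)) * h1 - (γ + δ) * h2 - 2 * Complex.I * k * a * h
  · refine mul_left_cancel₀ hI ?_
    linear_combination -(Complex.I * k * (γ' - δ')) * h1 + (γ' + δ') * h2 -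
      2 * Complex.I * k * b * h

lemma eq_of_coefficients (hk : k ≠ 0) (h : γ * γ' - δ * δ' = 1)
    (ha : k * a = k * (α * γ - β * δ) + c * (α + β) * (γ + δ))
    (hb : k * b = k * (β * γ' - α * δ') - c * (α + β) * (γ' + δ')) :
    α + β = a * (γ' + δ') + b * (γ + δ) ∧
    Complex.I * k * (α - β) + 2 * Complex.I * c * (α + β) =
      a * (Complex.I * k * (γ' - δ')) + b * -(Complex.I * k * (γ - δ)) := by
  constructor
  · refine mul_left_cancel₀ hk ?_
    linear_combination -(γ' + δ') * ha - (γ + δ) * hb - k * (α + β) * h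
  · linear_combination -(Complex.I * (γ' - δ')) * ha + (Complex.I * (γ - δ)) * hb -
      (Complex.I * k * (α - β) + 2 * Complex.I * c * (α + β)) * h

end Coefficients

/-- The connection between the scattering data and the amplitudes of the Jost solutions. -/
lemma IsSystem.relation_iff {u : ℝ → ℝ} {k v : ℝ} (hk : k ≠ 0) {F φ G₁ ψ₁ G₂ ψ₂ : ℝ → ℂ}
    (hF : IsSystem u k F φ) (h₁ : IsSystem u k G₁ ψ₁) (h₂ : IsSystem u k G₂ ψ₂) {f g f' g' : X}
    (h' : IsAmplitude f' g') (F0 : F 0 = 1 + X.laplace f k + X.laplace g k)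
    (φ0 : φ 0 = Complex.I * k * (1 + X.laplace f k - X.laplace g k) +
      v * (1 + X.laplace f k + X.laplace g k))
    (G₁0 : G₁ 0 = 1 + X.laplace f' k + X.laplace g' k)
    (ψ₁0 : ψ₁ 0 = -(Complex.I * k * (1 + X.laplace f' k - X.laplace g' k)))
    (G₂0 : G₂ 0 = conj (1 + X.laplace f' k) + conj (X.laplace g' k))
    (ψ₂0 : ψ₂ 0 = Complex.I * k * (conj (1 + X.laplace f' k) - conj (X.laplace g' k)))
    (a b : ℂ) : (∀ x, F x = a * G₂ x + b * G₁ x) ↔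
      k * a = scatA v f g f' g' k ∧ k * b = scatB v f g f' g' k := by
  have hk' : (k : ℂ) ≠ 0 := by exact_mod_cast hk
  have hI := Complex.I_ne_zero
  have hc := h'.mul_conj_sub k
  have hv : (v : ℂ) = 2 * Complex.I * (v / (2 * Complex.I)) := by field_simp
  rw [hv] at φ0
  have hS := h₂.combine h₁ a b
  simp only [scatA, scatB, map_add conj (1 + X.laplace f' k)]
  constructor
  · intro h
    have e : F = fun x => a * G₂ x + b * G₁ x := funext h
    -- Equality of the solutions already forces equality of the quasi-derivatives.
    have e2 := hF.snd_unique (by rw [e]; exact hS)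
    have h3 := h 0
    have h4 := congrFun e2 0
    rw [F0, G₁0, G₂0] at h3
    rw [φ0, ψ₁0, ψ₂0] at h4
    exact coefficients_eq hc h3 h4
  · rintro ⟨ha, hb⟩ x
    obtain ⟨h3, h4⟩ := eq_of_coefficients hk' hc ha hb
    have hD := hF.combine hS 1 (-1)
    have h5 := hD.eq_zero_of_wronskian h₁ h₂ ?_ ?_ ?_ x
    · linear_combination h5
    · rw [G₁0, ψ₁0, G₂0, ψ₂0]
      have e : (1 + X.laplace f' k + X.laplace g' k) *
          (Complex.I * k * (conj (1 + X.laplace f' k) - conj (X.laplace g' k))) -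
          -(Complex.I * k * (1 + X.laplace f' k - X.laplace g' k)) *
          (conj (1 + X.laplace f' k) + conj (X.laplace g' k)) = 2 * Complex.I * k := by
        linear_combination (2 * Complex.I * k) * hc
      rw [e]
      simp [hI, hk']
    · rw [F0, G₁0, G₂0]
      linear_combination h3
    · rw [φ0, ψ₁0, ψ₂0]
      linear_combination h4

/-- The scattering data of a generic potential in terms of amplitudes. -/
lemma IsGenericMiura.exists_amplitude {q : 𝓓'((⊤ : TopologicalSpace.Opens ℝ), ℝ)}
    (hq : IsGenericMiura q) : ∃ (f g f' g' : X) (v : ℝ), IsAmplitude f g ∧ IsAmplitude f' g' ∧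
      v < 0 ∧ (∃ (fPlus fMinus : ℝ → ℝ → ℂ) (a b : ℝ → ℂ),
        IsScatteringData q fPlus fMinus a b) ∧
      ∀ (fPlus fMinus : ℝ → ℝ → ℂ) (a b : ℝ → ℂ), IsScatteringData q fPlus fMinus a b →
        ∀ k : ℝ, k ≠ 0 → k * a k = scatA v f g f' g' k ∧ k * b k = scatB v f g f' g' k := by
  obtain ⟨-, uP, uM, lP, iP, rP, lM, iM, rM, hne⟩ := hq
  have locP := MemL2loc.of_memLp lP
  have locM := MemL2loc.of_memLp lM
  have intP : LocallyIntegrable uP volume := lP.locallyIntegrable one_le_two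
  have intM : LocallyIntegrable uM volume := lM.locallyIntegrable one_le_two
  obtain ⟨v, hv, hvae⟩ := rP.exists_sub rM locP locM
  have hv0 := neg_of_riccati_difference hv hvae intP intM iP hne
  -- The left problem is reflected: -u₋(-x) is integrable on (0, ∞).
  have lN : MemLp (fun x => -uM (-x)) 2 volume :=
    (lM.comp_measurePreserving X.measurePreserving_neg).neg
  have iN : IntegrableOn (fun x => -uM (-x)) (Ioi 0) := by
    have h := (X.measurePreserving_neg.integrableOn_comp_preimage
      (Homeomorph.neg ℝ).measurableEmbedding).2 iM
    have e : (fun x : ℝ => -x) ⁻¹' Iio 0 = Ioi 0 := by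
      ext x
      simp
    rw [e] at h
    exact h.neg
  obtain ⟨f, g, hA, hPair⟩ := exists_isAmplitude lP (integrableOn_Ioi_of_locallyIntegrable intP iP)
  obtain ⟨f', g', hA', hPair'⟩ := exists_isAmplitude lN
    (integrableOn_Ioi_of_locallyIntegrable (lN.locallyIntegrable one_le_two) iN)
  choose p m hp p0 m0 using hPair
  choose p' m' hp' p0' m0' using hPair'
  have sysP : ∀ k : ℝ, IsSystem uP k
      (fun x => Complex.exp (Complex.I * k * x) * (p k x + m k x)) _ := fun k => (hp k).isSystem
  -- The right solutions are rewritten with respect to u₋, so that both sides can be matched at 0.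
  -- This is where v(0) enters.
  have sysPM := fun k : ℝ => (sysP k).switch hv hvae
  have hrefl : (fun x => -(fun x => -uM (-x)) (-x)) = uM := by
    funext x
    simp
  have sysM := fun k : ℝ => (hp' k).isSystem.reflect
  simp only [hrefl] at sysM
  -- The system depends on k only through k², so f₋(·, -k) solves it as well.
  have sysM' := fun k : ℝ => (sysM (-k)).neg
  simp only [neg_neg] at sysM'
  have hrel : ∀ k : ℝ, k ≠ 0 → ∀ a b : ℂ, _ := fun k hk a b =>
    (sysPM k).relation_iff (v := v 0) (f := f) (g := g) hk (sysM k) (sysM' k) hA'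
      (by simp [p0, m0]) (by simp [p0, m0]) (by simp [p0', m0']) (by simp [p0', m0'])
      (by simp only [p0', m0', neg_zero, Complex.ofReal_zero, mul_zero, Complex.exp_zero, one_mul,
            hA'.conj_fst, hA'.conj_snd, map_add, map_one])
      (by simp only [p0', m0', neg_zero, Complex.ofReal_zero, mul_zero, Complex.exp_zero, one_mul,
            hA'.conj_fst, hA'.conj_snd, map_add, map_one]
          push_cast
          ring) a b
  refine ⟨f, g, f', g', v 0, hA, hA', hv0, ?_, ?_⟩
  · refine ⟨fun x k => Complex.exp (Complex.I * k * x) * (p k x + m k x),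
      fun x k => Complex.exp (Complex.I * k * ((-x : ℝ) : ℂ)) * (p' k (-x) + m' k (-x)),
      fun k => scatA (v 0) f g f' g' k / k, fun k => scatB (v 0) f g f' g' k / k,
      fun k _ => (sysP k).isSchrodingerSolution rP locP, fun k _ => (hp k).tendsto_sub_exp,
      fun k _ => (sysM k).isSchrodingerSolution rM locM, fun k _ => ?_, fun k hk => ?_⟩
    · refine ((hp' k).tendsto_sub_exp.comp tendsto_neg_atBot_atTop).congr fun x => ?_
      simp
    · have hk' : (k : ℂ) ≠ 0 := by exact_mod_cast hk
      exact (hrel k hk _ _).2 ⟨mul_div_cancel₀ _ hk', mul_div_cancel₀ _ hk'⟩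
  · intro fPlus fMinus a b hd k hk
    have eP : ∀ x, fPlus x k = Complex.exp (Complex.I * k * x) * (p k x + m k x) := by
      obtain ⟨η, hη⟩ := isSystem_of_isSchrodingerSolution rP locP (hd.plus_solution k hk)
      exact (hp k).eq_of_tendsto hk hη (hd.plus_asymp k hk)
    have eM : ∀ k : ℝ, k ≠ 0 → ∀ x : ℝ, fMinus x k =
        Complex.exp (Complex.I * k * ((-x : ℝ) : ℂ)) * (p' k (-x) + m' k (-x)) := fun k hk x => by
      obtain ⟨η, hη⟩ := isSystem_of_isSchrodingerSolution rM locM (hd.minus_solution k hk)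
      have h1 := (hp' k).eq_of_tendsto hk hη.reflect (by
        refine ((hd.minus_asymp k hk).comp tendsto_neg_atTop_atBot).congr fun x => ?_
        simp) (-x)
      simpa using h1
    refine (hrel k hk _ _).1 fun x => ?_
    have h1 := hd.relation k hk x
    rw [eP, eM k hk, eM (-k) (neg_ne_zero.2 hk)] at h1
    exact h1

end MiuraScattering

end

/-! ### The proposition -/

theorem proposition3p14 :
    -- the functions `log [...]` and `t̃` are well defined for every `r` in the class
    (∀ r : RPos, MemXhat (logSymbol r) ∧ IsCauchyPlus (logSymbol r) (cauchyPlus (logSymbol r))) ∧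
    ∃ I : RPos → RPos,
      (∀ r : RPos, ∀ k : ℝ, k ≠ 0 →
        I r k = -(transmission r k / transmission r (-k)) * r (-k)) ∧
      Continuous I ∧
      Function.Involutive I ∧
      -- `I` exchanges the right and left reflection coefficients
      ∀ q : 𝓓'((⊤ : TopologicalSpace.Opens ℝ), ℝ), IsGenericMiura q →
        (∃ (fPlus fMinus : ℝ → ℝ → ℂ) (a b : ℝ → ℂ), IsScatteringData q fPlus fMinus a b) ∧
        ∀ (fPlus fMinus : ℝ → ℝ → ℂ) (a b : ℝ → ℂ), IsScatteringData q fPlus fMinus a b →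
          (∀ k, k ≠ 0 → a k ≠ 0) ∧
          ∃ rPlus rMinus : RPos,
            (∀ k, k ≠ 0 → rPlus k = -b (-k) / a k) ∧
            (∀ k, k ≠ 0 → rMinus k = b k / a k) ∧
            I rPlus = rMinus ∧ I rMinus = rPlus := by
  refine ⟨fun r => ⟨?_, r.isCauchyPlus_logSymbol⟩, RPos.dual, fun r k hk => r.dual_of_ne hk,
    RPos.continuous_dual, RPos.involutive_dual, fun q hq => ?_⟩
  · rw [r.logSymbol_eq]
    exact X.memXhat_hat _
  obtain ⟨f, g, f', g', v, hA, hA', hv, hex, hrel⟩ := hq.exists_amplitude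
  refine ⟨hex, fun fPlus fMinus a b hd => ?_⟩
  have hab := hrel fPlus fMinus a b hd
  have hne : ∀ k : ℝ, scatA v f g f' g' k ≠ 0 := fun k => hA.scatA_ne_zero hA' hv (by simp)
  have ha : ∀ k : ℝ, k ≠ 0 → a k ≠ 0 := fun k hk h0 => by
    refine hne k ?_
    rw [← (hab k hk).1, h0, mul_zero]
  obtain ⟨rPlus, rMinus, h1, h2, h3⟩ := hA.exists_reflection hA' hv
  refine ⟨ha, rPlus, rMinus, fun k hk => ?_, fun k hk => ?_, h3, ?_⟩
  · have hk' : (k : ℂ) ≠ 0 := by exact_mod_cast hk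
    -- The sign in r₊ comes from evaluating k b(k) at -k: `scatB` at -k is -k b(-k).
    rw [h1, ← (hab k hk).1, ← (hab (-k) (neg_ne_zero.2 hk)).2]
    have := ha k hk
    push_cast
    field_simp
  · have hk' : (k : ℂ) ≠ 0 := by exact_mod_cast hk
    rw [h2, ← (hab k hk).1, ← (hab k hk).2]
    exact mul_div_mul_left _ _ hk'
  · rw [← h3]
    exact RPos.involutive_dual rPlus
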